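/- **Theorem (Moser method for Manin triples).** A *Courant algebroid* over a smooth manifold $M$ is a smooth vector bundle $A\to M$ with a metric $\langle\cdot,\cdot\rangle$ (a non-degenerate symmetric bilinear form) on its fibres, a bundle map $a\colon A\to TM$ over $\mathrm{id}_M$ (the anchor) and an $\mathbb{R}$-bilinear bracket $[\![\cdot,\cdot]\!]$ on $\Gamma(A)$ such that for all $\sigma,\tau_1,\tau_2\in\Gamma(A)$ $$a(\sigma)\langle\tau_1,\tau_2\rangle=\langle[\![\sigma,\tau_1]\!],\tau_2\rangle+\langle\tau_1,[\![\sigma,\tau_2]\!]\rangle,$$ $$[\![\sigma,[\![\tau_1,\tau_2]\!]]\!]=[\![[\![\sigma,\tau_1]\!],\tau_2]\!]+[\![\tau_1,[\![\sigma,\tau_2]\!]]\!],\qquad [\![\tau_1,\tau_2]\!]+[\![\tau_2,\tau_1]\!]=a^*\,d\langle\tau_1,\tau_2\rangle ,$$ where $a^*\colon T^*M\to A^*\cong A$ is the dual of $a$ followed by the identification given by the metric. A *Dirac structure* is a smooth subbundle $E\subset A$ with $E=E^\perp$ whose space of sections is closed under the bracket. For a closed 2-form $\omega$ the *gauge transformation*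 is $R_\omega=\mathrm{id}+a^*\circ\omega^\flat\circ a\colon A\to A$, with $\omega^\flat(X)=\omega(X,\cdot)$. If $E,F\subset A$ are transverse Dirac structures, i.e. $A=E\oplus F$, the associated Poisson structure $\pi$ is given by the composition $\pi^\sharp\colon T^*M\to E^*\cong F\to TM$ of $(a|_E)^*$, the identification $E^*\cong F$ given by the metric, and $a|_F$. Let $A\to M$ be a Courant algebroid with a Dirac structure $E\subset A$, and let $F_s$, $s\in\mathbb{R}$, be a family of Dirac structures transverse to $E$, depending smoothly on $s$, which are gauge equivalent in the sense that $$F_s=R_{\nu_s}(F_0)$$ for a smooth family of closed 2-forms $\nu_s\in\Omega^2(M)$ with $\nu_0=0$. Let $\pi_s$ be the Poisson structure associated with $E,F_s$. Suppose furthermore that $\frac{d}{ds}\nu_s=-d\alpha_s$ for a smooth family of 1-forms $\alpha_s\in\Omega^1(M)$, such that the time-dependent vector field $X_s=\pi_s^\sharp(\alpha_s)$ is complete, that is, for every initial time $s_0$ and every point $x_0\in M$ there is a curve $\gamma\colon\mathbb{R}\to M$, defined for all times, with $\gamma(s_0)=x_0$ and $\gamma'(s)=X_s(\gamma(s))$.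 Then there is a smooth family $\tilde\phi_s$, $s\in\mathbb{R}$, of Courant automorphisms of $A$ (vector bundle automorphisms covering diffeomorphisms of $M$ and preserving anchor, metric and bracket) such that for all $s$ $$\tilde\phi_s(E)=E,\qquad \tilde\phi_s(F_s)=F_0 .$$ -/

import Mathlib

open Bundle Filter
open scoped Manifold ContDiff Topology

noncomputable section

namespace MoserManin

/-! ## Differential forms of degree one and two on a manifold

Throughout, `M` is a smooth manifold without boundary modelled on the finite-dimensional real
vector space `EM`.  Smoothness of tensorial objects is tested on smooth sections. -/

section Forms

variable (EM : Type*) [NormedAddCommGroup EM] [NormedSpace ℝ EM]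
  (M : Type*) [TopologicalSpace M] [ChartedSpace EM M] [IsManifold 𝓘(ℝ, EM) ∞ M]

/-- Smooth vector fields on `M`. -/
abbrev VField : Type _ :=
  ContMDiffSection 𝓘(ℝ, EM) EM ∞ (fun x : M => TangentSpace 𝓘(ℝ, EM) x)

variable {M}

/-- The derivative `v(f)` of a real-valued function `f` at `x` in the direction of the tangent
vector `v`. -/
def dirDeriv (f : M → ℝ) (x : M) (v : TangentSpace 𝓘(ℝ, EM) x) : ℝ :=
  mfderiv 𝓘(ℝ, EM) 𝓘(ℝ, ℝ) f x v

variable (M)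

/-- Smooth 1-forms on `M`. -/
structure OneForm where
  /-- the covector at a point -/
  toFun : ∀ x : M, TangentSpace 𝓘(ℝ, EM) x →ₗ[ℝ] ℝ
  smooth : ∀ X : VField EM M, ContMDiff 𝓘(ℝ, EM) 𝓘(ℝ, ℝ) ∞ (fun x => toFun x (X x))

/-- Smooth 2-forms on `M`. -/
structure TwoForm where
  /-- the bilinear form at a point -/
  toFun : ∀ x : M, TangentSpace 𝓘(ℝ, EM) x →ₗ[ℝ] TangentSpace 𝓘(ℝ, EM) x →ₗ[ℝ] ℝ
  alt : ∀ (x : M) (v : TangentSpace 𝓘(ℝ, EM) x), toFun x v v = 0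
  smooth : ∀ X Y : VField EM M,
    ContMDiff 𝓘(ℝ, EM) 𝓘(ℝ, ℝ) ∞ (fun x => toFun x (X x) (Y x))

variable {EM M}

/-- The exterior derivative of a 1-form, evaluated on two vector fields at the point `x`:
`(dα)(X, Y) = X (α(Y)) - Y (α(X)) - α([X, Y])`. -/
def OneForm.extDeriv (α : OneForm EM M) (X Y : VField EM M) (x : M) : ℝ :=
  dirDeriv EM (fun y => α.toFun y (Y y)) x (X x)
    - dirDeriv EM (fun y => α.toFun y (X y)) x (Y x)
    - α.toFun x (VectorField.mlieBracket 𝓘(ℝ, EM) X Y x)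

/-- The exterior derivative of a 2-form, evaluated on three vector fields at the point `x`. -/
def TwoForm.extDeriv (η : TwoForm EM M) (X Y Z : VField EM M) (x : M) : ℝ :=
  dirDeriv EM (fun y => η.toFun y (Y y) (Z y)) x (X x)
    - dirDeriv EM (fun y => η.toFun y (X y) (Z y)) x (Y x)
    + dirDeriv EM (fun y => η.toFun y (X y) (Y y)) x (Z x)
    - η.toFun x (VectorField.mlieBracket 𝓘(ℝ, EM) X Y x) (Z x)
    + η.toFun x (VectorField.mlieBracket 𝓘(ℝ, EM) X Z x) (Y x)
    - η.toFun x (VectorField.mlieBracket 𝓘(ℝ, EM) Y Z x) (X x)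

/-- A 2-form is closed if its exterior derivative vanishes. -/
def TwoForm.IsClosed (η : TwoForm EM M) : Prop :=
  ∀ (X Y Z : VField EM M) (x : M), η.extDeriv X Y Z x = 0

/-- A family `s ↦ α s` of 1-forms is smooth (jointly in the parameter and the point). -/
def SmoothOneFormFamily (α : ℝ → OneForm EM M) : Prop :=
  ∀ X : VField EM M, ContMDiff (𝓘(ℝ, ℝ).prod 𝓘(ℝ, EM)) 𝓘(ℝ, ℝ) ∞
    (fun p : ℝ × M => (α p.1).toFun p.2 (X p.2))

/-- A family `s ↦ ν s` of 2-forms is smooth (jointly in the parameter and the point). -/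
def SmoothTwoFormFamily (ν : ℝ → TwoForm EM M) : Prop :=
  ∀ X Y : VField EM M, ContMDiff (𝓘(ℝ, ℝ).prod 𝓘(ℝ, EM)) 𝓘(ℝ, ℝ) ∞
    (fun p : ℝ × M => (ν p.1).toFun p.2 (X p.2) (Y p.2))

/-- A time-dependent vector field `X s` is complete if through every point `x₀`, at every
initial time `s₀`, there passes an integral curve `γ'(s) = X s (γ s)` defined for all times. -/
def IsCompleteTimeDependent (X : ℝ → ∀ x : M, TangentSpace 𝓘(ℝ, EM) x) : Prop :=
  ∀ (s₀ : ℝ) (x₀ : M), ∃ γ : ℝ → M, γ s₀ = x₀ ∧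
    ∀ s : ℝ, HasMFDerivAt 𝓘(ℝ, ℝ) 𝓘(ℝ, EM) γ s ((1 : ℝ →L[ℝ] ℝ).smulRight (X s (γ s)))

end Forms

/-! ## Courant algebroids -/

section Courant

variable (EM : Type*) [NormedAddCommGroup EM] [NormedSpace ℝ EM]
  {M : Type*} [TopologicalSpace M] [ChartedSpace EM M] [IsManifold 𝓘(ℝ, EM) ∞ M]
  (F : Type*) [NormedAddCommGroup F] [NormedSpace ℝ F]
  (V : M → Type*) [TopologicalSpace (TotalSpace F V)]
  [∀ x, AddCommGroup (V x)] [∀ x, Module ℝ (V x)] [∀ x, TopologicalSpace (V x)]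
  [FiberBundle F V] [VectorBundle ℝ F V]

/-- Smooth sections of the vector bundle `V`. -/
abbrev Sec : Type _ := ContMDiffSection 𝓘(ℝ, EM) F ∞ V

/-- The structure of a Courant algebroid on the smooth vector bundle `V → M` (with typical
fibre `F`): a metric (non-degenerate symmetric bilinear form) on the fibres, an anchor and an
`ℝ`-bilinear bracket on smooth sections, satisfying the three axioms
`a(σ)⟨τ₁, τ₂⟩ = ⟨⟦σ, τ₁⟧, τ₂⟩ + ⟨τ₁, ⟦σ, τ₂⟧⟩`,
`⟦σ, ⟦τ₁, τ₂⟧⟧ = ⟦⟦σ, τ₁⟧, τ₂⟧ + ⟦τ₁, ⟦σ, τ₂⟧⟧`,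
`⟦τ₁, τ₂⟧ + ⟦τ₂, τ₁⟧ = a^* d⟨τ₁, τ₂⟩`. -/
structure CourantAlgebroid where
  /-- the fibre metric -/
  metric : ∀ x : M, LinearMap.BilinForm ℝ (V x)
  metric_symm : ∀ (x : M) (v w : V x), metric x v w = metric x w v
  metric_nondegenerate : ∀ x : M, (metric x).Nondegenerate
  metric_smooth : ∀ σ τ : Sec EM F V,
    ContMDiff 𝓘(ℝ, EM) 𝓘(ℝ, ℝ) ∞ (fun x => metric x (σ x) (τ x))
  /-- the anchor `a : V → TM` -/
  anchor : ∀ x : M, V x →ₗ[ℝ] TangentSpace 𝓘(ℝ, EM) x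
  anchor_smooth : ∀ σ : Sec EM F V,
    ContMDiff 𝓘(ℝ, EM) (𝓘(ℝ, EM).prod 𝓘(ℝ, EM)) ∞
      (fun x => (TotalSpace.mk' EM x (anchor x (σ x)) : TangentBundle 𝓘(ℝ, EM) M))
  /-- the Courant bracket -/
  bracket : Sec EM F V →ₗ[ℝ] Sec EM F V →ₗ[ℝ] Sec EM F V
  anchor_metric : ∀ (σ τ₁ τ₂ : Sec EM F V) (x : M),
    dirDeriv EM (fun y => metric y (τ₁ y) (τ₂ y)) x (anchor x (σ x)) =
      metric x (bracket σ τ₁ x) (τ₂ x) + metric x (τ₁ x) (bracket σ τ₂ x)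
  jacobi : ∀ σ τ₁ τ₂ : Sec EM F V,
    bracket σ (bracket τ₁ τ₂) = bracket (bracket σ τ₁) τ₂ + bracket τ₁ (bracket σ τ₂)
  /-- The third axiom, paired with an arbitrary `v`: by definition
  `⟨a^* d⟨τ₁, τ₂⟩, v⟩ = d⟨τ₁, τ₂⟩ (a v)`. -/
  bracket_symm : ∀ (τ₁ τ₂ : Sec EM F V) (x : M) (v : V x),
    metric x (bracket τ₁ τ₂ x + bracket τ₂ τ₁ x) v =
      dirDeriv EM (fun y => metric y (τ₁ y) (τ₂ y)) x (anchor x v)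

variable {EM F V}

/-- The dual anchor `a^* : T^*M → V^* ≅ V`, where `V^* ≅ V` through the metric. -/
def CourantAlgebroid.coanchor [FiniteDimensional ℝ F] (A : CourantAlgebroid EM F V) (x : M) :
    (TangentSpace 𝓘(ℝ, EM) x →ₗ[ℝ] ℝ) →ₗ[ℝ] V x :=
  have : FiniteDimensional ℝ (V x) := VectorBundle.finiteDimensional ℝ F V x
  ((A.metric x).toDual (A.metric_nondegenerate x)).symm.toLinearMap ∘ₗ
    (A.anchor x).dualMap

/-- The defining property of `a^*`. -/
theorem CourantAlgebroid.metric_coanchor [FiniteDimensional ℝ F] (A : CourantAlgebroid EM F V)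
    (x : M) (ξ : TangentSpace 𝓘(ℝ, EM) x →ₗ[ℝ] ℝ) (v : V x) :
    A.metric x (A.coanchor x ξ) v = ξ (A.anchor x v) := by
  have : FiniteDimensional ℝ (V x) := VectorBundle.finiteDimensional ℝ F V x
  exact LinearMap.BilinForm.apply_toDual_symm_apply (hB := A.metric_nondegenerate x)
    ((A.anchor x).dualMap ξ) v

/-- The gauge transformation `R_η = id + a^* ∘ η^♭ ∘ a` on the fibre over `x`, where
`η^♭(X) = η(X, ·)`. -/
def CourantAlgebroid.gauge [FiniteDimensional ℝ F] (A : CourantAlgebroid EM F V)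
    (η : TwoForm EM M) (x : M) : V x →ₗ[ℝ] V x :=
  LinearMap.id + A.coanchor x ∘ₗ η.toFun x ∘ₗ A.anchor x

variable (EM F) in
/-- A family of subspaces of the fibres is a smooth subbundle: near every point it has a smooth
frame. -/
def IsSmoothSubbundle (E : ∀ x : M, Submodule ℝ (V x)) : Prop :=
  ∀ x₀ : M, ∃ (k : ℕ) (e : Fin k → Sec EM F V), ∀ᶠ x in 𝓝 x₀,
    LinearIndependent ℝ (fun i => e i x) ∧ Submodule.span ℝ (Set.range fun i => e i x) = E x

/-- Dirac structures: smooth subbundles `E` with `E = E^⊥` whose space of sections is closed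
under the Courant bracket. -/
structure CourantAlgebroid.IsDirac (A : CourantAlgebroid EM F V)
    (E : ∀ x : M, Submodule ℝ (V x)) : Prop where
  subbundle : IsSmoothSubbundle EM F E
  lagrangian : ∀ (x : M) (v : V x), v ∈ E x ↔ ∀ w ∈ E x, A.metric x v w = 0
  involutive : ∀ σ τ : Sec EM F V, (∀ x, σ x ∈ E x) → (∀ x, τ x ∈ E x) →
    ∀ x, A.bracket σ τ x ∈ E x

/-- The map `π^♯ : T^*M → TM` of the Poisson structure associated with a Manin triple
`(A, E, L)`, `A = E ⊕ L`: the composition `T^*M → E^* ≅ L → TM` of the dual of the anchor of `E`,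
the identification of `E^*` with `L` given by the metric, and the anchor of `L`.  The image of
`ξ` in `E^* ≅ L` is the component in `L` of `a^* ξ`, since `E` is isotropic. -/
def CourantAlgebroid.poissonSharp [FiniteDimensional ℝ F] (A : CourantAlgebroid EM F V)
    {E L : ∀ x : M, Submodule ℝ (V x)} (h : ∀ x, IsCompl (E x) (L x)) (x : M) :
    (TangentSpace 𝓘(ℝ, EM) x →ₗ[ℝ] ℝ) →ₗ[ℝ] TangentSpace 𝓘(ℝ, EM) x :=
  A.anchor x ∘ₗ (L x).projection (E x) (h x).symm ∘ₗ A.coanchor x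

/-- Courant algebroid automorphisms: vector bundle automorphisms `(base, fiber)` preserving
anchor, metric and bracket.  Smoothness of the inverse is automatic, since `base` is a
diffeomorphism and `fiber` is a fibrewise linear isomorphism. -/
structure CourantAlgebroid.Automorphism (A : CourantAlgebroid EM F V) where
  /-- the underlying diffeomorphism of the base -/
  base : Diffeomorph 𝓘(ℝ, EM) 𝓘(ℝ, EM) M M ∞
  /-- the linear isomorphisms of the fibres -/
  fiber : ∀ x : M, V x ≃ₗ[ℝ] V (base x)
  smooth : ContMDiff (𝓘(ℝ, EM).prod 𝓘(ℝ, F)) (𝓘(ℝ, EM).prod 𝓘(ℝ, F)) ∞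
    (fun p : TotalSpace F V => TotalSpace.mk' F (base p.proj) (fiber p.proj p.snd))
  map_anchor : ∀ (x : M) (v : V x),
    A.anchor (base x) (fiber x v) = mfderiv 𝓘(ℝ, EM) 𝓘(ℝ, EM) base x (A.anchor x v)
  map_metric : ∀ (x : M) (v w : V x),
    A.metric (base x) (fiber x v) (fiber x w) = A.metric x v w
  /-- If `σ'` and `τ'` are the push-forwards of `σ` and `τ`, then the bracket of `σ'` and `τ'` is
  the push-forward of the bracket of `σ` and `τ`. -/
  map_bracket : ∀ σ τ σ' τ' : Sec EM F V,
    (∀ x, σ' (base x) = fiber x (σ x)) → (∀ x, τ' (base x) = fiber x (τ x)) →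
    ∀ x, A.bracket σ' τ' (base x) = fiber x (A.bracket σ τ x)

/-- The map of the total space of `V` defined by an automorphism. -/
def CourantAlgebroid.Automorphism.toMap {A : CourantAlgebroid EM F V} (φ : A.Automorphism)
    (p : TotalSpace F V) : TotalSpace F V :=
  TotalSpace.mk' F (φ.base p.proj) (φ.fiber p.proj p.snd)

/-- A family `s ↦ φ s` of automorphisms is smooth (jointly in the parameter and the point of the
total space). -/
def CourantAlgebroid.SmoothAutomorphismFamily {A : CourantAlgebroid EM F V}
    (φ : ℝ → A.Automorphism) : Prop :=
  ContMDiff (𝓘(ℝ, ℝ).prod (𝓘(ℝ, EM).prod 𝓘(ℝ, F))) (𝓘(ℝ, EM).prod 𝓘(ℝ, F)) ∞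
    (fun p : ℝ × TotalSpace F V => (φ p.1).toMap p.2)

/-- The automorphism `φ` maps the subbundle `E` onto the subbundle `L`. -/
def CourantAlgebroid.Automorphism.MapsSubbundle {A : CourantAlgebroid EM F V}
    (φ : A.Automorphism) (E L : ∀ x : M, Submodule ℝ (V x)) : Prop :=
  ∀ x : M, (E x).map (φ.fiber x).toLinearMap = L (φ.base x)

end Courant

end MoserManin

end

/-! The automorphisms are the flow of a time-dependent section `σ s` of `A`, acting by the Courant
bracket. Write `a^* α s = ε s + lam s` for the decomposition along `A = E ⊕ L s`, and let
`σ s = - ε s = lam s - a^* α s`. Since `a ∘ a^* = 0`, the vector field `a (σ s)` is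
`π_s^♯ (α s)`, which is complete.

*The flow.* A curve in the total space of `A` is a transport curve if its base point moves with
velocity `a (σ s)` and it is parallel for the derivative along the base curve which acts on sections
as `⟦σ s, ·⟧`. In a frame and a chart this is an ordinary differential equation
(`CourantAlgebroid.isEvolutionLaw`). The smooth local evolution of such an equation is
`exists_local_evolution`, proved with the implicit function theorem for the integral equation on
`C([-2, 2], H)`; `IsEvolutionLaw.contMDiff_evolution` propagates smoothness to all times. As the
equation is linear in the fibres, completeness of `a (σ s)` suffices for the transport curves to
exist for all times (`CourantAlgebroid.exists_transport`).

*The flow consists of automorphisms.* The first axiom of a Courant algebroid says that the metric is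
constant along transport curves (`metric_fiberFlow`), and the Jacobi identity says that the bracket
of two families of sections with `∂_s u = - ⟦σ s, u⟧` is again such a family
(`IsInvariantFamily.bracket`), so the flow preserves brackets (`bracket_fiberFlow`). The anchor is
determined by metric and bracket, hence preserved (`anchor_fiberFlow`).

*The flow preserves `E` and the family `L s`.* A family of Lagrangian subbundles with local frames
`l i s` such that `∂_s l + ⟦σ s, l⟧` remains in the family is preserved, because the pairings of a
transport curve with the frame satisfy a homogeneous linear equation (`fiberFlow_mem`). For `E` this
holds because `E` is involutive and `σ s` is a section of `E`. For `L s` take the frame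
`l s = R_{ν s} l`. By `∂_s ν s = - dα s` and the identity
`⟨⟦a^* α, τ⟧, ρ⟩ = - dα (a τ, a ρ)` (`metric_bracket_coanchorSec`), its derivative is
`∂_s l s = ⟦a^* α s, l s⟧`. Thus `∂_s l s + ⟦σ s, l s⟧ = ⟦lam s, l s⟧`, which is a section of `L s`
because `L s` is involutive. -/

open Bundle Filter
open scoped Manifold ContDiff Topology

noncomputable section

namespace MoserManin

set_option linter.unusedSectionVars false

/-! ### Smooth superposition operators on spaces of continuous functions -/

section Nemytskii

variable {K : Type*} [TopologicalSpace K] [CompactSpace K]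

/-- The pointwise application of a bounded bilinear map to continuous functions on a compact
space. -/
def pointwiseApply (K : Type*) [TopologicalSpace K] [CompactSpace K]
    {W H G : Type*} [NormedAddCommGroup W] [NormedSpace ℝ W] [NormedAddCommGroup H]
    [NormedSpace ℝ H] [NormedAddCommGroup G] [NormedSpace ℝ G] (B : W →L[ℝ] H →L[ℝ] G) :
    C(K, W) →L[ℝ] C(K, H) →L[ℝ] C(K, G) :=
  LinearMap.mkContinuous₂
    (LinearMap.mk₂ ℝ (fun (a : C(K, W)) (d : C(K, H)) =>
      (⟨fun x => B (a x) (d x), (B.continuous.comp a.continuous).clm_apply d.continuous⟩ : C(K, G)))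
      (fun _ _ _ => by ext; simp) (fun _ _ _ => by ext; simp)
      (fun _ _ _ => by ext; simp) (fun _ _ _ => by ext; simp)) ‖B‖
    (fun a d => by
      rw [ContinuousMap.norm_le _ (by positivity)]
      intro x
      refine (B.le_opNorm₂ _ _).trans ?_
      exact mul_le_mul (mul_le_mul_of_nonneg_left (a.norm_coe_le_norm x) B.opNorm_nonneg)
        (d.norm_coe_le_norm x) (norm_nonneg _) (by positivity))

/-- Composition with a map `h` that is differentiable with continuous derivative `B ∘ h'` is
differentiable on the space of continuous maps from a compact space. -/
theorem hasFDerivAt_postcomp {W H G : Type*} [NormedAddCommGroup W] [NormedSpace ℝ W]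
    [NormedAddCommGroup H] [NormedSpace ℝ H]
    [NormedAddCommGroup G] [NormedSpace ℝ G] (B : W →L[ℝ] H →L[ℝ] G) (h : C(H, G)) (h' : C(H, W))
    (hh : ∀ x, HasFDerivAt h (B (h' x)) x) (g : C(K, H)) :
    HasFDerivAt (fun g : C(K, H) => h.comp g) (pointwiseApply K B (h'.comp g)) g := by
  rw [hasFDerivAt_iff_isLittleO, Asymptotics.isLittleO_iff]
  intro ε hε
  have hc : Continuous (fun g : C(K, H) => h'.comp g) := ContinuousMap.continuous_postcomp h'
  have hB : 0 < ‖B‖ + 1 := by positivity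
  obtain ⟨r, hr, hball⟩ := Metric.continuousAt_iff.1 hc.continuousAt (ε / (‖B‖ + 1))
    (by positivity)
  filter_upwards [Metric.ball_mem_nhds g hr] with g₁ hg₁
  rw [ContinuousMap.norm_le _ (by positivity)]
  intro x
  have hx : ‖g₁ x - g x‖ ≤ ‖g₁ - g‖ := (g₁ - g).norm_coe_le_norm x
  have hlt : ‖g₁ x - g x‖ < r := by
    rw [Metric.mem_ball, dist_eq_norm] at hg₁
    exact hx.trans_lt hg₁
  have key : ‖h (g₁ x) - h (g x) - B (h' (g x)) (g₁ x - g x)‖ ≤ ε * ‖g₁ x - g x‖ := by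
    refine Convex.norm_image_sub_le_of_norm_hasFDerivWithin_le' (s := Metric.ball (g x) r)
      (f' := fun y => B (h' y)) (fun y _ => (hh y).hasFDerivWithinAt) (fun y hy => ?_)
      (convex_ball _ _) (Metric.mem_ball_self hr) (by simpa [dist_eq_norm] using hlt)
    -- a vector near `g x` is the value at `x` of a translate of `g`
    have h1 : dist (g + ContinuousMap.const K (y - g x)) g < r := by
      rw [dist_eq_norm, add_sub_cancel_left]
      refine lt_of_le_of_lt ((ContinuousMap.norm_le _ (norm_nonneg (y - g x))).2 fun z => ?_)
        (by simpa [dist_eq_norm] using hy)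
      simp
    have h2 := (ContinuousMap.norm_coe_le_norm
      (h'.comp (g + ContinuousMap.const K (y - g x)) - h'.comp g) x)
    have h3 := hball h1
    rw [dist_eq_norm] at h3
    have h4 : ‖h' y - h' (g x)‖ ≤ ε / (‖B‖ + 1) := by simpa using h2.trans h3.le
    rw [← map_sub]
    calc ‖B (h' y - h' (g x))‖ ≤ ‖B‖ * ‖h' y - h' (g x)‖ := B.le_opNorm _
      _ ≤ (‖B‖ + 1) * (ε / (‖B‖ + 1)) := by gcongr; linarith
      _ = ε := by field_simp
  refine le_trans (le_of_eq ?_) (key.trans (mul_le_mul_of_nonneg_left hx hε.le))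
  simp [pointwiseApply]

/-- Composition with a smooth map is smooth on the space of continuous maps from a compact
space. -/
theorem contDiff_postcomp {H : Type*} [NormedAddCommGroup H] [NormedSpace ℝ H]
    {h : H → H} (hh : ContDiff ℝ ∞ h) :
    ContDiff ℝ ∞ (fun g : C(K, H) => (⟨h, hh.continuous⟩ : C(H, H)).comp g) := by
  suffices H' : ∀ (n : ℕ) {G : Type _} [NormedAddCommGroup G] [NormedSpace ℝ G] {h : H → G}
      (hh : ContDiff ℝ ∞ h),
      ContDiff ℝ n (fun g : C(K, H) => (⟨h, hh.continuous⟩ : C(H, G)).comp g) from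
    contDiff_infty.2 fun n => H' n hh
  intro n
  induction n with
  | zero =>
    intro G _ _ h hh
    exact contDiff_zero.2 (ContinuousMap.continuous_postcomp _)
  | succ n ih =>
    intro G _ _ h hh
    have hd : ContDiff ℝ ∞ (fderiv ℝ h) := hh.fderiv_right (by simp)
    exact_mod_cast contDiff_succ_iff_hasFDerivAt.2 ⟨_,
      (pointwiseApply K (ContinuousLinearMap.id ℝ (H →L[ℝ] G))).contDiff.comp (ih hd), fun g =>
        hasFDerivAt_postcomp (ContinuousLinearMap.id ℝ (H →L[ℝ] G)) ⟨h, hh.continuous⟩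
          ⟨fderiv ℝ h, hd.continuous⟩
          (fun x => (hh.differentiable (by simp)).differentiableAt.hasFDerivAt) g⟩

end Nemytskii

/-! ### Smooth local evolution of vector fields on Banach spaces -/

section LocalFlow

/-- The interval on which the rescaled integral curves are defined. -/
abbrev TimeInterval : Type := Set.Icc (-2 : ℝ) 2

/-- The extension of a function on `[-2, 2]` to the line, constant on both sides. -/
abbrev extendTime {H : Type*} [NormedAddCommGroup H] (g : C(TimeInterval, H)) (t : ℝ) : H :=
  g (Set.projIcc (-2) 2 (by norm_num) t)

theorem continuous_extendTime {H : Type*} [NormedAddCommGroup H] (g : C(TimeInterval, H)) :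
    Continuous (extendTime g) := g.continuous.comp continuous_projIcc

/-- The primitive vanishing at `0`, as a bounded operator on `C([-2, 2], H)`. -/
def primitive (H : Type*) [NormedAddCommGroup H] [NormedSpace ℝ H] :
    C(TimeInterval, H) →L[ℝ] C(TimeInterval, H) :=
  LinearMap.mkContinuous
    { toFun := fun g => ⟨fun t => ∫ τ in (0 : ℝ)..t, extendTime g τ,
        (intervalIntegral.continuous_primitive
          (fun _ _ => (continuous_extendTime g).intervalIntegrable _ _) 0).comp
          continuous_subtype_val⟩
      map_add' := fun g₁ g₂ => by
        ext t
        exact intervalIntegral.integral_add ((continuous_extendTime g₁).intervalIntegrable _ _)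
          ((continuous_extendTime g₂).intervalIntegrable _ _)
      map_smul' := fun c g => by
        ext t
        exact intervalIntegral.integral_smul c _ } 2
    (fun g => by
      rw [ContinuousMap.norm_le _ (by positivity)]
      intro t
      have h := intervalIntegral.norm_integral_le_of_norm_le_const (a := 0) (b := (t : ℝ))
        (f := extendTime g) (C := ‖g‖) (fun τ _ => g.norm_coe_le_norm _)
      have ht : |(t : ℝ) - 0| ≤ 2 := by rw [sub_zero]; exact abs_le.2 t.2
      calc _ ≤ ‖g‖ * |(t : ℝ) - 0| := h
        _ ≤ ‖g‖ * 2 := by gcongr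
        _ = 2 * ‖g‖ := mul_comm _ _)

theorem primitive_apply {H : Type*} [NormedAddCommGroup H] [NormedSpace ℝ H]
    (g : C(TimeInterval, H)) (t : TimeInterval) :
    primitive H g t = ∫ τ in (0 : ℝ)..t, extendTime g τ := rfl

variable {H : Type*} [NormedAddCommGroup H] [NormedSpace ℝ H] [CompleteSpace H]

/-- If `g = p + ε ∫ h ∘ g` on `[-2, 2]`, then `g` is an integral curve of `ε h` starting at `p`. -/
theorem hasDerivAt_of_eq_primitive {h : C(H, H)} {g : C(TimeInterval, H)} {p : H} {ε : ℝ}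
    (hg : g - ContinuousMap.const _ p - ε • primitive H (h.comp g) = 0) :
    extendTime g 0 = p ∧
      ∀ t ∈ Set.Ioo (-2 : ℝ) 2, HasDerivAt (extendTime g) (ε • h (extendTime g t)) t := by
  have hval : ∀ t ∈ Set.Icc (-2 : ℝ) 2,
      extendTime g t = p + ε • ∫ τ in (0 : ℝ)..t, extendTime (h.comp g) τ := by
    intro t ht
    have h1 := congrArg (fun k : C(TimeInterval, H) => k ⟨t, ht⟩) hg
    simp only [ContinuousMap.sub_apply, ContinuousMap.const_apply, ContinuousMap.smul_apply,
      primitive_apply, ContinuousMap.zero_apply] at h1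
    rw [extendTime, Set.projIcc_of_mem _ ht]
    rw [sub_sub, sub_eq_zero] at h1
    exact h1
  refine ⟨by simpa using hval 0 (by norm_num), fun t ht => ?_⟩
  have hcont := continuous_extendTime (h.comp g)
  have hd : HasDerivAt (fun t => p + ε • ∫ τ in (0 : ℝ)..t, extendTime (h.comp g) τ)
      (ε • extendTime (h.comp g) t) t :=
    ((intervalIntegral.integral_hasDerivAt_right (hcont.intervalIntegrable _ _)
      (hcont.stronglyMeasurableAtFilter _ _) hcont.continuousAt).const_smul ε).const_add p
  refine hd.congr_of_eventuallyEq ?_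
  filter_upwards [Ioo_mem_nhds ht.1 ht.2] with τ hτ
  exact hval τ (Set.Ioo_subset_Icc_self hτ)

/-- Smooth local flow of an autonomous smooth vector field on a Banach space. The integral curves
`g` of `ε h` on `[-2, 2]` starting at `p` are the zeros of `g - p - ε ∫ h ∘ g`, so they depend
smoothly on `(ε, p)` by the implicit function theorem; the flow is `(t, p) ↦ g_{t, p} 1`. -/
theorem exists_local_flow_autonomous {h : H → H} (hh : ContDiff ℝ ∞ h) (p₀ : H) :
    ∃ Θ : ℝ × H → H, ContDiffAt ℝ ∞ Θ (0, p₀) ∧ ∃ ε > 0, ∀ᶠ p in 𝓝 p₀, Θ (0, p) = p ∧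
      ∀ t ∈ Set.Ioo (-ε) ε, HasDerivAt (fun t => Θ (t, p)) (h (Θ (t, p))) t := by
  set X := C(TimeInterval, H)
  set hc : C(H, H) := ⟨h, hh.continuous⟩
  set Fn : (ℝ × H) × X → X := fun z =>
    z.2 - ContinuousLinearMap.const ℝ TimeInterval z.1.2 - z.1.1 • primitive H (hc.comp z.2)
    with hFn
  have hFs : ContDiff ℝ ∞ Fn := by
    refine (contDiff_snd.sub ((ContinuousLinearMap.contDiff _).comp
      (contDiff_snd.comp contDiff_fst))).sub ((contDiff_fst.comp contDiff_fst).smul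
        ((primitive H).contDiff.comp ((contDiff_postcomp hh).comp contDiff_snd)))
  set u : (ℝ × H) × X := ((0, p₀), ContinuousLinearMap.const ℝ TimeInterval p₀)
  have hu : Fn u = 0 := by simp [hFn, u]
  have hinv : (fderiv ℝ Fn u ∘L .inr ℝ (ℝ × H) X).IsInvertible := by
    have h1 : HasFDerivAt (fun y : X => Fn (u.1, y))
        (fderiv ℝ Fn u ∘L .inr ℝ (ℝ × H) X) u.2 :=
      ((hFs.differentiable (by simp)).differentiableAt.hasFDerivAt (x := u)).comp u.2
        (hasFDerivAt_prodMk_right u.1 u.2)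
    have h2 : HasFDerivAt (fun y : X => Fn (u.1, y)) (ContinuousLinearMap.id ℝ X) u.2 := by
      have : (fun y : X => Fn (u.1, y)) =
          fun y => y - ContinuousLinearMap.const ℝ TimeInterval p₀ := by
        ext y t; simp [hFn, u]; rfl
      rw [this]
      exact (hasFDerivAt_id _).sub_const _
    rw [h1.unique h2]
    exact ⟨ContinuousLinearEquiv.refl ℝ X, rfl⟩
  have hpn : (∞ : ℕ∞ω) ≠ 0 := by simp
  have cdf : ContDiffAt ℝ ∞ Fn u := hFs.contDiffAt
  set ψ : ℝ × H → X := cdf.implicitFunction hpn hinv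
  have hψs : ContDiffAt ℝ ∞ ψ (0, p₀) := cdf.contDiffAt_implicitFunction hpn hinv
  have hψ0 : ψ (0, p₀) = ContinuousLinearMap.const ℝ TimeInterval p₀ :=
    cdf.implicitFunction_apply_self hpn hinv
  have hψe : ∀ᶠ z in 𝓝 ((0 : ℝ), p₀), Fn (z, ψ z) = 0 := by
    simpa [hu] using cdf.eventually_apply_implicitFunction hpn hinv
  obtain ⟨L, S, hS, hL⟩ := (hh.contDiffAt (x := p₀)).of_le
    (show (1 : ℕ∞ω) ≤ ∞ by simp) |>.exists_lipschitzOnWith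
  obtain ⟨r, hr, hrS⟩ := Metric.mem_nhds_iff.1 hS
  have hψb : ∀ᶠ z in 𝓝 ((0 : ℝ), p₀), ∀ t, extendTime (ψ z) t ∈ S := by
    have := hψs.continuousAt.eventually (Metric.ball_mem_nhds _ hr)
    filter_upwards [this] with z hz t
    refine hrS ?_
    rw [hψ0, dist_eq_norm] at hz
    rw [Metric.mem_ball, dist_eq_norm]
    exact ((ψ z - ContinuousLinearMap.const ℝ TimeInterval p₀).norm_coe_le_norm _).trans_lt hz
  obtain ⟨T, hT, U, hU, hTU⟩ := mem_nhds_prod_iff.1 (hψe.and hψb)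
  obtain ⟨δ, hδ, hδT⟩ := Metric.mem_nhds_iff.1 hT
  have hsub : ∀ ε ∈ Set.Ioo (-δ) δ, ∀ p ∈ U, Fn ((ε, p), ψ (ε, p)) = 0 ∧
      ∀ t, extendTime (ψ (ε, p)) t ∈ S := fun ε hε p hp =>
    hTU ⟨hδT (by simpa [Real.ball_eq_Ioo] using hε), hp⟩
  refine ⟨fun z => extendTime (ψ z) 1, ?_, δ / 2, by positivity, ?_⟩
  · exact (ContinuousMap.evalCLM ℝ (M := H)
      (Set.projIcc (-2 : ℝ) 2 (by norm_num) 1)).contDiff.contDiffAt.comp _ hψs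
  filter_upwards [hU] with p hp
  set ε := δ / 2 with hε
  have hε0 : 0 < ε := by positivity
  obtain ⟨hFε, hSε⟩ := hsub ε ⟨by linarith, by linarith⟩ p hp
  obtain ⟨hε1, hε2⟩ := hasDerivAt_of_eq_primitive (h := hc) hFε
  -- the unscaled integral curve through `p`
  set c : ℝ → H := fun t => extendTime (ψ (ε, p)) (t / ε) with hcdef
  have hcd : ∀ t ∈ Set.Ioo (-(2 * ε)) (2 * ε), HasDerivAt c (h (c t)) t := by
    intro t ht
    have ht' : t / ε ∈ Set.Ioo (-2 : ℝ) 2 :=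
      ⟨by rw [lt_div_iff₀ hε0]; linarith [ht.1], by rw [div_lt_iff₀ hε0]; linarith [ht.2]⟩
    have := (hε2 _ ht').scomp t ((hasDerivAt_id t).div_const ε)
    refine this.congr_deriv ?_
    rw [smul_smul, one_div_mul_cancel hε0.ne', one_smul]
    rfl
  have huniq : ∀ t ∈ Set.Ioo (-ε) ε, extendTime (ψ (t, p)) 1 = c t := by
    intro t ht
    obtain ⟨hF1, hS1⟩ := hsub t ⟨by linarith [ht.1], by linarith [ht.2]⟩ p hp
    obtain ⟨h1, h2⟩ := hasDerivAt_of_eq_primitive (h := hc) hF1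
    have hEq : Set.EqOn (extendTime (ψ (t, p))) (fun τ => c (t * τ)) (Set.Ioo (-2) 2) := by
      refine ODE_solution_unique_of_mem_Ioo (v := fun _ y => t • h y) (s := fun _ => S)
        (K := ‖t‖₊ * L) (t₀ := 0)
        (fun _ _ => ?_) (by norm_num) (fun τ hτ => ⟨h2 τ hτ, hS1 τ⟩) (fun τ hτ => ⟨?_, hSε _⟩) ?_
      · exact (lipschitzWith_smul t).comp_lipschitzOnWith hL
      · have hτ' : t * τ ∈ Set.Ioo (-(2 * ε)) (2 * ε) := by
          rw [Set.mem_Ioo, ← abs_lt, abs_mul]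
          have := abs_lt.2 ht
          have h2 := abs_lt.2 hτ
          nlinarith [abs_nonneg t, abs_nonneg τ]
        have := (hcd _ hτ').scomp τ ((hasDerivAt_id τ).const_mul t)
        exact this.congr_deriv (by simp)
      · rw [h1, hcdef]
        simp only [mul_zero, zero_div]
        exact hε1.symm
    simpa using hEq (show (1 : ℝ) ∈ Set.Ioo (-2 : ℝ) 2 by norm_num)
  refine ⟨?_, fun t ht => ?_⟩
  · rw [huniq 0 ⟨by linarith, hε0⟩, hcdef]
    simpa using hε1
  · have h1 := hcd t ⟨by linarith [ht.1], by linarith [ht.2]⟩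
    simp only [huniq t ht]
    refine h1.congr_of_eventuallyEq ?_
    filter_upwards [Ioo_mem_nhds ht.1 ht.2] with τ hτ using huniq τ hτ

/-- Smooth local evolution of a time-dependent smooth vector field on a Banach space. -/
theorem exists_local_evolution {f : ℝ × H → H} (hf : ContDiff ℝ ∞ f) (s₀ : ℝ) (p₀ : H) :
    ∃ Θ : ℝ × ℝ × H → H, ContDiffAt ℝ ∞ Θ (s₀, s₀, p₀) ∧ ∃ ε > 0, ∀ᶠ q in 𝓝 (s₀, p₀),
      Θ (q.1, q) = q.2 ∧
      ∀ t ∈ Set.Ioo (s₀ - ε) (s₀ + ε), HasDerivAt (fun t => Θ (t, q)) (f (t, Θ (t, q))) t := by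
  have hh : ContDiff ℝ ∞ (fun z : ℝ × H => ((1 : ℝ), f z)) := contDiff_const.prodMk hf
  obtain ⟨Θ, hΘ, ε, hε, h⟩ := exists_local_flow_autonomous hh (s₀, p₀)
  refine ⟨fun z => (Θ (z.1 - z.2.1, z.2)).2, ?_, ε / 2, by positivity, ?_⟩
  · refine contDiff_snd.contDiffAt.comp _ (ContDiffAt.comp _ ?_ ?_)
    · simpa using hΘ
    · exact ((contDiff_fst.sub (contDiff_fst.comp contDiff_snd)).prodMk
        contDiff_snd).contDiffAt
  have hnear : ∀ᶠ q : ℝ × H in 𝓝 (s₀, p₀), q.1 ∈ Set.Ioo (s₀ - ε / 2) (s₀ + ε / 2) :=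
    continuous_fst.continuousAt.eventually (Ioo_mem_nhds (by simp; linarith) (by simp; linarith))
  filter_upwards [h, hnear] with q hq hqn
  refine ⟨by simp [hq.1], fun t ht => ?_⟩
  have hfst : ∀ τ ∈ Set.Ioo (-ε) ε, (Θ (τ, q)).1 = q.1 + τ := by
    have hd : ∀ τ ∈ Set.Ioo (-ε) ε,
        HasDerivAt (fun τ => (Θ (τ, q)).1 - (q.1 + τ)) 0 τ := fun τ hτ => by
      have h1 : HasDerivAt (fun τ => (Θ (τ, q)).1) 1 τ :=
        (ContinuousLinearMap.fst ℝ ℝ H).hasFDerivAt.comp_hasDerivAt τ (hq.2 τ hτ)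
      exact (h1.sub ((hasDerivAt_id τ).const_add q.1)).congr_deriv (sub_self 1)
    intro τ hτ
    have := (convex_Ioo (-ε) ε).is_const_of_fderivWithin_eq_zero (𝕜 := ℝ)
      (f := fun τ => (Θ (τ, q)).1 - (q.1 + τ))
      (fun τ hτ => (hd τ hτ).differentiableAt.differentiableWithinAt)
      (fun τ hτ => by
        rw [fderivWithin_of_isOpen isOpen_Ioo hτ]
        ext
        simp [(hd τ hτ).hasFDerivAt.fderiv]) hτ (show (0 : ℝ) ∈ Set.Ioo (-ε) ε from
          ⟨by linarith, hε⟩)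
    simp only [hq.1, add_zero, sub_self] at this
    linarith
  have ht' : t - q.1 ∈ Set.Ioo (-ε) ε :=
    ⟨by linarith [ht.1, hqn.2], by linarith [ht.2, hqn.1]⟩
  have h1 := (ContinuousLinearMap.snd ℝ ℝ H).hasFDerivAt.comp_hasDerivAt t
    ((hq.2 _ ht').comp_sub_const t q.1)
  have h2 : Θ (t - q.1, q) = (t, (Θ (t - q.1, q)).2) := Prod.ext (by rw [hfst _ ht']; ring) rfl
  refine h1.congr_deriv ?_
  rw [← h2]
  rfl

end LocalFlow

/-! ### Directional derivatives on manifolds -/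

section Calculus

variable {EM : Type*} [NormedAddCommGroup EM] [NormedSpace ℝ EM]
  {M : Type*} [TopologicalSpace M] [ChartedSpace EM M]

theorem dirDeriv_sub {f g : M → ℝ} {x : M} (hf : MDifferentiableAt 𝓘(ℝ, EM) 𝓘(ℝ, ℝ) f x)
    (hg : MDifferentiableAt 𝓘(ℝ, EM) 𝓘(ℝ, ℝ) g x) (v : TangentSpace 𝓘(ℝ, EM) x) :
    dirDeriv EM (fun y => f y - g y) x v = dirDeriv EM f x v - dirDeriv EM g x v :=
  congrArg (fun L => L v) (mvfderiv_sub hf hg)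

theorem dirDeriv_mul {f g : M → ℝ} {x : M} (hf : MDifferentiableAt 𝓘(ℝ, EM) 𝓘(ℝ, ℝ) f x)
    (hg : MDifferentiableAt 𝓘(ℝ, EM) 𝓘(ℝ, ℝ) g x) (v : TangentSpace 𝓘(ℝ, EM) x) :
    dirDeriv EM (fun y => f y * g y) x v
      = f x * dirDeriv EM g x v + g x * dirDeriv EM f x v :=
  congrArg (fun L => L v) (mvfderiv_mul hf hg)

theorem dirDeriv_congr {f g : M → ℝ} {x : M} (h : f =ᶠ[𝓝 x] g) (v : TangentSpace 𝓘(ℝ, EM) x) :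
    dirDeriv EM f x v = dirDeriv EM g x v := by
  have := h.mfderiv_eq (I := 𝓘(ℝ, EM)) (I' := 𝓘(ℝ, ℝ))
  unfold dirDeriv
  exact congrArg (fun L : EM →L[ℝ] ℝ => L v) this

/-- The derivative `df` of a function, as a covector. -/
def covector (EM : Type*) [NormedAddCommGroup EM] [NormedSpace ℝ EM]
    {M : Type*} [TopologicalSpace M] [ChartedSpace EM M] (f : M → ℝ) (x : M) :
    TangentSpace 𝓘(ℝ, EM) x →ₗ[ℝ] ℝ :=
  (mvfderiv 𝓘(ℝ, EM) f x).toLinearMap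

/-- Chain rule along a curve. -/
theorem hasDerivAt_comp_curve {f : M → ℝ} {γ : ℝ → M} {t : ℝ}
    {v : TangentSpace 𝓘(ℝ, EM) (γ t)}
    (hf : MDifferentiableAt 𝓘(ℝ, EM) 𝓘(ℝ, ℝ) f (γ t))
    (hγ : HasMFDerivAt 𝓘(ℝ, ℝ) 𝓘(ℝ, EM) γ t ((1 : ℝ →L[ℝ] ℝ).smulRight v)) :
    HasDerivAt (fun s => f (γ s)) (dirDeriv EM f (γ t) v) t := by
  have h : HasFDerivAt (fun s => f (γ s)) ((mvfderiv 𝓘(ℝ, EM) f (γ t) : EM →L[ℝ] ℝ).comp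
      ((1 : ℝ →L[ℝ] ℝ).smulRight (v : EM))) t :=
    hasMFDerivAt_iff_hasFDerivAt.1 (hf.hasMFDerivAt.comp t hγ)
  refine h.hasDerivAt.congr_deriv ?_
  change (mvfderiv 𝓘(ℝ, EM) f (γ t) : EM →L[ℝ] ℝ) ((1 : ℝ) • (v : EM)) = dirDeriv EM f (γ t) v
  rw [one_smul]
  rfl

variable [FiniteDimensional ℝ EM] [T2Space M] [IsManifold 𝓘(ℝ, EM) ∞ M]

/-- Smooth germs of functions with values in a vector space extend to global smooth functions. -/
theorem exists_smooth_eventuallyEq {G : Type*} [NormedAddCommGroup G] [NormedSpace ℝ G]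
    {f : M → G} {x : M} (hf : ∀ᶠ y in 𝓝 x, ContMDiffAt 𝓘(ℝ, EM) 𝓘(ℝ, G) ∞ f y) :
    ∃ g : M → G, ContMDiff 𝓘(ℝ, EM) 𝓘(ℝ, G) ∞ g ∧ g =ᶠ[𝓝 x] f := by
  obtain ⟨u, hu, huo, hxu⟩ := eventually_nhds_iff.1 hf
  obtain ⟨ρ, -, hρ⟩ := (SmoothBumpFunction.nhds_basis_tsupport (I := 𝓘(ℝ, EM)) x).mem_iff.1
    (huo.mem_nhds hxu)
  refine ⟨fun y => ρ y • f y, ?_, ?_⟩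
  · refine contMDiff_of_tsupport fun y hy => ?_
    have hy' : y ∈ tsupport ρ := tsupport_smul_subset_left _ _ hy
    exact (ρ.contMDiff y).smul (hu y (hρ hy'))
  · filter_upwards [ρ.eventuallyEq_one] with y hy
    simp [hy]

/-- A global smooth map to the model space that is the chart near `x`. -/
theorem exists_smooth_eventuallyEq_extChartAt (x : M) :
    ∃ g : M → EM, ContMDiff 𝓘(ℝ, EM) 𝓘(ℝ, EM) ∞ g ∧ g =ᶠ[𝓝 x] extChartAt 𝓘(ℝ, EM) x := by
  refine exists_smooth_eventuallyEq ?_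
  filter_upwards [(isOpen_extChartAt_source (I := 𝓘(ℝ, EM)) x).mem_nhds
    (mem_extChartAt_source x)] with y hy
  exact contMDiffAt_extChartAt' (by simpa using hy)

/-- A tangent vector is determined by the derivatives of the components of a chart. -/
theorem dirDeriv_ext_of_chart {ι : Type*} (b : Module.Basis ι ℝ EM) {x₀ x : M}
    (hx : x ∈ (extChartAt 𝓘(ℝ, EM) x₀).source) {g : M → EM}
    (hg : ContMDiff 𝓘(ℝ, EM) 𝓘(ℝ, EM) ∞ g) (hgx : g =ᶠ[𝓝 x] extChartAt 𝓘(ℝ, EM) x₀)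
    {v w : TangentSpace 𝓘(ℝ, EM) x}
    (h : ∀ l, dirDeriv EM (fun y => b.repr (g y) l) x v =
      dirDeriv EM (fun y => b.repr (g y) l) x w) : v = w := by
  obtain ⟨L, hL⟩ := isInvertible_mfderiv_extChartAt (I := 𝓘(ℝ, EM)) hx
  have hd : (mvfderiv 𝓘(ℝ, EM) g x v : EM) = mvfderiv 𝓘(ℝ, EM) g x w := by
    refine b.ext_elem fun l => ?_
    have hcomp : ∀ u : TangentSpace 𝓘(ℝ, EM) x, dirDeriv EM (fun y => b.repr (g y) l) x u =
        b.repr (mvfderiv 𝓘(ℝ, EM) g x u : EM) l := by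
      intro u
      set l' : EM →L[ℝ] ℝ := LinearMap.toContinuousLinearMap (b.coord l)
      have h1 : HasMFDerivAt 𝓘(ℝ, EM) 𝓘(ℝ, ℝ) l' (g x) l' := l'.hasMFDerivAt
      have h2 := (h1.comp x (hg.mdifferentiableAt (by simp) (x := x)).hasMFDerivAt).mfderiv
      unfold dirDeriv
      exact congrArg (fun L : EM →L[ℝ] ℝ => L u) h2
    rw [← hcomp, ← hcomp, h l]
  have hE : mvfderiv 𝓘(ℝ, EM) g x = mvfderiv 𝓘(ℝ, EM) (extChartAt 𝓘(ℝ, EM) x₀) x :=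
    hgx.mfderiv_eq (I := 𝓘(ℝ, EM)) (I' := 𝓘(ℝ, EM))
  have hd' : mfderiv 𝓘(ℝ, EM) 𝓘(ℝ, EM) (extChartAt 𝓘(ℝ, EM) x₀) x v =
      mfderiv 𝓘(ℝ, EM) 𝓘(ℝ, EM) (extChartAt 𝓘(ℝ, EM) x₀) x w := by
    rw [hE] at hd
    exact hd
  rw [← hL] at hd'
  exact L.injective hd'

/-- Tangent vectors are separated by the derivatives of smooth functions. -/
theorem dirDeriv_ext {x : M} {v w : TangentSpace 𝓘(ℝ, EM) x}
    (h : ∀ f : M → ℝ, ContMDiff 𝓘(ℝ, EM) 𝓘(ℝ, ℝ) ∞ f →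
      dirDeriv EM f x v = dirDeriv EM f x w) : v = w := by
  obtain ⟨g, hg, hgx⟩ := exists_smooth_eventuallyEq_extChartAt (EM := EM) x
  set b := Module.finBasis ℝ EM
  exact dirDeriv_ext_of_chart b (mem_extChartAt_source x) hg hgx fun l =>
    h _ ((LinearMap.toContinuousLinearMap (b.coord l)).contMDiff.comp hg)

end Calculus

/-! ### Sections and local frames of vector bundles -/

section Sections

variable {EM : Type*} [NormedAddCommGroup EM] [NormedSpace ℝ EM] [FiniteDimensional ℝ EM]
  {M : Type*} [TopologicalSpace M] [T2Space M] [ChartedSpace EM M] [IsManifold 𝓘(ℝ, EM) ∞ M]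
  {F : Type*} [NormedAddCommGroup F] [NormedSpace ℝ F]
  {V : M → Type*} [TopologicalSpace (TotalSpace F V)]
  [∀ x, AddCommGroup (V x)] [∀ x, Module ℝ (V x)] [∀ x, TopologicalSpace (V x)]
  [FiberBundle F V] [VectorBundle ℝ F V]

/-- The product of a smooth function and a smooth section. -/
def fsmul (f : M → ℝ) (hf : ContMDiff 𝓘(ℝ, EM) 𝓘(ℝ, ℝ) ∞ f) (σ : Sec EM F V) : Sec EM F V :=
  ⟨fun x => f x • σ x, hf.smul_section σ.contMDiff_toFun⟩

@[simp] theorem fsmul_apply (f : M → ℝ) (hf : ContMDiff 𝓘(ℝ, EM) 𝓘(ℝ, ℝ) ∞ f) (σ : Sec EM F V)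
    (x : M) : fsmul f hf σ x = f x • σ x := rfl

/-- Smooth germs of sections extend to global smooth sections. -/
theorem exists_sec_eventuallyEq {s : ∀ x, V x} {x : M}
    (hs : ∀ᶠ y in 𝓝 x, ContMDiffAt 𝓘(ℝ, EM) (𝓘(ℝ, EM).prod 𝓘(ℝ, F)) ∞
      (fun x => TotalSpace.mk' F x (s x)) y) :
    ∃ σ : Sec EM F V, ∀ᶠ y in 𝓝 x, σ y = s y := by
  obtain ⟨u, hu, huo, hxu⟩ := eventually_nhds_iff.1 hs
  obtain ⟨ρ, -, hρ⟩ := (SmoothBumpFunction.nhds_basis_tsupport (I := 𝓘(ℝ, EM)) x).mem_iff.1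
    (huo.mem_nhds hxu)
  refine ⟨⟨fun y => ρ y • s y, ?_⟩, ?_⟩
  · exact ContMDiffOn.smul_section_of_tsupport (ρ.contMDiff.contMDiffOn) huo hρ
      (fun y hy => (hu y hy).contMDiffWithinAt)
  · filter_upwards [ρ.eventuallyEq_one] with y hy
    change ρ y • s y = s y
    simp [hy]

variable [FiniteDimensional ℝ F] [ContMDiffVectorBundle ∞ F V 𝓘(ℝ, EM)]

/-- Near every point there is a frame of the bundle consisting of global smooth sections. -/
theorem exists_frame (EM F) [NormedAddCommGroup EM] [NormedSpace ℝ EM] [FiniteDimensional ℝ EM]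
    [NormedAddCommGroup F] [NormedSpace ℝ F] [FiniteDimensional ℝ F] [ChartedSpace EM M]
    [IsManifold 𝓘(ℝ, EM) ∞ M] [TopologicalSpace (TotalSpace F V)]
    [FiberBundle F V] [VectorBundle ℝ F V] [ContMDiffVectorBundle ∞ F V 𝓘(ℝ, EM)] (x₀ : M) :
    ∃ e : Fin (Module.finrank ℝ F) → Sec EM F V, ∀ᶠ x in 𝓝 x₀,
      LinearIndependent ℝ (fun i => e i x) ∧ Submodule.span ℝ (Set.range fun i => e i x) = ⊤ := by
  set t := trivializationAt F V x₀
  set b := Module.finBasis ℝ F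
  have hfr := t.isLocalFrameOn_localFrame_baseSet 𝓘(ℝ, EM) ∞ b
  have hx₀ : x₀ ∈ t.baseSet := mem_baseSet_trivializationAt F V x₀
  have hloc : ∀ i, ∃ σ : Sec EM F V, ∀ᶠ y in 𝓝 x₀, σ y = t.localFrame b i y := fun i =>
    exists_sec_eventuallyEq (by
      filter_upwards [t.open_baseSet.mem_nhds hx₀] with y hy
      exact hfr.contMDiffAt t.open_baseSet hy i)
  choose e he using hloc
  refine ⟨e, ?_⟩
  filter_upwards [eventually_all.2 he, t.open_baseSet.mem_nhds hx₀] with y hy hyb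
  have : (fun i => e i y) = fun i => t.localFrame b i y := funext hy
  rw [this]
  exact ⟨hfr.linearIndependent hyb, top_le_iff.1 (hfr.generating hyb)⟩

theorem exists_sec_apply (x : M) (v : V x) : ∃ σ : Sec EM F V, σ x = v := by
  obtain ⟨e, he⟩ := exists_frame EM F (V := V) x
  have hv : v ∈ Submodule.span ℝ (Set.range fun i => e i x) := by
    rw [he.self_of_nhds.2]; trivial
  obtain ⟨c, hc⟩ := (Submodule.mem_span_range_iff_exists_fun ℝ).1 hv
  refine ⟨∑ i, c i • e i, ?_⟩
  rw [← hc]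
  have := map_sum (⟨⟨fun σ : Sec EM F V => σ x, rfl⟩, fun _ _ => rfl⟩ : Sec EM F V →+ V x)
    (fun i => c i • e i) Finset.univ
  exact this

end Sections

/-! ### Smoothness of the matrix inverse -/

section MatrixInverse

variable {EN : Type*} [NormedAddCommGroup EN] [NormedSpace ℝ EN] {HN : Type*} [TopologicalSpace HN]
  {J : ModelWithCorners ℝ EN HN} {N : Type*} [TopologicalSpace N] [ChartedSpace HN N]
  {ι : Type*} [Fintype ι] [DecidableEq ι] {n : ℕ∞ω}

theorem contMDiffAt_det {G : N → Matrix ι ι ℝ} {p : N}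
    (hG : ∀ i j, ContMDiffAt J 𝓘(ℝ, ℝ) n (fun q => G q i j) p) :
    ContMDiffAt J 𝓘(ℝ, ℝ) n (fun q => (G q).det) p := by
  simp only [Matrix.det_apply']
  exact ContMDiffAt.sum fun σ _ => contMDiffAt_const.mul (ContMDiffAt.prod fun i _ => hG _ _)

/-- The entries of the inverse of a smooth family of invertible matrices are smooth. -/
theorem contMDiffAt_matrix_inv {G : N → Matrix ι ι ℝ} {p : N}
    (hG : ∀ i j, ContMDiffAt J 𝓘(ℝ, ℝ) n (fun q => G q i j) p) (hp : (G p).det ≠ 0) (i j : ι) :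
    ContMDiffAt J 𝓘(ℝ, ℝ) n (fun q => (G q)⁻¹ i j) p := by
  have h1 : ContMDiffAt J 𝓘(ℝ, ℝ) n (fun q => ((G q).det)⁻¹) p :=
    ContDiffAt.comp_contMDiffAt (g := fun r : ℝ => r⁻¹) (contDiffAt_inv ℝ hp) (contMDiffAt_det hG)
  have h2 : ContMDiffAt J 𝓘(ℝ, ℝ) n (fun q => (G q).adjugate i j) p := by
    simp only [Matrix.adjugate_apply]
    refine contMDiffAt_det fun k l => ?_
    by_cases hk : k = j
    · subst hk
      simpa [Matrix.updateRow_self] using contMDiffAt_const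
    · simpa [Matrix.updateRow_ne hk] using hG k l
  have h3 : (fun q => (G q)⁻¹ i j) = fun q => ((G q).det)⁻¹ * (G q).adjugate i j := by
    ext q
    rw [Matrix.inv_def, Ring.inverse_eq_inv']
    rfl
  rw [h3]
  exact h1.mul h2

end MatrixInverse

/-! ### Smooth functions of time and position -/

section Families

variable {EM : Type*} [NormedAddCommGroup EM] [NormedSpace ℝ EM]
  {M : Type*} [TopologicalSpace M] [ChartedSpace EM M] [IsManifold 𝓘(ℝ, EM) ∞ M]

theorem contMDiff_of_family {f : ℝ × M → ℝ}
    (hf : ContMDiff (𝓘(ℝ, ℝ).prod 𝓘(ℝ, EM)) 𝓘(ℝ, ℝ) ∞ f) (s : ℝ) :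
    ContMDiff 𝓘(ℝ, EM) 𝓘(ℝ, ℝ) ∞ (fun y => f (s, y)) :=
  hf.comp (contMDiff_const.prodMk contMDiff_id)

/-- The derivative of a smooth function on `ℝ × M` along a smooth vector field `c ∂_s + X`
is smooth. -/
theorem contMDiff_mfderiv_family {f : ℝ × M → ℝ}
    (hf : ContMDiff (𝓘(ℝ, ℝ).prod 𝓘(ℝ, EM)) 𝓘(ℝ, ℝ) ∞ f) (c : ℝ) (X : VField EM M) :
    ContMDiff (𝓘(ℝ, ℝ).prod 𝓘(ℝ, EM)) 𝓘(ℝ, ℝ) ∞ (fun p : ℝ × M =>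
      (mvfderiv (𝓘(ℝ, ℝ).prod 𝓘(ℝ, EM)) f p : ℝ × EM →L[ℝ] ℝ) (c, X p.2)) := by
  have h1 : ContMDiff (𝓘(ℝ, ℝ).prod 𝓘(ℝ, EM)) ((𝓘(ℝ, ℝ).prod 𝓘(ℝ, EM)).tangent) ∞
      (fun p : ℝ × M => (equivTangentBundleProd 𝓘(ℝ, ℝ) ℝ 𝓘(ℝ, EM) M).symm
        (⟨p.1, c⟩, ⟨p.2, X p.2⟩)) := by
    refine contMDiff_equivTangentBundleProd_symm.comp (ContMDiff.prodMk ?_ ?_)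
    · have : ContMDiff 𝓘(ℝ, ℝ) (𝓘(ℝ, ℝ).tangent) ∞
          (fun s : ℝ => (⟨s, c⟩ : TangentBundle 𝓘(ℝ, ℝ) ℝ)) :=
        contMDiff_vectorSpace_iff_contDiff.2 contDiff_const
      exact this.comp contMDiff_fst
    · exact X.contMDiff_toFun.comp contMDiff_snd
  have h2 := (contMDiff_snd_tangentBundle_modelSpace (n := ∞) (H := ℝ) (I := 𝓘(ℝ, ℝ))).comp
    ((hf.contMDiff_tangentMap (m := ∞) (by simp)).comp h1)
  exact h2

theorem mvfderiv_family_apply {f : ℝ × M → ℝ}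
    (hf : ContMDiff (𝓘(ℝ, ℝ).prod 𝓘(ℝ, EM)) 𝓘(ℝ, ℝ) ∞ f) (p : ℝ × M)
    (v : TangentSpace 𝓘(ℝ, EM) p.2) :
    (mvfderiv (𝓘(ℝ, ℝ).prod 𝓘(ℝ, EM)) f p : ℝ × EM →L[ℝ] ℝ) (0, v)
      = dirDeriv EM (fun y => f (p.1, y)) p.2 v := by
  have hd : MDifferentiableAt (𝓘(ℝ, ℝ).prod 𝓘(ℝ, EM)) 𝓘(ℝ, ℝ) f (p.1, p.2) :=
    hf.mdifferentiableAt (by simp)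
  have h := mfderiv_comp p.2 hd (f := fun y : M => (p.1, y))
    (mdifferentiableAt_const.prodMk mdifferentiableAt_id)
  rw [mfderiv_prod_right] at h
  unfold dirDeriv
  exact (congrArg (fun L : EM →L[ℝ] ℝ => L v) h).symm

theorem hasDerivAt_family {f : ℝ × M → ℝ}
    (hf : ContMDiff (𝓘(ℝ, ℝ).prod 𝓘(ℝ, EM)) 𝓘(ℝ, ℝ) ∞ f) (p : ℝ × M) :
    HasDerivAt (fun s => f (s, p.2))
      ((mvfderiv (𝓘(ℝ, ℝ).prod 𝓘(ℝ, EM)) f p : ℝ × EM →L[ℝ] ℝ) (1, 0)) p.1 := by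
  have hd : MDifferentiableAt (𝓘(ℝ, ℝ).prod 𝓘(ℝ, EM)) 𝓘(ℝ, ℝ) f (p.1, p.2) :=
    hf.mdifferentiableAt (by simp)
  have h := hd.hasMFDerivAt.comp p.1 (f := fun s : ℝ => (s, p.2))
    ((hasMFDerivAt_id p.1).prodMk (hasMFDerivAt_const p.2 p.1))
  have h' : HasFDerivAt (fun s => f (s, p.2))
    ((mvfderiv (𝓘(ℝ, ℝ).prod 𝓘(ℝ, EM)) f p : ℝ × EM →L[ℝ] ℝ).comp
      ((ContinuousLinearMap.id ℝ ℝ).prod (0 : ℝ →L[ℝ] EM))) p.1 := hasMFDerivAt_iff_hasFDerivAt.1 h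
  exact h'.hasDerivAt

/-- The space derivative of a smooth function on `ℝ × M` is smooth. -/
theorem contMDiff_dirDeriv_family {f : ℝ × M → ℝ}
    (hf : ContMDiff (𝓘(ℝ, ℝ).prod 𝓘(ℝ, EM)) 𝓘(ℝ, ℝ) ∞ f) (X : VField EM M) :
    ContMDiff (𝓘(ℝ, ℝ).prod 𝓘(ℝ, EM)) 𝓘(ℝ, ℝ) ∞
      (fun p : ℝ × M => dirDeriv EM (fun y => f (p.1, y)) p.2 (X p.2)) := by
  simp only [← mvfderiv_family_apply hf]
  exact contMDiff_mfderiv_family hf 0 X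

/-- The time derivative of a smooth function on `ℝ × M` is smooth. -/
theorem contMDiff_deriv_family {f : ℝ × M → ℝ}
    (hf : ContMDiff (𝓘(ℝ, ℝ).prod 𝓘(ℝ, EM)) 𝓘(ℝ, ℝ) ∞ f) :
    ContMDiff (𝓘(ℝ, ℝ).prod 𝓘(ℝ, EM)) 𝓘(ℝ, ℝ) ∞
      (fun p : ℝ × M => deriv (fun s => f (s, p.2)) p.1) := by
  simp only [(hasDerivAt_family hf _).deriv]
  exact contMDiff_mfderiv_family hf 1 0

theorem contMDiff_dirDeriv {f : M → ℝ} (hf : ContMDiff 𝓘(ℝ, EM) 𝓘(ℝ, ℝ) ∞ f) (X : VField EM M) :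
    ContMDiff 𝓘(ℝ, EM) 𝓘(ℝ, ℝ) ∞ (fun x => dirDeriv EM f x (X x)) :=
  contMDiff_of_family (contMDiff_dirDeriv_family (hf.comp contMDiff_snd) X) 0

/-- Chain rule for a function on `ℝ × M` along the graph of a curve. -/
theorem hasDerivAt_comp_graph {f : ℝ × M → ℝ}
    (hf : ContMDiff (𝓘(ℝ, ℝ).prod 𝓘(ℝ, EM)) 𝓘(ℝ, ℝ) ∞ f) {γ : ℝ → M} {t : ℝ}
    {v : TangentSpace 𝓘(ℝ, EM) (γ t)}
    (hγ : HasMFDerivAt 𝓘(ℝ, ℝ) 𝓘(ℝ, EM) γ t ((1 : ℝ →L[ℝ] ℝ).smulRight v)) :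
    HasDerivAt (fun s => f (s, γ s))
      (deriv (fun s => f (s, γ t)) t + dirDeriv EM (fun y => f (t, y)) (γ t) v) t := by
  have hd : MDifferentiableAt (𝓘(ℝ, ℝ).prod 𝓘(ℝ, EM)) 𝓘(ℝ, ℝ) f (t, γ t) :=
    hf.mdifferentiableAt (by simp)
  have h := hd.hasMFDerivAt.comp t (f := fun s : ℝ => (s, γ s)) ((hasMFDerivAt_id t).prodMk hγ)
  have h' : HasFDerivAt (fun s => f (s, γ s))
    ((mvfderiv (𝓘(ℝ, ℝ).prod 𝓘(ℝ, EM)) f (t, γ t) : ℝ × EM →L[ℝ] ℝ).comp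
      ((ContinuousLinearMap.id ℝ ℝ).prod ((1 : ℝ →L[ℝ] ℝ).smulRight (v : EM)))) t :=
    hasMFDerivAt_iff_hasFDerivAt.1 h
  refine h'.hasDerivAt.congr_deriv ?_
  rw [(hasDerivAt_family hf (t, γ t)).deriv, ← mvfderiv_family_apply hf (t, γ t)]
  have key : ∀ (L : ℝ × EM →L[ℝ] ℝ) (w : EM), L (1, (1 : ℝ) • w) = L (1, 0) + L (0, w) :=
    fun L w => by
      rw [one_smul, ← map_add]
      simp
  exact key (mvfderiv (𝓘(ℝ, ℝ).prod 𝓘(ℝ, EM)) f (t, γ t) : ℝ × EM →L[ℝ] ℝ) v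

/-- Equality of the mixed second derivatives on `ℝ × G`. -/
theorem hasDerivAt_fderiv_family {G : Type*} [NormedAddCommGroup G] [NormedSpace ℝ G]
    {g : ℝ × G → ℝ} {s₀ : ℝ} {y₀ : G} (hg : ContDiffAt ℝ ∞ g (s₀, y₀)) (w : G) :
    HasDerivAt (fun s => fderiv ℝ (fun y => g (s, y)) y₀ w)
      (fderiv ℝ (fun y => deriv (fun s => g (s, y)) s₀) y₀ w) s₀ := by
  have h2 : ContDiffAt ℝ 2 g (s₀, y₀) := contDiffAt_infty.1 hg 2
  have hev : ∀ᶠ p in 𝓝 (s₀, y₀), HasFDerivAt g (fderiv ℝ g p) p := by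
    filter_upwards [h2.eventually (by simp)] with p hp
    exact (hp.differentiableAt (by simp)).hasFDerivAt
  have hd : HasFDerivAt (fderiv ℝ g) (fderiv ℝ (fderiv ℝ g) (s₀, y₀)) (s₀, y₀) :=
    ((h2.fderiv_right (m := 1) (by norm_num)).differentiableAt (by simp)).hasFDerivAt
  set g'' := fderiv ℝ (fderiv ℝ g) (s₀, y₀)
  have hsymm : g'' (1, 0) (0, w) = g'' (0, w) (1, 0) :=
    h2.isSymmSndFDerivAt (by simp) _ _
  have hs : ∀ᶠ s in 𝓝 s₀, HasFDerivAt g (fderiv ℝ g (s, y₀)) (s, y₀) :=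
    (Continuous.continuousAt (by fun_prop : Continuous fun s : ℝ => (s, y₀))).eventually hev
  have hy : ∀ᶠ y in 𝓝 y₀, HasFDerivAt g (fderiv ℝ g (s₀, y)) (s₀, y) :=
    (Continuous.continuousAt (by fun_prop : Continuous fun y : G => (s₀, y))).eventually hev
  have e1 : (fun s => fderiv ℝ (fun y => g (s, y)) y₀ w) =ᶠ[𝓝 s₀]
      fun s => fderiv ℝ g (s, y₀) (0, w) := by
    filter_upwards [hs] with s h
    exact congrArg (fun L => L w) (h.comp y₀ (hasFDerivAt_prodMk_right s y₀)).fderiv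
  have e2 : (fun y => deriv (fun s => g (s, y)) s₀) =ᶠ[𝓝 y₀]
      fun y => fderiv ℝ g (s₀, y) (1, 0) := by
    filter_upwards [hy] with y h
    exact (h.comp s₀ (hasFDerivAt_prodMk_left s₀ y)).hasDerivAt.deriv
  have d1 : HasDerivAt (fun s => fderiv ℝ g (s, y₀) (0, w)) (g'' (1, 0) (0, w)) s₀ := by
    have := (hd.comp s₀ (hasFDerivAt_prodMk_left s₀ y₀)).hasDerivAt
    exact this.clm_apply (hasDerivAt_const s₀ ((0 : ℝ), w)) |>.congr_deriv (by simp)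
  have d2 : HasFDerivAt (fun y => fderiv ℝ g (s₀, y) (1, 0))
      ((ContinuousLinearMap.apply ℝ ℝ ((1 : ℝ), (0 : G))).comp
        (g''.comp (ContinuousLinearMap.inr ℝ ℝ G))) y₀ :=
    (ContinuousLinearMap.apply ℝ ℝ ((1 : ℝ), (0 : G))).hasFDerivAt.comp y₀
      (hd.comp y₀ (hasFDerivAt_prodMk_right s₀ y₀))
  rw [e2.fderiv_eq, d2.fderiv]
  refine (d1.congr_of_eventuallyEq e1).congr_deriv ?_
  simpa using hsymm

/-- Equality of the mixed second derivatives on `ℝ × M`. -/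
theorem hasDerivAt_dirDeriv_family {f : ℝ × M → ℝ}
    (hf : ContMDiff (𝓘(ℝ, ℝ).prod 𝓘(ℝ, EM)) 𝓘(ℝ, ℝ) ∞ f) (s₀ : ℝ) (x : M)
    (v : TangentSpace 𝓘(ℝ, EM) x) :
    HasDerivAt (fun s => dirDeriv EM (fun y => f (s, y)) x v)
      (dirDeriv EM (fun y => deriv (fun s => f (s, y)) s₀) x v) s₀ := by
  set φ := extChartAt 𝓘(ℝ, EM) x
  set g : ℝ × EM → ℝ := fun p => f (p.1, φ.symm p.2)
  set w : EM := mvfderiv 𝓘(ℝ, EM) φ x v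
  have hsymm : ContMDiffAt 𝓘(ℝ, EM) 𝓘(ℝ, EM) ∞ φ.symm (φ x) :=
    (contMDiffOn_extChartAt_symm x).contMDiffAt (extChartAt_target_mem_nhds x)
  have hg : ∀ s, ContDiffAt ℝ ∞ g (s, φ x) := fun s =>
    contMDiffAt_iff_contDiffAt.1 ((hf _).comp (s, φ x)
      (contDiff_fst.contMDiff.contMDiffAt.prodMk
        (hsymm.comp (s, φ x) contDiff_snd.contMDiff.contMDiffAt)))
  have hchain : ∀ {h : EM → ℝ} {k : M → ℝ}, DifferentiableAt ℝ h (φ x) →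
      (∀ y ∈ φ.source, k y = h (φ y)) → dirDeriv EM k x v = fderiv ℝ h (φ x) w := by
    intro h k hh hk
    have hc := (hh.hasFDerivAt.hasMFDerivAt).comp x
      (mdifferentiableAt_extChartAt (I := 𝓘(ℝ, EM)) (mem_chart_source EM x)).hasMFDerivAt
    rw [dirDeriv_congr (g := fun y => h (φ y)) (by
      filter_upwards [extChartAt_source_mem_nhds (I := 𝓘(ℝ, EM)) x] with y hy using hk y hy)]
    unfold dirDeriv
    exact congrArg (fun L : EM →L[ℝ] ℝ => L v) hc.mfderiv
  have hdy : ∀ s, DifferentiableAt ℝ (fun y => g (s, y)) (φ x) := fun s =>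
    ((hg s).differentiableAt (by simp)).comp _ (by fun_prop)
  have hds : DifferentiableAt ℝ (fun y => deriv (fun s => g (s, y)) s₀) (φ x) := by
    have hk := contMDiff_of_family (contMDiff_deriv_family hf) s₀
    exact (contMDiffAt_iff_contDiffAt.1 ((hk _).comp (φ x) hsymm)).differentiableAt (by simp)
  have hinv : ∀ y ∈ φ.source, φ.symm (φ y) = y := fun y hy => φ.left_inv hy
  rw [hchain hds (fun y hy => by simp only [g, hinv y hy])]
  have hE : (fun s => dirDeriv EM (fun y => f (s, y)) x v) =
      fun s => fderiv ℝ (fun y => g (s, y)) (φ x) w := by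
    ext s
    exact hchain (hdy s) (fun y hy => by simp only [g, hinv y hy])
  rw [hE]
  exact hasDerivAt_fderiv_family (hg s₀) w

end Families

/-! ### Coefficients with respect to a frame -/

section Gram

variable {EM : Type*} [NormedAddCommGroup EM] [NormedSpace ℝ EM] [FiniteDimensional ℝ EM]
  {M : Type*} [TopologicalSpace M] [T2Space M] [ChartedSpace EM M] [IsManifold 𝓘(ℝ, EM) ∞ M]
  {F : Type*} [NormedAddCommGroup F] [NormedSpace ℝ F] [FiniteDimensional ℝ F]
  {V : M → Type*} [TopologicalSpace (TotalSpace F V)]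
  [∀ x, AddCommGroup (V x)] [∀ x, Module ℝ (V x)] [∀ x, TopologicalSpace (V x)]
  [FiberBundle F V] [VectorBundle ℝ F V] [ContMDiffVectorBundle ∞ F V 𝓘(ℝ, EM)]
  (A : CourantAlgebroid EM F V)

namespace CourantAlgebroid

theorem metric_ext {x : M} {v w : V x} (h : ∀ u, A.metric x v u = A.metric x w u) : v = w := by
  refine sub_eq_zero.1 ((A.metric_nondegenerate x).1 _ fun u => ?_)
  rw [map_sub, LinearMap.sub_apply, h, sub_self]

theorem metric_ext_sec {x : M} {v w : V x}
    (h : ∀ τ : Sec EM F V, A.metric x v (τ x) = A.metric x w (τ x)) : v = w :=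
  A.metric_ext fun u => by
    obtain ⟨τ, rfl⟩ := exists_sec_apply (EM := EM) (F := F) x u
    exact h τ

/-- The Gram matrix of a family of vectors. -/
def gram {ι : Type*} (x : M) (b : ι → V x) : Matrix ι ι ℝ :=
  Matrix.of fun i j => A.metric x (b i) (b j)

variable {ι : Type*} [Fintype ι] [DecidableEq ι]

theorem gram_det_ne_zero {x : M} {b : ι → V x} (hb : LinearIndependent ℝ b)
    (hs : Submodule.span ℝ (Set.range b) = ⊤) : (A.gram x b).det ≠ 0 := by
  have h := (LinearMap.BilinForm.nondegenerate_iff_det_ne_zero (Module.Basis.mk hb hs.ge)).1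
    (A.metric_nondegenerate x)
  convert h using 2
  ext i j
  simp [gram, LinearMap.BilinForm.toMatrix_apply]

/-- Expansion of a vector in a frame, with coefficients computed from the metric. -/
theorem eq_sum_gram_inv {x : M} {b : ι → V x} (hb : LinearIndependent ℝ b)
    (hs : Submodule.span ℝ (Set.range b) = ⊤) (v : V x) :
    v = ∑ i, (∑ j, (A.gram x b)⁻¹ i j * A.metric x v (b j)) • b i := by
  have hdet := A.gram_det_ne_zero hb hs
  refine A.metric_ext fun u => ?_
  have hu : u ∈ Submodule.span ℝ (Set.range b) := hs ▸ Submodule.mem_top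
  induction hu using Submodule.span_induction with
  | zero => simp
  | add u w _ _ hu hw => rw [map_add, map_add, hu, hw]
  | smul c u _ hu => rw [map_smul, map_smul, hu]
  | mem u hu =>
    obtain ⟨k, rfl⟩ := hu
    have h1 : A.gram x b * (A.gram x b)⁻¹ = 1 :=
      Matrix.mul_nonsing_inv _ (isUnit_iff_ne_zero.2 hdet)
    have h2 : ∀ j, ∑ i, A.metric x (b k) (b i) * (A.gram x b)⁻¹ i j = (1 : Matrix ι ι ℝ) k j := by
      intro j
      rw [← h1]
      rfl
    simp only [map_sum, LinearMap.sum_apply, map_smul, LinearMap.smul_apply, smul_eq_mul,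
      Finset.sum_mul]
    rw [Finset.sum_comm]
    calc A.metric x v (b k) = ∑ j, (1 : Matrix ι ι ℝ) k j * A.metric x v (b j) := by
          simp [Matrix.one_apply]
      _ = _ := by
          refine Finset.sum_congr rfl fun j _ => ?_
          rw [← h2, Finset.sum_mul]
          refine Finset.sum_congr rfl fun i _ => ?_
          rw [A.metric_symm x (b i) (b k)]
          ring

variable {EN : Type*} [NormedAddCommGroup EN] [NormedSpace ℝ EN] {HN : Type*} [TopologicalSpace HN]
  {J : ModelWithCorners ℝ EN HN} {N : Type*} [TopologicalSpace N] [ChartedSpace HN N] {n : ℕ∞ω}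

/-- A map to the total space of the bundle is smooth if its base component is smooth and
all its pairings with smooth sections are smooth. -/
theorem contMDiffAt_of_metric (hn : n ≤ ∞) {f : N → TotalSpace F V} {p : N}
    (hbase : ContMDiffAt J 𝓘(ℝ, EM) n (fun q => (f q).proj) p)
    (hf : ∀ τ : Sec EM F V,
      ContMDiffAt J 𝓘(ℝ, ℝ) n (fun q => A.metric (f q).proj (f q).snd (τ (f q).proj)) p) :
    ContMDiffAt J (𝓘(ℝ, EM).prod 𝓘(ℝ, F)) n f p := by
  obtain ⟨e, he⟩ := exists_frame EM F (V := V) (f p).proj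
  set t := trivializationAt F V (f p).proj
  have ht : (f p).proj ∈ t.baseSet := mem_baseSet_trivializationAt F V _
  refine contMDiffAt_totalSpace.2 ⟨hbase, ?_⟩
  set G : N → Matrix _ _ ℝ := fun q => A.gram (f q).proj (fun i => e i (f q).proj)
  have hG : ∀ i j, ContMDiffAt J 𝓘(ℝ, ℝ) n (fun q => G q i j) p := fun i j =>
    (((A.metric_smooth (e i) (e j)).of_le hn).contMDiffAt).comp p hbase
  have hinv := contMDiffAt_matrix_inv hG
    (A.gram_det_ne_zero he.self_of_nhds.1 he.self_of_nhds.2)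
  have hcoef : ∀ i, ContMDiffAt J 𝓘(ℝ, ℝ) n
      (fun q => ∑ j, (G q)⁻¹ i j * A.metric (f q).proj (f q).snd (e j (f q).proj)) p :=
    fun i => ContMDiffAt.sum fun j _ => (hinv i j).mul (hf (e j))
  have hte : ∀ i, ContMDiffAt J 𝓘(ℝ, F) n (fun q => (t ⟨(f q).proj, e i (f q).proj⟩).2) p := by
    intro i
    have h1 : ContMDiffAt J (𝓘(ℝ, EM).prod 𝓘(ℝ, F)) n
        (fun q => TotalSpace.mk' F (f q).proj (e i (f q).proj)) p :=
      (((e i).contMDiff_toFun.of_le hn).contMDiffAt).comp p hbase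
    exact (contMDiffAt_totalSpace.1 h1).2
  have hsum : ContMDiffAt J 𝓘(ℝ, F) n (fun q => ∑ i,
      (∑ j, (G q)⁻¹ i j * A.metric (f q).proj (f q).snd (e j (f q).proj)) •
        (t ⟨(f q).proj, e i (f q).proj⟩).2) p :=
    ContMDiffAt.sum fun i _ => (hcoef i).smul (hte i)
  refine hsum.congr_of_eventuallyEq ?_
  filter_upwards [hbase.continuousAt.eventually he,
    hbase.continuousAt.eventually (t.open_baseSet.mem_nhds ht)] with q hq hqt
  have hlin : ∀ v : V (f q).proj, (t ⟨(f q).proj, v⟩).2 =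
      t.linearMapAt ℝ (f q).proj v := fun v => by
    rw [t.coe_linearMapAt_of_mem hqt]
  change (t ⟨(f q).proj, (f q).snd⟩).2 = _
  simp only [hlin, ← map_smul]
  rw [← map_sum, ← A.eq_sum_gram_inv hq.1 hq.2]

/-- Pairing with a smooth section is a smooth function on the total space. -/
theorem contMDiff_metric_total (τ : Sec EM F V) :
    ContMDiff (𝓘(ℝ, EM).prod 𝓘(ℝ, F)) 𝓘(ℝ, ℝ) ∞
      (fun p : TotalSpace F V => A.metric p.proj p.snd (τ p.proj)) := by
  intro p
  obtain ⟨e, he⟩ := exists_frame EM F (V := V) p.proj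
  set t := trivializationAt F V p.proj
  have ht : p.proj ∈ t.baseSet := mem_baseSet_trivializationAt F V _
  set b := Module.finBasis ℝ F
  have hfr := t.isLocalFrameOn_localFrame_baseSet 𝓘(ℝ, EM) ∞ b
  have hloc : ∀ i, ∃ σ : Sec EM F V, ∀ᶠ y in 𝓝 p.proj, σ y = t.localFrame b i y := fun i =>
    exists_sec_eventuallyEq (by
      filter_upwards [t.open_baseSet.mem_nhds ht] with y hy
      exact hfr.contMDiffAt t.open_baseSet hy i)
  choose e he using hloc
  have hproj : ContMDiffAt (𝓘(ℝ, EM).prod 𝓘(ℝ, F)) 𝓘(ℝ, EM) ∞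
    (fun q : TotalSpace F V => q.proj) p := contMDiffAt_proj V
  have hcoord : ContMDiffAt (𝓘(ℝ, EM).prod 𝓘(ℝ, F)) 𝓘(ℝ, F) ∞
    (fun q : TotalSpace F V => (t q).2) p := (contMDiffAt_totalSpace.1 contMDiffAt_id).2
  have hrepr : ∀ i, ContMDiffAt (𝓘(ℝ, EM).prod 𝓘(ℝ, F)) 𝓘(ℝ, ℝ) ∞
      (fun q : TotalSpace F V => b.repr (t q).2 i) p := fun i =>
    ((LinearMap.toContinuousLinearMap (b.coord i)).contMDiff.contMDiffAt).comp p hcoord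
  have hsum : ContMDiffAt (𝓘(ℝ, EM).prod 𝓘(ℝ, F)) 𝓘(ℝ, ℝ) ∞ (fun q : TotalSpace F V =>
      ∑ i, b.repr (t q).2 i * A.metric q.proj (e i q.proj) (τ q.proj)) p :=
    ContMDiffAt.sum fun i _ => (hrepr i).mul (((A.metric_smooth (e i) τ) _).comp p hproj)
  refine hsum.congr_of_eventuallyEq ?_
  filter_upwards [hproj.continuousAt.eventually (eventually_all.2 he),
    hproj.continuousAt.eventually (t.open_baseSet.mem_nhds ht)] with q hq hqt
  have hexp : q.snd = ∑ i, b.repr (t q).2 i • e i q.proj := by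
    conv_lhs => rw [← (t.basisAt b hqt).sum_repr q.snd]
    refine Finset.sum_congr rfl fun i _ => ?_
    rw [hq i, t.localFrame_apply_of_mem_baseSet b hqt]
    congr 1
  conv_lhs => rw [hexp]
  simp [map_sum, LinearMap.sum_apply]

end CourantAlgebroid

end Gram

/-! ### The Lie bracket of vector fields as a commutator -/

section LieBracket

variable {EM : Type*} [NormedAddCommGroup EM] [NormedSpace ℝ EM] [FiniteDimensional ℝ EM]
  {M : Type*} [TopologicalSpace M] [T2Space M] [ChartedSpace EM M] [IsManifold 𝓘(ℝ, EM) ∞ M]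

theorem _root_.ContMDiff.mdiffAt {f : M → ℝ} (hf : ContMDiff 𝓘(ℝ, EM) 𝓘(ℝ, ℝ) ∞ f) (x : M) :
    MDifferentiableAt 𝓘(ℝ, EM) 𝓘(ℝ, ℝ) f x := hf.mdifferentiableAt (by simp)

/-- The Lie bracket of vector fields acts on functions as the commutator. The proof compares the
coefficients of `W` in the Jacobi identity for `X`, `Y` and `f W`. -/
theorem dirDeriv_mlieBracket (X Y : VField EM M) {f : M → ℝ}
    (hf : ContMDiff 𝓘(ℝ, EM) 𝓘(ℝ, ℝ) ∞ f) (x : M) :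
    dirDeriv EM f x (VectorField.mlieBracket 𝓘(ℝ, EM) X Y x) =
      dirDeriv EM (fun y => dirDeriv EM f y (Y y)) x (X x)
        - dirDeriv EM (fun y => dirDeriv EM f y (X y)) x (Y x) := by
  have : CompleteSpace EM := FiniteDimensional.complete ℝ EM
  by_cases htriv : ∀ w : EM, w = 0
  · have h0 : ∀ (g : M → ℝ) (v : TangentSpace 𝓘(ℝ, EM) x), dirDeriv EM g x v = 0 := fun g v => by
      rw [show v = 0 from htriv v]
      exact map_zero (mvfderiv 𝓘(ℝ, EM) g x)
    simp [h0]
  push Not at htriv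
  obtain ⟨w, hw⟩ := htriv
  obtain ⟨W, hW⟩ : ∃ W : VField EM M, W x = (w : TangentSpace 𝓘(ℝ, EM) x) :=
    exists_sec_apply (EM := EM) (F := EM) (V := fun x : M => TangentSpace 𝓘(ℝ, EM) x) x w
  have hM1 : IsManifold 𝓘(ℝ, EM) 2 M := .of_le (n := ∞) ENat.LEInfty.out
  have hM2 : IsManifold 𝓘(ℝ, EM) (minSmoothness ℝ 3) M := .of_le (n := ∞) (by simpa using ENat.LEInfty.out)
  have hM3 : IsManifold 𝓘(ℝ, EM) ((2 : ℕ∞) + 1) M :=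
    .of_le (n := ∞) (by exact_mod_cast le_top)
  have hfd : ∀ y, MDifferentiableAt 𝓘(ℝ, EM) 𝓘(ℝ, ℝ) f y := fun y => hf.mdiffAt y
  have hsec : ∀ Z : VField EM M, ∀ y, MDifferentiableAt 𝓘(ℝ, EM) (𝓘(ℝ, EM).tangent)
      (fun y => (⟨y, Z y⟩ : TangentBundle 𝓘(ℝ, EM) M)) y := fun Z y =>
    Z.contMDiff_toFun.mdifferentiableAt (by simp)
  have hs2 : ∀ Z : VField EM M, ContMDiff 𝓘(ℝ, EM) (𝓘(ℝ, EM).tangent) (2 : ℕ∞)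
      (fun y => (⟨y, Z y⟩ : TangentBundle 𝓘(ℝ, EM) M)) := fun Z =>
    Z.contMDiff_toFun.of_le (by exact_mod_cast le_top)
  have hbr : ∀ Z Z' : VField EM M, ∀ y, MDifferentiableAt 𝓘(ℝ, EM) (𝓘(ℝ, EM).tangent)
      (fun y => (⟨y, VectorField.mlieBracket 𝓘(ℝ, EM) Z Z' y⟩ : TangentBundle 𝓘(ℝ, EM) M)) y :=
    fun Z Z' y => (ContDiff.mlieBracket_vectorField (m := 1) (n := 2) (hs2 Z) (hs2 Z')
      (by simp; norm_num)).mdifferentiableAt (by simp)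
  -- the bracket with `f W`
  have hsmul : ∀ Z : VField EM M, VectorField.mlieBracket 𝓘(ℝ, EM) Z (f • ⇑W) =
      (fun y => dirDeriv EM f y (Z y)) • ⇑W + f • VectorField.mlieBracket 𝓘(ℝ, EM) Z W :=
    fun Z => funext fun y => VectorField.mlieBracket_smul_right (hfd y) (hsec W y)
  have hZf : ∀ Z : VField EM M, ∀ y, MDifferentiableAt 𝓘(ℝ, EM) 𝓘(ℝ, ℝ)
      (fun y => dirDeriv EM f y (Z y)) y := fun Z y => (contMDiff_dirDeriv hf Z).mdiffAt y
  have hsmul2 : ∀ Z Z' : VField EM M,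
      VectorField.mlieBracket 𝓘(ℝ, EM) Z (VectorField.mlieBracket 𝓘(ℝ, EM) Z' (f • ⇑W)) x =
        dirDeriv EM (fun y => dirDeriv EM f y (Z' y)) x (Z x) • W x
        + dirDeriv EM f x (Z' x) • VectorField.mlieBracket 𝓘(ℝ, EM) Z W x
        + (dirDeriv EM f x (Z x) • VectorField.mlieBracket 𝓘(ℝ, EM) Z' W x
        + f x • VectorField.mlieBracket 𝓘(ℝ, EM) Z (VectorField.mlieBracket 𝓘(ℝ, EM) Z' W) x) := by
    intro Z Z'
    rw [hsmul Z', VectorField.mlieBracket_add_right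
      ((hZf Z' x).smul_section (hsec W x)) ((hfd x).smul_section (hbr Z' W x)),
      VectorField.mlieBracket_smul_right (hZf Z' x) (hsec W x),
      VectorField.mlieBracket_smul_right (hfd x) (hbr Z' W x)]
    rfl
  have hW2 : ContMDiff 𝓘(ℝ, EM) (𝓘(ℝ, EM).tangent) (2 : ℕ∞)
      (fun y => (⟨y, (f • ⇑W) y⟩ : TangentBundle 𝓘(ℝ, EM) M)) :=
    (hf.of_le (by exact_mod_cast le_top)).smul_section (hs2 W)
  have hJ := VectorField.leibniz_identity_mlieBracket_apply (I := 𝓘(ℝ, EM)) (U := X) (V := Y)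
    (W := f • ⇑W) (x := x) ((hs2 X).contMDiffAt.of_le (by simp)) ((hs2 Y).contMDiffAt.of_le (by simp))
    (hW2.contMDiffAt.of_le (by simp))
  have hJ' := VectorField.leibniz_identity_mlieBracket_apply (I := 𝓘(ℝ, EM)) (U := X) (V := Y)
    (W := W) (x := x) ((hs2 X).contMDiffAt.of_le (by simp)) ((hs2 Y).contMDiffAt.of_le (by simp))
    ((hs2 W).contMDiffAt.of_le (by simp))
  rw [hsmul2, hsmul2, VectorField.mlieBracket_smul_right (hfd x) (hsec W x), hJ'] at hJ
  have hfin : (dirDeriv EM f x (VectorField.mlieBracket 𝓘(ℝ, EM) X Y x) -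
      (dirDeriv EM (fun y => dirDeriv EM f y (Y y)) x (X x)
        - dirDeriv EM (fun y => dirDeriv EM f y (X y)) x (Y x))) • W x = 0 := by
    change _ = (dirDeriv EM f x (VectorField.mlieBracket 𝓘(ℝ, EM) X Y x)) • W x + _ + _ at hJ
    rw [smul_add] at hJ
    rw [sub_smul, sub_smul, sub_eq_zero]
    generalize dirDeriv EM f x (VectorField.mlieBracket 𝓘(ℝ, EM) X Y x) • W x = a at *
    rw [← sub_eq_zero] at hJ ⊢
    rw [← neg_eq_zero, ← hJ]
    abel
  rw [hW] at hfin
  exact sub_eq_zero.1 ((smul_eq_zero.1 hfin).resolve_right hw)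

/-- Every covector is the derivative of a smooth function vanishing at the given point. -/
theorem exists_smooth_covector (x : M) (ξ : TangentSpace 𝓘(ℝ, EM) x →ₗ[ℝ] ℝ) :
    ∃ f : M → ℝ, ContMDiff 𝓘(ℝ, EM) 𝓘(ℝ, ℝ) ∞ f ∧ f x = 0 ∧ ∀ v, dirDeriv EM f x v = ξ v := by
  obtain ⟨g, hg, hgx⟩ := exists_smooth_eventuallyEq_extChartAt (EM := EM) x
  obtain ⟨L, hL⟩ : ∃ L : EM ≃L[ℝ] EM,
      (L : EM →L[ℝ] EM) = mvfderiv 𝓘(ℝ, EM) (extChartAt 𝓘(ℝ, EM) x) x :=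
    isInvertible_mfderiv_extChartAt (I := 𝓘(ℝ, EM)) (mem_extChartAt_source x)
  have hLg : ∀ v : EM, L v = (mvfderiv 𝓘(ℝ, EM) g x : EM →L[ℝ] EM) v := fun v => by
    have h1 : mvfderiv 𝓘(ℝ, EM) g x = mvfderiv 𝓘(ℝ, EM) (extChartAt 𝓘(ℝ, EM) x) x :=
      hgx.mfderiv_eq (I := 𝓘(ℝ, EM)) (I' := 𝓘(ℝ, EM))
    rw [h1, ← hL]
    rfl
  set ξ' : EM →L[ℝ] ℝ := LinearMap.toContinuousLinearMap ((ξ : EM →ₗ[ℝ] ℝ) ∘ₗ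
    (L.symm.toLinearEquiv : EM →ₗ[ℝ] EM))
  have hξg : ContMDiff 𝓘(ℝ, EM) 𝓘(ℝ, ℝ) ∞ (fun y => ξ' (g y)) := ξ'.contMDiff.comp hg
  refine ⟨fun y => ξ' (g y) - ξ' (g x), hξg.sub contMDiff_const, sub_self _, fun v => ?_⟩
  rw [dirDeriv_sub (hξg.mdiffAt x) (contMDiff_const.mdiffAt x)]
  have h1 : HasMFDerivAt 𝓘(ℝ, EM) 𝓘(ℝ, ℝ) ξ' (g x) ξ' := ξ'.hasMFDerivAt
  have h2 := (h1.comp x (hg.mdifferentiableAt (by simp) (x := x)).hasMFDerivAt).mfderiv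
  have h3 : dirDeriv EM (fun y => ξ' (g y)) x v =
      ξ' ((mvfderiv 𝓘(ℝ, EM) g x : EM →L[ℝ] EM) v) := by
    unfold dirDeriv
    exact congrArg (fun L : EM →L[ℝ] ℝ => L v) h2
  have h4 : dirDeriv EM (fun _ : M => ξ' (g x)) x v = 0 :=
    congrArg (fun L => L v) (mvfderiv_const (I := 𝓘(ℝ, EM)) (ξ' (g x)) (x := x))
  rw [h3, h4, sub_zero]
  refine (congrArg ξ' (hLg v)).symm.trans ?_
  exact congrArg (fun w : EM => (ξ : EM →ₗ[ℝ] ℝ) w) (L.symm_apply_apply (v : EM))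

end LieBracket

/-! ### Identities in Courant algebroids -/

section Identities

variable {EM : Type*} [NormedAddCommGroup EM] [NormedSpace ℝ EM] [FiniteDimensional ℝ EM]
  {M : Type*} [TopologicalSpace M] [T2Space M] [ChartedSpace EM M] [IsManifold 𝓘(ℝ, EM) ∞ M]
  {F : Type*} [NormedAddCommGroup F] [NormedSpace ℝ F] [FiniteDimensional ℝ F]
  {V : M → Type*} [TopologicalSpace (TotalSpace F V)]
  [∀ x, AddCommGroup (V x)] [∀ x, Module ℝ (V x)] [∀ x, TopologicalSpace (V x)]
  [FiberBundle F V] [VectorBundle ℝ F V] [ContMDiffVectorBundle ∞ F V 𝓘(ℝ, EM)]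
  (A : CourantAlgebroid EM F V)

namespace CourantAlgebroid

/-- The vector field `a(σ)`. -/
def anchorField (σ : Sec EM F V) : VField EM M := ⟨fun x => A.anchor x (σ x), A.anchor_smooth σ⟩

@[simp] theorem anchorField_apply (σ : Sec EM F V) (x : M) :
    A.anchorField σ x = A.anchor x (σ x) := rfl

/-- A section whose pairings with smooth sections are smooth functions is smooth. -/
def secOfMetric (s : ∀ x : M, V x)
    (hs : ∀ τ : Sec EM F V, ContMDiff 𝓘(ℝ, EM) 𝓘(ℝ, ℝ) ∞ (fun x => A.metric x (s x) (τ x))) :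
    Sec EM F V :=
  ⟨s, fun x => A.contMDiffAt_of_metric (f := fun x => TotalSpace.mk' F x (s x)) le_rfl
    contMDiffAt_id (fun τ => hs τ x)⟩

@[simp] theorem secOfMetric_apply (s : ∀ x : M, V x) (hs) (x : M) :
    A.secOfMetric s hs x = s x := rfl

/-- The bracket `⟦u, τ⟧`, paired with `ρ`, as a first order differential operator in `u`. -/
theorem metric_bracket_left (u τ ρ : Sec EM F V) (x : M) :
    A.metric x (A.bracket u τ x) (ρ x) =
      dirDeriv EM (fun y => A.metric y (u y) (τ y)) x (A.anchor x (ρ x))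
      - dirDeriv EM (fun y => A.metric y (u y) (ρ y)) x (A.anchor x (τ x))
      + A.metric x (u x) (A.bracket τ ρ x) := by
  have h1 := A.bracket_symm u τ x (ρ x)
  have h2 := A.anchor_metric τ u ρ x
  rw [map_add, LinearMap.add_apply] at h1
  linarith

/-- The bracket `⟦u, w⟧`, paired with `τ`, as a first order differential operator in `w`. -/
theorem metric_bracket_right (u w τ : Sec EM F V) (x : M) :
    A.metric x (A.bracket u w x) (τ x) =
      dirDeriv EM (fun y => A.metric y (w y) (τ y)) x (A.anchor x (u x))
      - A.metric x (w x) (A.bracket u τ x) := by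
  have := A.anchor_metric u w τ x
  linarith

/-- The Leibniz rule for the Courant bracket. -/
theorem bracket_fsmul (τ ρ : Sec EM F V) {f : M → ℝ} (hf : ContMDiff 𝓘(ℝ, EM) 𝓘(ℝ, ℝ) ∞ f) :
    A.bracket τ (fsmul f hf ρ) = fsmul f hf (A.bracket τ ρ)
      + fsmul (fun x => dirDeriv EM f x (A.anchorField τ x))
        (contMDiff_dirDeriv hf (A.anchorField τ)) ρ := by
  ext x
  refine A.metric_ext_sec fun κ => ?_
  have h : (fun y => A.metric y (fsmul f hf ρ y) (κ y)) =
      fun y => f y * A.metric y (ρ y) (κ y) := by ext y; simp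
  rw [metric_bracket_right, h, dirDeriv_mul (hf.mdiffAt x) ((A.metric_smooth ρ κ).mdiffAt x)]
  simp only [ContMDiffSection.coe_add, Pi.add_apply, fsmul_apply, map_add, LinearMap.add_apply,
    map_smul, LinearMap.smul_apply, smul_eq_mul, anchorField_apply]
  rw [metric_bracket_right]
  ring

/-- The anchor maps the Courant bracket to the commutator of derivations of functions. -/
theorem dirDeriv_anchor_bracket (σ τ : Sec EM F V) {f : M → ℝ}
    (hf : ContMDiff 𝓘(ℝ, EM) 𝓘(ℝ, ℝ) ∞ f) (x : M) :
    dirDeriv EM f x (A.anchor x (A.bracket σ τ x)) =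
      dirDeriv EM (fun y => dirDeriv EM f y (A.anchorField τ y)) x (A.anchorField σ x)
        - dirDeriv EM (fun y => dirDeriv EM f y (A.anchorField σ y)) x (A.anchorField τ x) := by
  by_cases htriv : ∀ v : V x, v = 0
  · have h0 : ∀ (g : M → ℝ) (v : V x), dirDeriv EM g x (A.anchor x v) = 0 := fun g v => by
      rw [htriv v, map_zero]
      exact map_zero (mvfderiv 𝓘(ℝ, EM) g x)
    simp [h0]
  push Not at htriv
  obtain ⟨v, hv⟩ := htriv
  obtain ⟨ρ, rfl⟩ := exists_sec_apply (EM := EM) (F := F) x v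
  have hJ := congrArg (fun κ : Sec EM F V => κ x) (A.jacobi σ τ (fsmul f hf ρ))
  have hJ' := congrArg (fun κ : Sec EM F V => κ x) (A.jacobi σ τ ρ)
  simp only [bracket_fsmul, map_add, ContMDiffSection.coe_add, Pi.add_apply, fsmul_apply] at hJ hJ'
  have hfin : (dirDeriv EM f x (A.anchor x (A.bracket σ τ x)) -
      (dirDeriv EM (fun y => dirDeriv EM f y (A.anchorField τ y)) x (A.anchorField σ x)
        - dirDeriv EM (fun y => dirDeriv EM f y (A.anchorField σ y)) x (A.anchorField τ x))) •
        ρ x = 0 := by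
    rw [hJ', smul_add] at hJ
    simp only [anchorField_apply] at hJ ⊢
    rw [sub_smul, sub_smul]
    rw [← sub_eq_zero] at hJ
    rw [← neg_eq_zero, ← hJ]
    abel
  exact sub_eq_zero.1 ((smul_eq_zero.1 hfin).resolve_right hv)

/-- The anchor is a homomorphism to the Lie algebra of vector fields. -/
theorem anchor_bracket (σ τ : Sec EM F V) (x : M) :
    A.anchor x (A.bracket σ τ x) =
      VectorField.mlieBracket 𝓘(ℝ, EM) (A.anchorField σ) (A.anchorField τ) x :=
  dirDeriv_ext fun f hf => by
    rw [A.dirDeriv_anchor_bracket σ τ hf, dirDeriv_mlieBracket _ _ hf]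

/-- The composition `a ∘ a^*` vanishes. -/
theorem anchor_coanchor (x : M) (ξ : TangentSpace 𝓘(ℝ, EM) x →ₗ[ℝ] ℝ) :
    A.anchor x (A.coanchor x ξ) = 0 := by
  by_cases htriv : ∀ v : V x, v = 0
  · rw [htriv (A.coanchor x ξ), map_zero]
  push Not at htriv
  obtain ⟨v, hv⟩ := htriv
  obtain ⟨w, hw⟩ : ∃ w, A.metric x v w ≠ 0 := by
    by_contra! h
    exact hv ((A.metric_nondegenerate x).1 v h)
  obtain ⟨σ, hσ⟩ := exists_sec_apply (EM := EM) (F := F) x v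
  obtain ⟨τ, hτ⟩ := exists_sec_apply (EM := EM) (F := F) x ((A.metric x v w)⁻¹ • w)
  obtain ⟨f, hf, hfx, hfξ⟩ := exists_smooth_covector x ξ
  have h1 : A.metric x (σ x) (τ x) = 1 := by
    rw [hσ, hτ, map_smul, smul_eq_mul, inv_mul_cancel₀ hw]
  have hco : A.coanchor x ξ = A.bracket (fsmul f hf σ) τ x + A.bracket τ (fsmul f hf σ) x := by
    refine A.metric_ext fun u => ?_
    have h : (fun y => A.metric y (fsmul f hf σ y) (τ y)) =
      fun y => f y * A.metric y (σ y) (τ y) := by ext y; simp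
    rw [A.metric_coanchor, A.bracket_symm, h,
      dirDeriv_mul (hf.mdiffAt x) ((A.metric_smooth σ τ).mdiffAt x), hfx, h1, hfξ]
    ring
  rw [hco, map_add, anchor_bracket, anchor_bracket, VectorField.mlieBracket_swap_apply,
    neg_add_cancel]

/-- The section `a^* α`. -/
def coanchorSec (α : OneForm EM M) : Sec EM F V :=
  A.secOfMetric (fun x => A.coanchor x (α.toFun x)) (fun τ => by
    simp only [metric_coanchor]
    exact α.smooth (A.anchorField τ))

@[simp] theorem coanchorSec_apply (α : OneForm EM M) (x : M) :
    A.coanchorSec α x = A.coanchor x (α.toFun x) := rfl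

/-- The bracket with `a^* α` is `- a^* ι dα`. -/
theorem metric_bracket_coanchorSec (α : OneForm EM M) (τ ρ : Sec EM F V) (x : M) :
    A.metric x (A.bracket (A.coanchorSec α) τ x) (ρ x) =
      - α.extDeriv (A.anchorField τ) (A.anchorField ρ) x := by
  rw [metric_bracket_left]
  simp only [coanchorSec_apply, metric_coanchor, OneForm.extDeriv, anchorField_apply]
  rw [anchor_bracket]
  ring

end CourantAlgebroid

end Identities

/-! ### The transport equation of a time-dependent section -/

section Transport

variable {EM : Type*} [NormedAddCommGroup EM] [NormedSpace ℝ EM] [FiniteDimensional ℝ EM]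
  {M : Type*} [TopologicalSpace M] [T2Space M] [ChartedSpace EM M] [IsManifold 𝓘(ℝ, EM) ∞ M]
  {F : Type*} [NormedAddCommGroup F] [NormedSpace ℝ F] [FiniteDimensional ℝ F]
  {V : M → Type*} [TopologicalSpace (TotalSpace F V)]
  [∀ x, AddCommGroup (V x)] [∀ x, Module ℝ (V x)] [∀ x, TopologicalSpace (V x)]
  [FiberBundle F V] [VectorBundle ℝ F V] [ContMDiffVectorBundle ∞ F V 𝓘(ℝ, EM)]
  (A : CourantAlgebroid EM F V)

namespace CourantAlgebroid

/-- A family of sections that is smooth jointly in the parameter and the point. Smoothness is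
tested on the pairings with smooth sections. -/
def SmoothSecFamily (u : ℝ → Sec EM F V) : Prop :=
  ∀ τ : Sec EM F V, ContMDiff (𝓘(ℝ, ℝ).prod 𝓘(ℝ, EM)) 𝓘(ℝ, ℝ) ∞
    (fun p : ℝ × M => A.metric p.2 (u p.1 p.2) (τ p.2))

variable {A}

theorem SmoothSecFamily.bracket {u : ℝ → Sec EM F V} (hu : A.SmoothSecFamily u)
    (τ : Sec EM F V) : A.SmoothSecFamily (fun s => A.bracket (u s) τ) := fun ρ => by
  simp only [metric_bracket_left]
  exact ((contMDiff_dirDeriv_family (hu τ) (A.anchorField ρ)).sub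
    (contMDiff_dirDeriv_family (hu ρ) (A.anchorField τ))).add (hu _)

/-- The exact 1-form `df`. -/
def exactForm {f : M → ℝ} (hf : ContMDiff 𝓘(ℝ, EM) 𝓘(ℝ, ℝ) ∞ f) : OneForm EM M :=
  ⟨covector EM f, fun X => contMDiff_dirDeriv hf X⟩

theorem SmoothSecFamily.dirDeriv_anchor {u : ℝ → Sec EM F V} (hu : A.SmoothSecFamily u)
    {f : M → ℝ} (hf : ContMDiff 𝓘(ℝ, EM) 𝓘(ℝ, ℝ) ∞ f) :
    ContMDiff (𝓘(ℝ, ℝ).prod 𝓘(ℝ, EM)) 𝓘(ℝ, ℝ) ∞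
      (fun p : ℝ × M => dirDeriv EM f p.2 (A.anchor p.2 (u p.1 p.2))) := by
  have h := hu (A.coanchorSec (exactForm hf))
  refine h.congr fun p => ?_
  rw [A.metric_symm, coanchorSec_apply, metric_coanchor]
  rfl

variable (A)

/-- The curve `v` of vectors over the curve `γ` has covariant derivative `z` at time `t`, for the
derivative along `γ` which acts on sections as the bracket `⟦ς, ·⟧`. It is tested on the pairings
with smooth sections. -/
def HasCovDerivAt (ς : Sec EM F V) {γ : ℝ → M} (v : ∀ s, V (γ s)) (t : ℝ) (z : V (γ t)) : Prop :=
  ∀ τ : Sec EM F V, HasDerivAt (fun s => A.metric (γ s) (v s) (τ (γ s)))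
    (A.metric (γ t) z (τ (γ t)) + A.metric (γ t) (v t) (A.bracket ς τ (γ t))) t

/-- The curve `γ` has velocity `a(ς)` at time `t`. -/
def HasAnchorVelocity (ς : Sec EM F V) (γ : ℝ → M) (t : ℝ) : Prop :=
  HasMFDerivAt 𝓘(ℝ, ℝ) 𝓘(ℝ, EM) γ t ((1 : ℝ →L[ℝ] ℝ).smulRight (A.anchor (γ t) (ς (γ t))))

variable {A}

theorem HasAnchorVelocity.hasDerivAt_metric {ς : Sec EM F V} {γ : ℝ → M} {t : ℝ}
    (hγ : A.HasAnchorVelocity ς γ t) (σ τ : Sec EM F V) :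
    HasDerivAt (fun s => A.metric (γ s) (σ (γ s)) (τ (γ s)))
      (A.metric (γ t) (A.bracket ς σ (γ t)) (τ (γ t)) +
        A.metric (γ t) (σ (γ t)) (A.bracket ς τ (γ t))) t := by
  rw [← A.anchor_metric]
  exact hasDerivAt_comp_curve ((A.metric_smooth σ τ).mdiffAt _) hγ

/-- If the pairings of `v` with a frame are differentiable, so are the coefficients of `v`. -/
theorem exists_differentiable_coeff {ς : Sec EM F V} {γ : ℝ → M} {t : ℝ}
    (hγ : A.HasAnchorVelocity ς γ t) {v : ∀ s, V (γ s)} {k : ℕ} {e : Fin k → Sec EM F V}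
    (he : ∀ᶠ x in 𝓝 (γ t), LinearIndependent ℝ (fun i => e i x) ∧
      Submodule.span ℝ (Set.range fun i => e i x) = ⊤)
    (hd : ∀ i, DifferentiableAt ℝ (fun s => A.metric (γ s) (v s) (e i (γ s))) t) :
    ∃ c : Fin k → ℝ → ℝ, (∀ i, DifferentiableAt ℝ (c i) t) ∧
      ∀ᶠ s in 𝓝 t, v s = ∑ i, c i s • e i (γ s) := by
  refine ⟨fun i s => ∑ j, (A.gram (γ s) (fun i => e i (γ s)))⁻¹ i j *
    A.metric (γ s) (v s) (e j (γ s)), fun i => ?_, ?_⟩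
  · refine DifferentiableAt.fun_sum fun j _ => DifferentiableAt.fun_mul ?_ (hd j)
    have hinv := contMDiffAt_matrix_inv (n := ∞) (J := 𝓘(ℝ, EM)) (p := γ t)
      (G := fun x => A.gram x (fun i => e i x)) (fun i j => A.metric_smooth (e i) (e j) _)
      (A.gram_det_ne_zero he.self_of_nhds.1 he.self_of_nhds.2) i j
    exact (hasDerivAt_comp_curve (hinv.mdifferentiableAt (by simp)) hγ).differentiableAt
  · filter_upwards [hγ.continuousAt.eventually he] with s hs
    exact A.eq_sum_gram_inv hs.1 hs.2 (v s)

theorem hasCovDerivAt_of_coeff {ς : Sec EM F V} {γ : ℝ → M} {t : ℝ}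
    (hγ : A.HasAnchorVelocity ς γ t) {v : ∀ s, V (γ s)} {k : ℕ} {e : Fin k → Sec EM F V}
    {c : Fin k → ℝ → ℝ} (hc : ∀ i, DifferentiableAt ℝ (c i) t)
    (hv : ∀ᶠ s in 𝓝 t, v s = ∑ i, c i s • e i (γ s)) :
    A.HasCovDerivAt ς v t
      (∑ i, (deriv (c i) t • e i (γ t) + c i t • A.bracket ς (e i) (γ t))) := by
  intro τ
  have h1 : HasDerivAt (fun s => ∑ i, c i s * A.metric (γ s) (e i (γ s)) (τ (γ s)))
      (∑ i, (deriv (c i) t * A.metric (γ t) (e i (γ t)) (τ (γ t)) + c i t *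
        (A.metric (γ t) (A.bracket ς (e i) (γ t)) (τ (γ t)) +
          A.metric (γ t) (e i (γ t)) (A.bracket ς τ (γ t))))) t :=
    HasDerivAt.fun_sum fun i _ => (hc i).hasDerivAt.mul (hγ.hasDerivAt_metric (e i) τ)
  refine (h1.congr_of_eventuallyEq ?_).congr_deriv ?_
  · filter_upwards [hv] with s hs
    rw [hs]
    simp [map_sum, LinearMap.sum_apply]
  · rw [hv.self_of_nhds]
    simp only [map_sum, LinearMap.sum_apply, map_add, LinearMap.add_apply, map_smul,
      LinearMap.smul_apply, smul_eq_mul]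
    rw [← Finset.sum_add_distrib]
    refine Finset.sum_congr rfl fun i _ => ?_
    ring

theorem HasCovDerivAt.unique {ς : Sec EM F V} {γ : ℝ → M} {t : ℝ} {v : ∀ s, V (γ s)}
    {z z' : V (γ t)} (h : A.HasCovDerivAt ς v t z) (h' : A.HasCovDerivAt ς v t z') : z = z' :=
  A.metric_ext_sec fun τ => by
    have := (h τ).unique (h' τ)
    linarith

/-- The covariant derivative is compatible with the metric. -/
theorem HasCovDerivAt.hasDerivAt_metric {ς : Sec EM F V} {γ : ℝ → M} {t : ℝ}
    (hγ : A.HasAnchorVelocity ς γ t) {v w : ∀ s, V (γ s)} {z z' : V (γ t)}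
    (hv : A.HasCovDerivAt ς v t z) (hw : A.HasCovDerivAt ς w t z') :
    HasDerivAt (fun s => A.metric (γ s) (v s) (w s))
      (A.metric (γ t) z (w t) + A.metric (γ t) (v t) z') t := by
  obtain ⟨e, he⟩ := exists_frame EM F (V := V) (γ t)
  obtain ⟨c, hc, hvc⟩ := exists_differentiable_coeff hγ he (fun i => (hv (e i)).differentiableAt)
  rw [hv.unique (hasCovDerivAt_of_coeff hγ hc hvc)]
  have h1 : HasDerivAt (fun s => ∑ i, c i s * A.metric (γ s) (w s) (e i (γ s)))
      (∑ i, (deriv (c i) t * A.metric (γ t) (w t) (e i (γ t)) + c i t *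
        (A.metric (γ t) z' (e i (γ t)) +
          A.metric (γ t) (w t) (A.bracket ς (e i) (γ t))))) t :=
    HasDerivAt.fun_sum fun i _ => (hc i).hasDerivAt.mul (hw (e i))
  refine (h1.congr_of_eventuallyEq ?_).congr_deriv ?_
  · filter_upwards [hvc] with s hs
    rw [A.metric_symm, hs]
    simp [map_sum]
  · conv_rhs => rw [A.metric_symm, A.metric_symm (γ t) (v t), hvc.self_of_nhds]
    simp only [map_sum, map_add, map_smul, smul_eq_mul]
    rw [← Finset.sum_add_distrib]
    refine Finset.sum_congr rfl fun i _ => ?_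
    ring

/-- If the pairings of `v` with a frame have the derivatives of a parallel curve, `v` is
parallel. -/
theorem hasCovDerivAt_zero_of_frame {ς : Sec EM F V} {γ : ℝ → M} {t : ℝ}
    (hγ : A.HasAnchorVelocity ς γ t) {v : ∀ s, V (γ s)} {k : ℕ} {e : Fin k → Sec EM F V}
    (he : ∀ᶠ x in 𝓝 (γ t), LinearIndependent ℝ (fun i => e i x) ∧
      Submodule.span ℝ (Set.range fun i => e i x) = ⊤)
    (hd : ∀ i, HasDerivAt (fun s => A.metric (γ s) (v s) (e i (γ s)))
      (A.metric (γ t) (v t) (A.bracket ς (e i) (γ t))) t) :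
    A.HasCovDerivAt ς v t 0 := by
  obtain ⟨c, hc, hvc⟩ := exists_differentiable_coeff hγ he (fun i => (hd i).differentiableAt)
  have h := hasCovDerivAt_of_coeff hγ hc hvc
  set z := ∑ i, (deriv (c i) t • e i (γ t) + c i t • A.bracket ς (e i) (γ t))
  have hz : ∀ i, A.metric (γ t) z (e i (γ t)) = 0 := fun i => by
    have := (h (e i)).unique (hd i)
    linarith
  have hz0 : z = 0 := by
    refine (A.metric_nondegenerate (γ t)).1 z fun u => ?_
    have hu : u ∈ Submodule.span ℝ (Set.range fun i => e i (γ t)) := by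
      rw [he.self_of_nhds.2]; trivial
    induction hu using Submodule.span_induction with
    | zero => simp
    | add u w _ _ hu hw => rw [map_add, hu, hw, add_zero]
    | smul c u _ hu => rw [map_smul, hu, smul_zero]
    | mem u hu =>
      obtain ⟨i, rfl⟩ := hu
      exact hz i
  rwa [hz0] at h

variable (A) in
/-- The curve `c` in the total space satisfies at time `t` the transport equation of the
time-dependent section `σ`: its base point moves with velocity `a(σ t)`, and it is parallel for
the derivative that acts on sections as `⟦σ t, ·⟧`. -/
def IsTransportAt (σ : ℝ → Sec EM F V) (c : ℝ → TotalSpace F V) (t : ℝ) : Prop :=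
  A.HasAnchorVelocity (σ t) (fun s => (c s).proj) t ∧
    A.HasCovDerivAt (σ t) (fun s => (c s).snd) t 0

theorem IsTransportAt.hasDerivAt {σ : ℝ → Sec EM F V} {c : ℝ → TotalSpace F V} {t : ℝ}
    (h : A.IsTransportAt σ c t) (τ : Sec EM F V) :
    HasDerivAt (fun s => A.metric (c s).proj (c s).snd (τ (c s).proj))
      (A.metric (c t).proj (c t).snd (A.bracket (σ t) τ (c t).proj)) t := by
  simpa using h.2 τ

theorem IsTransportAt.congr {σ : ℝ → Sec EM F V} {c c' : ℝ → TotalSpace F V} {t : ℝ}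
    (h : A.IsTransportAt σ c t) (hc : c' =ᶠ[𝓝 t] c) : A.IsTransportAt σ c' t := by
  have ht : c' t = c t := hc.self_of_nhds
  refine ⟨?_, fun τ => ?_⟩
  · have h1 : A.HasAnchorVelocity (σ t) (fun s => (c s).proj) t := h.1
    unfold HasAnchorVelocity at h1 ⊢
    have h2 := h1.congr_of_eventuallyEq (f₁ := fun s => (c' s).proj)
      (hc.mono fun s hs => congrArg TotalSpace.proj hs)
    exact h2.congr_mfderiv (congrArg (fun p : TotalSpace F V =>
      (1 : ℝ →L[ℝ] ℝ).smulRight (A.anchor p.proj (σ t p.proj) : EM)) ht.symm)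
  · have h1 := (h.hasDerivAt τ).congr_of_eventuallyEq
      (f₁ := fun s => A.metric (c' s).proj (c' s).snd (τ (c' s).proj))
      (hc.mono fun s hs =>
        congrArg (fun p : TotalSpace F V => A.metric p.proj p.snd (τ p.proj)) hs)
    rw [map_zero, LinearMap.zero_apply, zero_add]
    exact h1.congr_deriv (congrArg (fun p : TotalSpace F V =>
      A.metric p.proj p.snd (A.bracket (σ t) τ p.proj)) ht.symm)

theorem IsTransportAt.const_smul {σ : ℝ → Sec EM F V} {c : ℝ → TotalSpace F V} {t : ℝ}
    (h : A.IsTransportAt σ c t) (r : ℝ) :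
    A.IsTransportAt σ (fun s => ⟨(c s).proj, r • (c s).snd⟩) t := by
  refine ⟨h.1, fun τ => ?_⟩
  simpa using (h.hasDerivAt τ).const_mul r

theorem isTransportAt_zero {σ : ℝ → Sec EM F V} {γ : ℝ → M} {t : ℝ}
    (h : A.HasAnchorVelocity (σ t) γ t) :
    A.IsTransportAt σ (fun s => (⟨γ s, 0⟩ : TotalSpace F V)) t :=
  ⟨h, fun τ => by simpa using hasDerivAt_const t (0 : ℝ)⟩

end CourantAlgebroid

end Transport

/-! ### Evolution laws on manifolds -/

section Evolution

/-- A set of times that contains, near every time, all or none of the points is everything. -/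
theorem eq_univ_of_local_propagation {S : Set ℝ} (hne : S.Nonempty)
    (h : ∀ t₀, ∃ J ∈ 𝓝 t₀, ∀ t₁ ∈ J, ∀ t ∈ J, t₁ ∈ S → t ∈ S) : S = Set.univ := by
  refine IsClopen.eq_univ ⟨⟨isOpen_iff_mem_nhds.2 fun t₀ ht => ?_⟩,
    isOpen_iff_mem_nhds.2 fun t₀ ht => ?_⟩ hne
  · obtain ⟨J, hJ, hS⟩ := h t₀
    exact mem_of_superset hJ fun t htJ htS => ht (hS t htJ t₀ (mem_of_mem_nhds hJ) htS)
  · obtain ⟨J, hJ, hS⟩ := h t₀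
    exact mem_of_superset hJ fun t htJ => hS t₀ (mem_of_mem_nhds hJ) t htJ ht

theorem mem_nhds_square {X : Type*} [TopologicalSpace X] {x : X} {S : Set (X × X)}
    (hS : S ∈ 𝓝 (x, x)) : ∃ T ∈ 𝓝 x, T ×ˢ T ⊆ S := by
  obtain ⟨T, hT, T', hT', h⟩ := mem_nhds_prod_iff.1 hS
  exact ⟨T ∩ T', inter_mem hT hT',
    (Set.prod_mono Set.inter_subset_left Set.inter_subset_right).trans h⟩

variable {EN : Type*} [NormedAddCommGroup EN] [NormedSpace ℝ EN] {HN : Type*} [TopologicalSpace HN]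
  {J : ModelWithCorners ℝ EN HN} {N : Type*} [TopologicalSpace N] [ChartedSpace HN N]
  {G : Type*} [NormedAddCommGroup G] [NormedSpace ℝ G]
  {P : (ℝ → N) → ℝ → Prop}

variable (J G) in
/-- A condition `P c t` on curves `c` in the manifold `N` at the time `t` is an evolution law if it
is local and if, in suitable smooth coordinates with values in the normed space `G`, it becomes the
ordinary differential equation of a smooth time-dependent vector field. -/
structure IsEvolutionLaw (P : (ℝ → N) → ℝ → Prop) : Prop where
  congr : ∀ {c c' : ℝ → N} {t : ℝ}, P c t → c' =ᶠ[𝓝 t] c → P c' t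
  continuousAt : ∀ {c : ℝ → N} {t : ℝ}, (∀ᶠ τ in 𝓝 t, P c τ) → ContinuousAt c t
  exists_coordinates : ∀ (s₀ : ℝ) (p₀ : N), ∃ (K : N → G) (Ki : G → N) (f : ℝ × G → G),
    ContMDiff J 𝓘(ℝ, G) ∞ K ∧ ContMDiffAt 𝓘(ℝ, G) J ∞ Ki (K p₀) ∧ ContDiff ℝ ∞ f ∧
    (∀ᶠ p in 𝓝 p₀, Ki (K p) = p) ∧
    (∀ᶠ q in 𝓝 (s₀, p₀), ∀ c : ℝ → N, c q.1 = q.2 → P c q.1 →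
      HasDerivAt (fun t => K (c t)) (f (q.1, K q.2)) q.1) ∧
    (∀ᶠ q in 𝓝 (s₀, K p₀), ∀ z : ℝ → G, z q.1 = q.2 → HasDerivAt z (f q) q.1 →
      P (fun t => Ki (z t)) q.1)

namespace IsEvolutionLaw

theorem exists_local_evolution [CompleteSpace G] (hP : IsEvolutionLaw J G P) (s₀ : ℝ) (p₀ : N) :
    ∃ Θ : ℝ × ℝ × N → N,
      ContMDiffAt (𝓘(ℝ, ℝ).prod (𝓘(ℝ, ℝ).prod J)) J ∞ Θ (s₀, s₀, p₀) ∧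
      ∃ ε > 0, ∀ᶠ q in 𝓝 (s₀, p₀), Θ (q.1, q) = q.2 ∧
        ∀ t ∈ Set.Ioo (s₀ - ε) (s₀ + ε), P (fun t => Θ (t, q)) t := by
  obtain ⟨K, Ki, f, hK, hKi, hf, hKK, -, hz⟩ := hP.exists_coordinates s₀ p₀
  obtain ⟨Θ, hΘ, ε, hε, hq⟩ := MoserManin.exists_local_evolution hf s₀ (K p₀)
  have hΘ0 : Θ (s₀, s₀, K p₀) = K p₀ := hq.self_of_nhds.1
  have hKc : ContinuousAt (fun q : ℝ × N => (q.1, K q.2)) (s₀, p₀) :=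
    (continuous_fst.prodMk (hK.continuous.comp continuous_snd)).continuousAt
  refine ⟨fun z => Ki (Θ (z.1, z.2.1, K z.2.2)), ?_, ?_⟩
  · have h1 : ContMDiff (𝓘(ℝ, ℝ).prod (𝓘(ℝ, ℝ).prod J)) (𝓘(ℝ, ℝ × ℝ × G)) ∞
        (fun z : ℝ × ℝ × N => (z.1, z.2.1, K z.2.2)) :=
      contMDiff_fst.prodMk_space ((contMDiff_fst.comp contMDiff_snd).prodMk_space
        (hK.comp (contMDiff_snd.comp contMDiff_snd)))
    have h2 : ContMDiffAt (𝓘(ℝ, ℝ).prod (𝓘(ℝ, ℝ).prod J)) 𝓘(ℝ, G) ∞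
        (fun z : ℝ × ℝ × N => Θ (z.1, z.2.1, K z.2.2)) (s₀, s₀, p₀) :=
      ContDiffAt.comp_contMDiffAt (g := Θ) hΘ h1.contMDiffAt
    refine ContMDiffAt.comp (I' := 𝓘(ℝ, G)) (s₀, s₀, p₀) (g := Ki) ?_ h2
    rwa [hΘ0]
  · have hc : ContinuousAt (fun z : ℝ × ℝ × G => (z.1, Θ z)) (s₀, s₀, K p₀) :=
      continuous_fst.continuousAt.prodMk hΘ.continuousAt
    rw [← hΘ0] at hz
    obtain ⟨T, hT, U, hU, hTU⟩ := mem_nhds_prod_iff.1 (hc.eventually hz)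
    obtain ⟨δ, hδ, hδT⟩ := Metric.mem_nhds_iff.1 hT
    rw [Real.ball_eq_Ioo] at hδT
    refine ⟨min ε δ, lt_min hε hδ, ?_⟩
    filter_upwards [hKc.eventually hq, hKc.eventually hU,
      continuous_snd.continuousAt.eventually hKK] with q h1 h2 h3
    refine ⟨?_, fun t ht => ?_⟩
    · rw [h1.1]
      exact h3
    · have ht1 : t ∈ Set.Ioo (s₀ - ε) (s₀ + ε) :=
        ⟨by linarith [ht.1, min_le_left ε δ], by linarith [ht.2, min_le_left ε δ]⟩
      have ht2 : t ∈ Set.Ioo (s₀ - δ) (s₀ + δ) :=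
        ⟨by linarith [ht.1, min_le_right ε δ], by linarith [ht.2, min_le_right ε δ]⟩
      exact hTU (show (t, (q.1, K q.2)) ∈ T ×ˢ U from ⟨hδT ht2, h2⟩)
        (fun t => Θ (t, q.1, K q.2)) rfl (h1.2 t ht1)

theorem eventuallyEq (hP : IsEvolutionLaw J G P) {c₁ c₂ : ℝ → N} {t₀ : ℝ}
    (h₁ : ∀ᶠ t in 𝓝 t₀, P c₁ t) (h₂ : ∀ᶠ t in 𝓝 t₀, P c₂ t) (h : c₁ t₀ = c₂ t₀) :
    c₁ =ᶠ[𝓝 t₀] c₂ := by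
  obtain ⟨K, Ki, f, hK, hKi, hf, hKK, hc, -⟩ := hP.exists_coordinates t₀ (c₁ t₀)
  obtain ⟨C, S, hS, hL⟩ := (hf.contDiffAt (x := (t₀, K (c₁ t₀)))).of_le
    (show (1 : ℕ∞ω) ≤ ∞ by simp) |>.exists_lipschitzOnWith
  have key : ∀ c : ℝ → N, c t₀ = c₁ t₀ → (∀ᶠ t in 𝓝 t₀, P c t) →
      (∀ᶠ t in 𝓝 t₀, HasDerivAt (fun t => K (c t)) (f (t, K (c t))) t ∧
        K (c t) ∈ {y | (t, y) ∈ S}) ∧ ∀ᶠ t in 𝓝 t₀, Ki (K (c t)) = c t := by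
    intro c hct hcP
    have hcc := hP.continuousAt hcP
    have hg : ContinuousAt (fun t => (t, c t)) t₀ := continuousAt_id.prodMk hcc
    have hg' : ContinuousAt (fun t => (t, K (c t))) t₀ :=
      continuousAt_id.prodMk (hK.continuous.continuousAt.comp hcc)
    rw [← hct] at hS hc hKK
    refine ⟨?_, hcc.eventually hKK⟩
    filter_upwards [hg.eventually hc, hg'.eventually hS, hcP] with t h1 h2 h3
    exact ⟨h1 c rfl h3, h2⟩
  obtain ⟨h1, h1'⟩ := key c₁ rfl h₁
  obtain ⟨h2, h2'⟩ := key c₂ h.symm h₂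
  have := ODE_solution_unique_of_eventually (v := fun t y => f (t, y))
    (s := fun t => {y | (t, y) ∈ S}) (K := C) (.of_forall fun t => ?_) h1 h2
    (congrArg K h)
  · filter_upwards [this, h1', h2'] with t ht e1 e2
    rw [← e1, ← e2, ht]
  · intro y hy y' hy'
    have := hL hy hy'
    simpa [Prod.edist_eq] using this

theorem eqOn [T2Space N] (hP : IsEvolutionLaw J G P) {U : Set ℝ} (hU : IsOpen U)
    (hUc : IsPreconnected U) {c₁ c₂ : ℝ → N} {t₀ : ℝ} (ht₀ : t₀ ∈ U)
    (h₁ : ∀ t ∈ U, P c₁ t) (h₂ : ∀ t ∈ U, P c₂ t) (h : c₁ t₀ = c₂ t₀) : Set.EqOn c₁ c₂ U := by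
  have ev : ∀ t ∈ U, c₁ t = c₂ t → c₁ =ᶠ[𝓝 t] c₂ := fun t ht =>
    hP.eventuallyEq (mem_of_superset (hU.mem_nhds ht) h₁) (mem_of_superset (hU.mem_nhds ht) h₂)
  suffices hs : U ⊆ {t | c₁ =ᶠ[𝓝 t] c₂} from fun t ht => (hs ht).self_of_nhds
  refine hUc.subset_of_closure_inter_subset isOpen_setOfPred_eventually_nhds ⟨t₀, ht₀, ev t₀ ht₀ h⟩ ?_
  rintro t ⟨ht, htU⟩
  refine ev t htU ?_
  have hc : ∀ c, (∀ t ∈ U, P c t) → ContinuousAt c t := fun c hc =>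
    hP.continuousAt (mem_of_superset (hU.mem_nhds htU) hc)
  have : (𝓝[{t | c₁ =ᶠ[𝓝 t] c₂}] t).NeBot := mem_closure_iff_nhdsWithin_neBot.1 ht
  refine tendsto_nhds_unique_of_eventuallyEq (l := 𝓝[{t | c₁ =ᶠ[𝓝 t] c₂}] t) (f := c₁) (g := c₂)
    ((hc c₁ h₁).tendsto.mono_left nhdsWithin_le_nhds)
    ((hc c₂ h₂).tendsto.mono_left nhdsWithin_le_nhds)
    (eventually_nhdsWithin_of_forall fun τ hτ => EventuallyEq.eq_of_nhds hτ)

theorem eq [T2Space N] (hP : IsEvolutionLaw J G P) {c₁ c₂ : ℝ → N} (t₀ : ℝ)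
    (h₁ : ∀ t, P c₁ t) (h₂ : ∀ t, P c₂ t) (h : c₁ t₀ = c₂ t₀) : c₁ = c₂ :=
  funext fun t => hP.eqOn isOpen_univ isPreconnected_univ (Set.mem_univ t₀) (fun t _ => h₁ t)
    (fun t _ => h₂ t) h (Set.mem_univ t)

/-- If, near every time, the solutions starting in the sets `Z t` exist for a uniform time and
remain in these sets, then all of them exist for all times. -/
theorem exists_global [T2Space N] (hP : IsEvolutionLaw J G P) (Z : ℝ → Set N)
    (hZ : ∀ t₀, ∃ a b, a < t₀ ∧ t₀ < b ∧ ∀ t₁ ∈ Set.Ioo a b, ∀ p ∈ Z t₁, ∃ c : ℝ → N, c t₁ = p ∧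
      ∀ t ∈ Set.Ioo a b, P c t ∧ c t ∈ Z t) (s₀ : ℝ) {p : N} (hp : p ∈ Z s₀) :
    ∃ c : ℝ → N, c s₀ = p ∧ ∀ t, P c t := by
  set S : Set ℝ := {t | ∃ U : Set ℝ, IsOpen U ∧ U.OrdConnected ∧ s₀ ∈ U ∧ t ∈ U ∧
    ∃ c : ℝ → N, c s₀ = p ∧ ∀ t ∈ U, P c t ∧ c t ∈ Z t} with hS
  have hSu : S = Set.univ := by
    refine eq_univ_of_local_propagation ⟨s₀, ?_⟩ fun t₀ => ?_
    · obtain ⟨a, b, ha, hb, h⟩ := hZ s₀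
      obtain ⟨c, hc, hcP⟩ := h s₀ ⟨ha, hb⟩ p hp
      exact ⟨Set.Ioo a b, isOpen_Ioo, Set.ordConnected_Ioo, ⟨ha, hb⟩, ⟨ha, hb⟩, c, hc, hcP⟩
    · obtain ⟨a, b, ha, hb, h⟩ := hZ t₀
      refine ⟨Set.Ioo a b, Ioo_mem_nhds ha hb, ?_⟩
      rintro t₁ ht₁ t ht ⟨U, hUo, hUc, hsU, htU, c, hc, hcP⟩
      obtain ⟨c', hc', hcP'⟩ := h t₁ ht₁ (c t₁) (hcP t₁ htU).2
      have heq : Set.EqOn c' c (U ∩ Set.Ioo a b) :=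
        hP.eqOn (hUo.inter isOpen_Ioo) (hUc.inter Set.ordConnected_Ioo).isPreconnected ⟨htU, ht₁⟩
          (fun t ht => (hcP' t ht.2).1) (fun t ht => (hcP t ht.1).1) hc'
      classical
      have h1 : Set.EqOn (U.piecewise c c') c U := Set.piecewise_eqOn U c c'
      have h2 : Set.EqOn (U.piecewise c c') c' (Set.Ioo a b) := fun τ hτ => by
        by_cases hτU : τ ∈ U
        · rw [h1 hτU, heq ⟨hτU, hτ⟩]
        · exact Set.piecewise_eq_of_notMem U c c' hτU
      refine ⟨U ∪ Set.Ioo a b, hUo.union isOpen_Ioo, isPreconnected_iff_ordConnected.1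
        (hUc.isPreconnected.union t₁ htU ht₁ isPreconnected_Ioo), Or.inl hsU, Or.inr ht,
        U.piecewise c c', (h1 hsU).trans hc, ?_⟩
      rintro τ (hτ | hτ)
      · refine ⟨hP.congr (hcP τ hτ).1 (h1.eventuallyEq_of_mem (hUo.mem_nhds hτ)), ?_⟩
        rw [h1 hτ]
        exact (hcP τ hτ).2
      · refine ⟨hP.congr (hcP' τ hτ).1 (h2.eventuallyEq_of_mem (isOpen_Ioo.mem_nhds hτ)), ?_⟩
        rw [h2 hτ]
        exact (hcP' τ hτ).2
  have hall : ∀ t, t ∈ S := fun t => hSu ▸ Set.mem_univ t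
  choose U hUo hUc hsU htU c hc hcP using hall
  refine ⟨fun t => c t t, hc s₀, fun t => hP.congr (hcP t t (htU t)).1 ?_⟩
  filter_upwards [(hUo t).mem_nhds (htU t)] with τ hτ
  exact hP.eqOn ((hUo τ).inter (hUo t)) ((hUc τ).inter (hUc t)).isPreconnected ⟨hsU τ, hsU t⟩
    (fun r hr => (hcP τ r hr.1).1) (fun r hr => (hcP t r hr.2).1) ((hc τ).trans (hc t).symm)
    ⟨htU τ, hτ⟩

section Global

variable (hex : ∀ s p, ∃ c : ℝ → N, c s = p ∧ ∀ t, P c t)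

/-- The global evolution: `evolution hex t s p` is the value at time `t` of the solution which
passes through `p` at time `s`. -/
def _root_.MoserManin.evolution (hex : ∀ s p, ∃ c : ℝ → N, c s = p ∧ ∀ t, P c t)
    (t s : ℝ) (p : N) : N :=
  (hex s p).choose t

theorem _root_.MoserManin.evolution_self (s : ℝ) (p : N) : evolution hex s s p = p :=
  (hex s p).choose_spec.1

theorem _root_.MoserManin.evolution_law (s : ℝ) (p : N) (t : ℝ) :
    P (fun t => evolution hex t s p) t :=
  (hex s p).choose_spec.2 t

theorem evolution_eq [T2Space N] (hP : IsEvolutionLaw J G P) {c : ℝ → N} (hc : ∀ t, P c t) (t s : ℝ) :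
    evolution hex t s (c s) = c t :=
  congrFun (hP.eq s (evolution_law hex s (c s)) hc (evolution_self hex s (c s))) t

theorem evolution_evolution [T2Space N] (hP : IsEvolutionLaw J G P) (t s r : ℝ) (p : N) :
    evolution hex t s (evolution hex s r p) = evolution hex t r p :=
  hP.evolution_eq hex (evolution_law hex r p) t s

/-- The global evolution is smooth in all variables. -/
theorem contMDiff_evolution [CompleteSpace G] [T2Space N] [IsManifold J ∞ N]
    (hP : IsEvolutionLaw J G P) :
    ContMDiff (𝓘(ℝ, ℝ).prod (𝓘(ℝ, ℝ).prod J)) J ∞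
      (fun z : ℝ × ℝ × N => evolution hex z.1 z.2.1 z.2.2) := by
  suffices h : ∀ (n : ℕ) (s₀ : ℝ) (p₀ : N), {t | ContMDiffAt (𝓘(ℝ, ℝ).prod (𝓘(ℝ, ℝ).prod J)) J n
      (fun z : ℝ × ℝ × N => evolution hex z.1 z.2.1 z.2.2) (t, s₀, p₀)} = Set.univ from
    fun z => contMDiffAt_infty.2 fun n => by
      have := Set.mem_univ z.1
      rwa [← h n z.2.1 z.2.2] at this
  intro n s₀ p₀
  have : IsManifold J n N := .of_le (n := ∞) (by exact_mod_cast le_top)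
  have hn : (n : ℕ∞ω) ≤ ∞ := by exact_mod_cast le_top
  -- the relation of the global evolution to a local one
  have hloc : ∀ {Θ : ℝ × ℝ × N → N} {a b s : ℝ} {p : N}, Θ (s, s, p) = p → s ∈ Set.Ioo a b →
      (∀ t ∈ Set.Ioo a b, P (fun t => Θ (t, s, p)) t) → ∀ t ∈ Set.Ioo a b,
      evolution hex t s p = Θ (t, s, p) := fun h1 h2 h3 =>
    hP.eqOn isOpen_Ioo isPreconnected_Ioo h2 (fun t _ => evolution_law hex _ _ t) h3
      ((evolution_self hex _ _).trans h1.symm)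
  refine eq_univ_of_local_propagation ⟨s₀, ?_⟩ fun t₀ => ?_
  · obtain ⟨Θ, hΘ, ε, hε, h⟩ := hP.exists_local_evolution s₀ p₀
    refine (hΘ.of_le hn).congr_of_eventuallyEq ?_
    have hI : Set.Ioo (s₀ - ε) (s₀ + ε) ∈ 𝓝 s₀ := Ioo_mem_nhds (by linarith) (by linarith)
    have h1 : ContinuousAt (fun z : ℝ × ℝ × N => z.1) (s₀, s₀, p₀) := continuous_fst.continuousAt
    have h2 : ContinuousAt (fun z : ℝ × ℝ × N => z.2.1) (s₀, s₀, p₀) :=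
      (continuous_fst.comp continuous_snd).continuousAt
    have h3 : ContinuousAt (fun z : ℝ × ℝ × N => z.2) (s₀, s₀, p₀) := continuous_snd.continuousAt
    filter_upwards [h1.eventually hI, h2.eventually hI, h3.eventually h] with z hz1 hz2 hz3
    exact hloc hz3.1 hz2 hz3.2 z.1 hz1
  · set q : ℝ → N := fun t => evolution hex t s₀ p₀ with hq
    have hqc : Continuous q := continuous_iff_continuousAt.2 fun t =>
      hP.continuousAt (.of_forall (evolution_law hex s₀ p₀))
    obtain ⟨Θ, hΘ, ε, hε, h⟩ := hP.exists_local_evolution t₀ (q t₀)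
    have hΘn := (contMDiffAt_iff_contMDiffAt_nhds (by simp)).1 (hΘ.of_le hn)
    have h1 : ContinuousAt (fun τ : ℝ × ℝ => (τ.2, τ.1, q τ.1)) (t₀, t₀) :=
      (continuous_snd.prodMk (continuous_fst.prodMk (hqc.comp continuous_fst))).continuousAt
    have h2 : ContinuousAt (fun τ : ℝ × ℝ => (τ.1, q τ.1)) (t₀, t₀) :=
      (continuous_fst.prodMk (hqc.comp continuous_fst)).continuousAt
    have hI : Set.Ioo (t₀ - ε) (t₀ + ε) ∈ 𝓝 t₀ := Ioo_mem_nhds (by linarith) (by linarith)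
    have hall := ((h1.eventually hΘn).and (h2.eventually (eventually_eventually_nhds.2 h))).and
      ((continuous_fst.continuousAt (x := (t₀, t₀))).eventually hI |>.and
        ((continuous_snd.continuousAt (x := (t₀, t₀))).eventually hI))
    obtain ⟨T, hT, hTh⟩ := mem_nhds_square hall
    refine ⟨T, hT, fun t₁ ht₁ t ht hs => ?_⟩
    rw [Set.mem_ofPred_eq] at hs
    obtain ⟨⟨hA, hB⟩, hI1, hI2⟩ := hTh (Set.mk_mem_prod ht₁ ht)
    have hE : ContMDiffAt (𝓘(ℝ, ℝ).prod (𝓘(ℝ, ℝ).prod J)) J n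
        (fun z : ℝ × ℝ × N => evolution hex t₁ z.2.1 z.2.2) (t, s₀, p₀) := by
      have hm : ContMDiffAt (𝓘(ℝ, ℝ).prod (𝓘(ℝ, ℝ).prod J)) (𝓘(ℝ, ℝ).prod (𝓘(ℝ, ℝ).prod J)) n
          (fun z : ℝ × ℝ × N => (t₁, z.2)) (t, s₀, p₀) :=
        contMDiffAt_const.prodMk contMDiffAt_snd
      exact ContMDiffAt.comp (t, s₀, p₀)
        (g := fun z : ℝ × ℝ × N => evolution hex z.1 z.2.1 z.2.2) hs hm
    have hcomp : ContMDiffAt (𝓘(ℝ, ℝ).prod (𝓘(ℝ, ℝ).prod J)) J n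
        (fun z : ℝ × ℝ × N => Θ (z.1, t₁, evolution hex t₁ z.2.1 z.2.2)) (t, s₀, p₀) :=
      ContMDiffAt.comp (t, s₀, p₀) (g := Θ) hA
        (contMDiffAt_fst.prodMk (contMDiffAt_const.prodMk hE))
    refine hcomp.congr_of_eventuallyEq ?_
    have hc : ContinuousAt (fun z : ℝ × ℝ × N => (t₁, evolution hex t₁ z.2.1 z.2.2)) (t, s₀, p₀) :=
      continuousAt_const.prodMk hE.continuousAt
    have hc' : ContinuousAt (fun z : ℝ × ℝ × N => z.1) (t, s₀, p₀) := continuous_fst.continuousAt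
    filter_upwards [hc.eventually hB, hc'.eventually (isOpen_Ioo.mem_nhds hI2)] with z hz hzt
    rw [← hP.evolution_evolution hex z.1 t₁]
    exact hloc hz.1 hI1 hz.2 z.1 hzt

end Global

end IsEvolutionLaw

end Evolution

/-! ### The transport equation as an evolution law -/

section TransportEquation

variable {EM : Type*} [NormedAddCommGroup EM] [NormedSpace ℝ EM] [FiniteDimensional ℝ EM]
  {M : Type*} [TopologicalSpace M] [T2Space M] [ChartedSpace EM M] [IsManifold 𝓘(ℝ, EM) ∞ M]
  {F : Type*} [NormedAddCommGroup F] [NormedSpace ℝ F] [FiniteDimensional ℝ F]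
  {V : M → Type*} [TopologicalSpace (TotalSpace F V)]
  [∀ x, AddCommGroup (V x)] [∀ x, Module ℝ (V x)] [∀ x, TopologicalSpace (V x)]
  [FiberBundle F V] [VectorBundle ℝ F V] [ContMDiffVectorBundle ∞ F V 𝓘(ℝ, EM)]
  {A : CourantAlgebroid EM F V}

namespace CourantAlgebroid

variable (A) in
/-- The vector at `x` whose pairings with the frame `e` are `w`. -/
def ofPairings {k : ℕ} (e : Fin k → Sec EM F V) (x : M) (w : Fin k → ℝ) : TotalSpace F V :=
  ⟨x, ∑ i, (∑ j, (A.gram x (fun i => e i x))⁻¹ i j * w j) • e i x⟩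

theorem metric_ofPairings {k : ℕ} {e : Fin k → Sec EM F V} {x : M} (w : Fin k → ℝ)
    (τ : Sec EM F V) : A.metric x (A.ofPairings e x w).snd (τ x) =
      ∑ i, (∑ j, (A.gram x (fun i => e i x))⁻¹ i j * w j) * A.metric x (e i x) (τ x) := by
  simp [ofPairings, map_sum, LinearMap.sum_apply]

theorem metric_ofPairings_frame {k : ℕ} {e : Fin k → Sec EM F V} {x : M}
    (hb : LinearIndependent ℝ (fun i => e i x))
    (hs : Submodule.span ℝ (Set.range fun i => e i x) = ⊤) (w : Fin k → ℝ) (i : Fin k) :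
    A.metric x (A.ofPairings e x w).snd (e i x) = w i := by
  rw [metric_ofPairings]
  have hdet := A.gram_det_ne_zero hb hs
  set G := A.gram x (fun i => e i x) with hG
  have hsymm : ∀ j, A.metric x (e j x) (e i x) = G i j := fun j => A.metric_symm _ _ _
  have h1 : G * G⁻¹ = 1 := Matrix.mul_nonsing_inv _ (isUnit_iff_ne_zero.2 hdet)
  have h2 : (G * G⁻¹).mulVec w i = w i := by rw [h1, Matrix.one_mulVec]
  rw [← Matrix.mulVec_mulVec] at h2
  rw [← h2]
  simp only [hsymm, Matrix.mulVec, dotProduct]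
  exact Finset.sum_congr rfl fun j _ => mul_comm _ _

variable {EN : Type*} [NormedAddCommGroup EN] [NormedSpace ℝ EN] {HN : Type*} [TopologicalSpace HN]
  {J : ModelWithCorners ℝ EN HN} {N : Type*} [TopologicalSpace N] [ChartedSpace HN N] in
theorem contMDiffAt_metric_ofPairings {k : ℕ} {e : Fin k → Sec EM F V} {b : N → M}
    {w : N → Fin k → ℝ} {τ : N → Sec EM F V} {q : N}
    (hli : LinearIndependent ℝ (fun i => e i (b q)))
    (hs : Submodule.span ℝ (Set.range fun i => e i (b q)) = ⊤)
    (hb : ContMDiffAt J 𝓘(ℝ, EM) ∞ b q) (hw : ∀ i, ContMDiffAt J 𝓘(ℝ, ℝ) ∞ (fun q => w q i) q)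
    (hτ : ∀ i, ContMDiffAt J 𝓘(ℝ, ℝ) ∞ (fun q => A.metric (b q) (τ q (b q)) (e i (b q))) q) :
    ContMDiffAt J 𝓘(ℝ, ℝ) ∞
      (fun q => A.metric (b q) (A.ofPairings e (b q) (w q)).snd (τ q (b q))) q := by
  have hinv := contMDiffAt_matrix_inv (J := J) (n := ∞) (p := q)
    (G := fun q => A.gram (b q) (fun i => e i (b q)))
    (fun i j => ((A.metric_smooth (e i) (e j)) _).comp q hb) (A.gram_det_ne_zero hli hs)
  refine ContMDiffAt.congr_of_eventuallyEq ?_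
    (.of_forall fun q => metric_ofPairings (A := A) (x := b q) (w q) (τ q))
  exact ContMDiffAt.sum fun i _ => (ContMDiffAt.sum fun j _ => (hinv i j).mul (hw j)).mul
    ((hτ i).congr_of_eventuallyEq (.of_forall fun q => A.metric_symm _ _ _))

variable {EN : Type*} [NormedAddCommGroup EN] [NormedSpace ℝ EN] {HN : Type*} [TopologicalSpace HN]
  {J : ModelWithCorners ℝ EN HN} {N : Type*} [TopologicalSpace N] [ChartedSpace HN N] in
theorem contMDiffAt_ofPairings {k : ℕ} {e : Fin k → Sec EM F V} {b : N → M} {w : N → Fin k → ℝ}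
    {q : N} (hli : LinearIndependent ℝ (fun i => e i (b q)))
    (hs : Submodule.span ℝ (Set.range fun i => e i (b q)) = ⊤)
    (hb : ContMDiffAt J 𝓘(ℝ, EM) ∞ b q) (hw : ∀ i, ContMDiffAt J 𝓘(ℝ, ℝ) ∞ (fun q => w q i) q) :
    ContMDiffAt J (𝓘(ℝ, EM).prod 𝓘(ℝ, F)) ∞ (fun q => A.ofPairings e (b q) (w q)) q :=
  A.contMDiffAt_of_metric le_rfl hb fun τ => contMDiffAt_metric_ofPairings (τ := fun _ => τ)
    hli hs hb hw fun i => ((A.metric_smooth τ (e i)) _).comp q hb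

theorem continuousAt_of_isTransportAt {σ : ℝ → Sec EM F V} {c : ℝ → TotalSpace F V} {t : ℝ}
    (h : ∀ᶠ s in 𝓝 t, A.IsTransportAt σ c s) : ContinuousAt c t := by
  have key : ∀ {EN : Type _} [NormedAddCommGroup EN] [NormedSpace ℝ EN] {N : Type _}
      [TopologicalSpace N] [ChartedSpace EN N] {f : ℝ → N}, (∀ᶠ s in 𝓝 t, ContinuousAt f s) →
      ContMDiffAt 𝓘(ℝ, ℝ) 𝓘(ℝ, EN) 0 f t := fun hf =>
    (contMDiffOn_zero_iff.2 fun s hs => ContinuousAt.continuousWithinAt hs).contMDiffAt hf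
  refine (A.contMDiffAt_of_metric (n := 0) (J := 𝓘(ℝ, ℝ)) (by simp) (key ?_)
    fun τ => ?_).continuousAt
  · exact h.mono fun s hs => hs.1.continuousAt
  · exact (contMDiffOn_zero_iff.2 fun s (hs : A.IsTransportAt σ c s) =>
      (hs.hasDerivAt τ).continuousAt.continuousWithinAt).contMDiffAt h

theorem t2Space_totalSpace (A : CourantAlgebroid EM F V) : T2Space (TotalSpace F V) := by
  refine ⟨fun p q hpq => ?_⟩
  by_cases h : p.proj = q.proj
  · obtain ⟨x, v⟩ := p
    obtain ⟨y, w⟩ := q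
    obtain rfl : x = y := h
    have hvw : v ≠ w := fun h => hpq (by rw [h])
    obtain ⟨τ, hτ⟩ : ∃ τ : Sec EM F V, A.metric x v (τ x) ≠ A.metric x w (τ x) := by
      by_contra! hc
      exact hvw (A.metric_ext_sec hc)
    exact separated_by_continuous (A.contMDiff_metric_total τ).continuous hτ
  · exact separated_by_continuous (FiberBundle.continuous_proj F V) h

theorem isEvolutionLaw {σ : ℝ → Sec EM F V} (hσ : A.SmoothSecFamily σ) :
    IsEvolutionLaw (𝓘(ℝ, EM).prod 𝓘(ℝ, F)) (EM × (Fin (Module.finrank ℝ F) → ℝ))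
      (A.IsTransportAt σ) where
  congr := IsTransportAt.congr
  continuousAt := continuousAt_of_isTransportAt
  exists_coordinates s₀ p₀ := by
    set G := EM × (Fin (Module.finrank ℝ F) → ℝ)
    obtain ⟨e, he⟩ := exists_frame EM F (V := V) p₀.proj
    obtain ⟨g, hg, hgφ⟩ := exists_smooth_eventuallyEq_extChartAt (EM := EM) p₀.proj
    set φ := extChartAt 𝓘(ℝ, EM) p₀.proj with hφ
    set b := Module.finBasis ℝ EM
    have hgl : ∀ l, ContMDiff 𝓘(ℝ, EM) 𝓘(ℝ, ℝ) ∞ (fun x => b.repr (g x) l) := fun l =>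
      (LinearMap.toContinuousLinearMap (b.coord l)).contMDiff.comp hg
    set K : TotalSpace F V → G := fun p =>
      (g p.proj, fun i => A.metric p.proj p.snd (e i p.proj)) with hKdef
    set Ki : G → TotalSpace F V := fun z => A.ofPairings e (φ.symm z.1) z.2 with hKidef
    -- the velocity field of the transport equation, in coordinates
    set vel : ℝ → TotalSpace F V → G := fun s p =>
      (∑ l, dirDeriv EM (fun x => b.repr (g x) l) p.proj (A.anchor p.proj (σ s p.proj)) • b l,
        fun i => A.metric p.proj p.snd (A.bracket (σ s) (e i) p.proj)) with hvel
    have hK : ContMDiff (𝓘(ℝ, EM).prod 𝓘(ℝ, F)) 𝓘(ℝ, G) ∞ K :=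
      (hg.comp (contMDiff_proj V)).prodMk_space
        (contMDiff_pi_space.2 fun i => A.contMDiff_metric_total (e i))
    -- the part of the base on which the frame and the chart are defined
    have hR : ∀ᶠ x in 𝓝 p₀.proj, (∀ᶠ y in 𝓝 x, LinearIndependent ℝ (fun i => e i y) ∧
        Submodule.span ℝ (Set.range fun i => e i y) = ⊤) ∧ g =ᶠ[𝓝 x] φ ∧ x ∈ φ.source := by
      filter_upwards [eventually_eventually_nhds.2 he, eventually_eventually_nhds.2 hgφ,
        extChartAt_source_mem_nhds (I := 𝓘(ℝ, EM)) p₀.proj] with x h1 h2 h3 using ⟨h1, h2, h3⟩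
    have hK0 : (K p₀).1 = φ p₀.proj := hgφ.self_of_nhds
    have hsymm : ContinuousAt φ.symm (φ p₀.proj) := continuousAt_extChartAt_symm _
    have hR' : ∀ᶠ y in 𝓝 (φ p₀.proj), y ∈ φ.target ∧
        (∀ᶠ y in 𝓝 (φ.symm y), LinearIndependent ℝ (fun i => e i y) ∧
          Submodule.span ℝ (Set.range fun i => e i y) = ⊤) ∧ g =ᶠ[𝓝 (φ.symm y)] φ := by
      have h0 : φ.symm (φ p₀.proj) = p₀.proj := extChartAt_to_inv _
      have hR1 := hR
      rw [← h0] at hR1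
      filter_upwards [extChartAt_target_mem_nhds (I := 𝓘(ℝ, EM)) p₀.proj,
        hsymm.eventually hR1] with y h1 h2 using ⟨h1, h2.1, h2.2.1⟩
    rw [← hK0] at hR'
    have hKi : ∀ᶠ z in 𝓝 (K p₀), ContMDiffAt 𝓘(ℝ, G) (𝓘(ℝ, EM).prod 𝓘(ℝ, F)) ∞ Ki z := by
      filter_upwards [continuous_fst.continuousAt.eventually hR'] with z hz
      refine contMDiffAt_ofPairings hz.2.1.self_of_nhds.1 hz.2.1.self_of_nhds.2 ?_ fun i => ?_
      · exact ((contMDiffOn_extChartAt_symm _).contMDiffAt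
          ((isOpen_extChartAt_target _).mem_nhds hz.1)).comp z
          contDiff_fst.contMDiff.contMDiffAt
      · exact (contDiff_pi.1 contDiff_snd i).contMDiff.contMDiffAt
    have hKK : ∀ᶠ p in 𝓝 p₀, Ki (K p) = p := by
      filter_upwards [(FiberBundle.continuous_proj F V).continuousAt.eventually hR] with p hp
      have h1 : φ.symm (g p.proj) = p.proj := by
        rw [hp.2.1.self_of_nhds]
        exact φ.left_inv hp.2.2
      simp only [hKdef, hKidef, h1]
      exact congrArg (TotalSpace.mk p.proj)
        (A.eq_sum_gram_inv hp.1.self_of_nhds.1 hp.1.self_of_nhds.2 p.snd).symm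
    obtain ⟨f, hf, hfe⟩ : ∃ f : ℝ × G → G, ContDiff ℝ ∞ f ∧
        f =ᶠ[𝓝 (s₀, K p₀)] fun q => vel q.1 (Ki q.2) := by
      obtain ⟨f, hf, hfe⟩ := exists_smooth_eventuallyEq (EM := ℝ × G) (M := ℝ × G)
        (f := fun q => vel q.1 (Ki q.2)) (x := (s₀, K p₀)) (by
          filter_upwards [continuous_snd.continuousAt.eventually hKi,
            (continuous_fst.comp continuous_snd).continuousAt.eventually hR'] with q hq hqR'
          have hqR := hqR'.2.1.self_of_nhds
          have hKiq : ContMDiffAt 𝓘(ℝ, ℝ × G) (𝓘(ℝ, EM).prod 𝓘(ℝ, F)) ∞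
              (fun q : ℝ × G => Ki q.2) q := ContMDiffAt.comp q hq
            contDiff_snd.contMDiff.contMDiffAt
          have hpr : ContMDiffAt 𝓘(ℝ, ℝ × G) (𝓘(ℝ, ℝ).prod 𝓘(ℝ, EM)) ∞
              (fun q : ℝ × G => (q.1, (Ki q.2).proj)) q :=
            contDiff_fst.contMDiff.contMDiffAt.prodMk ((contMDiff_proj V _).comp q hKiq)
          refine ContMDiffAt.prodMk_space ?_ (contMDiffAt_pi_space.2 fun i => ?_)
          · exact ContMDiffAt.sum fun l _ =>
              (((hσ.dirDeriv_anchor (hgl l)) _).comp q hpr).smul contMDiffAt_const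
          · exact contMDiffAt_metric_ofPairings (τ := fun q : ℝ × G => A.bracket (σ q.1) (e i))
              hqR.1 hqR.2 ((contMDiff_proj V _).comp q hKiq)
              (fun j => (contDiff_pi.1 (contDiff_snd.comp contDiff_snd) j).contMDiff.contMDiffAt)
              (fun k => ((hσ.bracket (e i)) (e k) _).comp q hpr))
      exact ⟨f, hf.contDiff, hfe⟩
    refine ⟨K, Ki, f, hK, hKi.self_of_nhds, hf, hKK, ?_, ?_⟩
    · have hKc : ContinuousAt (fun q : ℝ × TotalSpace F V => (q.1, K q.2)) (s₀, p₀) :=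
        (continuous_fst.prodMk (hK.continuous.comp continuous_snd)).continuousAt
      filter_upwards [hKc.eventually hfe, continuous_snd.continuousAt.eventually hKK]
        with q hq hqK c hc hcP
      rw [hq]
      simp only [hqK]
      obtain ⟨s, p⟩ := q
      obtain rfl : c s = p := hc
      refine HasDerivAt.prodMk ?_ (hasDerivAt_pi.2 fun i => hcP.hasDerivAt (e i))
      have h1 : ∀ l, HasDerivAt (fun t => b.repr (g (c t).proj) l) _ s := fun l =>
        hasDerivAt_comp_curve ((hgl l).mdiffAt _) hcP.1
      refine (HasDerivAt.fun_sum fun l _ => (h1 l).smul_const (b l)).congr_of_eventuallyEq ?_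
      exact .of_forall fun t => (b.sum_repr _).symm
    · have h1 : ContinuousAt (fun q : ℝ × G => q.2.1) (s₀, K p₀) :=
        (continuous_fst.comp continuous_snd).continuousAt
      filter_upwards [hfe, h1.eventually hR'] with q hq hqR z hz hzd
      obtain ⟨s, y⟩ := q
      obtain rfl : z s = y := hz
      have hzc : ContinuousAt (fun t => (z t).1) s := continuous_fst.continuousAt.comp
        hzd.continuousAt
      have hsc : ContinuousAt φ.symm (z s).1 := continuousAt_extChartAt_symm'' hqR.1
      set γ : ℝ → M := fun t => φ.symm (z t).1 with hγdef
      have hγc : ContinuousAt γ s := ContinuousAt.comp (g := φ.symm) hsc hzc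
      have hev : ∀ᶠ t in 𝓝 s, (z t).1 ∈ φ.target ∧
          (LinearIndependent ℝ (fun i => e i (γ t)) ∧
            Submodule.span ℝ (Set.range fun i => e i (γ t)) = ⊤) ∧ g (γ t) = (z t).1 := by
        filter_upwards [hzc.eventually ((isOpen_extChartAt_target _).mem_nhds hqR.1),
          hγc.eventually hqR.2.1, hγc.eventually hqR.2.2] with t h1 h2 h3
        exact ⟨h1, h2, h3.trans (φ.right_inv h1)⟩
      replace hzd : HasDerivAt z (vel s (Ki (z s))) s := by
        rw [hq] at hzd
        exact hzd
      have hzd1 : HasDerivAt (fun t => (z t).1) (vel s (Ki (z s))).1 s :=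
        (ContinuousLinearMap.fst ℝ EM (Fin (Module.finrank ℝ F) → ℝ)).hasFDerivAt.comp_hasDerivAt
          s hzd
      have hzd2 : HasDerivAt (fun t => (z t).2) (vel s (Ki (z s))).2 s :=
        (ContinuousLinearMap.snd ℝ EM (Fin (Module.finrank ℝ F) → ℝ)).hasFDerivAt.comp_hasDerivAt
          s hzd
      have hγd : MDifferentiableAt 𝓘(ℝ, ℝ) 𝓘(ℝ, EM) γ s := by
        have h2 : MDifferentiableAt 𝓘(ℝ, EM) 𝓘(ℝ, EM) φ.symm (z s).1 :=
          ((contMDiffOn_extChartAt_symm _).contMDiffAt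
            ((isOpen_extChartAt_target _).mem_nhds hqR.1)).mdifferentiableAt (n := ∞) (by simp)
        have h3 : MDifferentiableAt 𝓘(ℝ, ℝ) 𝓘(ℝ, EM) (fun t => (z t).1) s :=
          hzd1.differentiableAt.mdifferentiableAt
        exact h2.comp s h3
      have hbase : A.HasAnchorVelocity (σ s) γ s := by
        set v : TangentSpace 𝓘(ℝ, EM) (γ s) := mfderiv 𝓘(ℝ, ℝ) 𝓘(ℝ, EM) γ s (1 : ℝ) with hv
        have hγv : HasMFDerivAt 𝓘(ℝ, ℝ) 𝓘(ℝ, EM) γ s ((1 : ℝ →L[ℝ] ℝ).smulRight v) := by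
          refine hγd.hasMFDerivAt.congr_mfderiv ?_
          refine ContinuousLinearMap.ext_ring (?_ : (mfderiv 𝓘(ℝ, ℝ) 𝓘(ℝ, EM) γ s : ℝ →L[ℝ] EM) 1 =
            ((1 : ℝ →L[ℝ] ℝ).smulRight (v : EM)) 1)
          exact (one_smul ℝ (v : EM)).symm
        have hl : ∀ l, dirDeriv EM (fun x => b.repr (g x) l) (γ s) v =
            dirDeriv EM (fun x => b.repr (g x) l) (γ s) (A.anchor (γ s) (σ s (γ s))) := by
          intro l
          have h3 := hasDerivAt_comp_curve ((hgl l).mdiffAt _) hγv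
          have h4 : HasDerivAt (fun t => b.repr (z t).1 l) _ s :=
            (LinearMap.toContinuousLinearMap (b.coord l)).hasFDerivAt.comp_hasDerivAt s hzd1
          have h5 := h3.unique (h4.congr_of_eventuallyEq (hev.mono fun t ht => by
            simp only [ht.2.2]))
          rw [h5]
          exact congrFun (b.repr_sum_self fun l => dirDeriv EM (fun x => b.repr (g x) l) (γ s)
            (A.anchor (γ s) (σ s (γ s)))) l
        have hvw := dirDeriv_ext_of_chart b (φ.map_target hqR.1) hg hqR.2.2 hl
        rwa [hvw] at hγv
      refine ⟨hbase, hasCovDerivAt_zero_of_frame hbase hqR.2.1 fun i => ?_⟩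
      exact ((hasDerivAt_pi.1 hzd2) i).congr_of_eventuallyEq (hev.mono fun t ht =>
        metric_ofPairings_frame ht.2.1.1 ht.2.1.2 (z t).2 i)

end CourantAlgebroid

end TransportEquation

/-! ### The flow of a time-dependent section -/

section Flow

variable {EM : Type*} [NormedAddCommGroup EM] [NormedSpace ℝ EM] [FiniteDimensional ℝ EM]
  {M : Type*} [TopologicalSpace M] [T2Space M] [ChartedSpace EM M] [IsManifold 𝓘(ℝ, EM) ∞ M]
  {F : Type*} [NormedAddCommGroup F] [NormedSpace ℝ F] [FiniteDimensional ℝ F]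
  {V : M → Type*} [TopologicalSpace (TotalSpace F V)]
  [∀ x, AddCommGroup (V x)] [∀ x, Module ℝ (V x)] [∀ x, TopologicalSpace (V x)]
  [FiberBundle F V] [VectorBundle ℝ F V] [ContMDiffVectorBundle ∞ F V 𝓘(ℝ, EM)]
  {A : CourantAlgebroid EM F V}

namespace CourantAlgebroid

variable (A) in
/-- The time-dependent vector field `a(σ t)` is complete. -/
def IsCompleteSecFamily (σ : ℝ → Sec EM F V) : Prop :=
  ∀ (s : ℝ) (x : M), ∃ γ : ℝ → M, γ s = x ∧ ∀ t, A.HasAnchorVelocity (σ t) γ t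

theorem continuous_mk_smul (A : CourantAlgebroid EM F V) (x : M) (v : V x) :
    Continuous (fun r : ℝ => (⟨x, r • v⟩ : TotalSpace F V)) := by
  refine continuous_iff_continuousAt.2 fun r => ContMDiffAt.continuousAt (I := 𝓘(ℝ, ℝ)) (n := ∞)
    (I' := 𝓘(ℝ, EM).prod 𝓘(ℝ, F)) (A.contMDiffAt_of_metric le_rfl contMDiffAt_const fun τ => ?_)
  simp only [map_smul, LinearMap.smul_apply, smul_eq_mul]
  exact contMDiffAt_id.mul (contMDiffAt_const (c := A.metric x v (τ x)))

/-- If `a(σ t)` is complete, so is the transport equation: its solutions exist for a uniform time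
near a point of the zero section, and they may be rescaled. -/
theorem exists_transport {σ : ℝ → Sec EM F V} (hσ : A.SmoothSecFamily σ)
    (hc : A.IsCompleteSecFamily σ) (s : ℝ) (p : TotalSpace F V) :
    ∃ c : ℝ → TotalSpace F V, c s = p ∧ ∀ t, A.IsTransportAt σ c t := by
  have hT2 := t2Space_totalSpace A
  have hlaw := isEvolutionLaw hσ
  obtain ⟨γ, hγs, hγ⟩ := hc s p.proj
  refine hlaw.exists_global (fun t => {q | q.proj = γ t}) (fun t₀ => ?_) s hγs.symm
  obtain ⟨Θ, -, ε, hε, hΘ⟩ := hlaw.exists_local_evolution t₀ ⟨γ t₀, 0⟩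
  have hzero : ∀ t, A.IsTransportAt σ (fun t => (⟨γ t, 0⟩ : TotalSpace F V)) t := fun t =>
    isTransportAt_zero (hγ t)
  have hzc : ContinuousAt (fun t => (t, (⟨γ t, 0⟩ : TotalSpace F V))) t₀ :=
    continuousAt_id.prodMk (continuousAt_of_isTransportAt (.of_forall hzero))
  obtain ⟨δ, hδ, hball⟩ := Metric.eventually_nhds_iff_ball.1
    (hzc.eventually (eventually_eventually_nhds.2 hΘ))
  rw [Real.ball_eq_Ioo] at hball
  have hm1 := min_le_left ε δ
  have hm2 := min_le_right ε δ
  have hm : 0 < min ε δ := lt_min hε hδ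
  refine ⟨t₀ - min ε δ, t₀ + min ε δ, by linarith, by linarith, fun t₁ ht₁ q hq => ?_⟩
  obtain ⟨x, v⟩ := q
  obtain rfl : x = γ t₁ := hq
  have hr : ContinuousAt (fun r : ℝ => (t₁, (⟨γ t₁, r • v⟩ : TotalSpace F V))) 0 :=
    (continuous_const.prodMk (A.continuous_mk_smul (γ t₁) v)).continuousAt
  have hgood := hball t₁ ⟨by linarith [ht₁.1], by linarith [ht₁.2]⟩
  rw [show (⟨γ t₁, 0⟩ : TotalSpace F V) = ⟨γ t₁, (0 : ℝ) • v⟩ by rw [zero_smul]] at hgood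
  obtain ⟨r, hr1, hr0⟩ := (((hr.eventually hgood).filter_mono nhdsWithin_le_nhds).and
    (self_mem_nhdsWithin (s := {0}ᶜ))).exists
  have hsub : ∀ t ∈ Set.Ioo (t₀ - min ε δ) (t₀ + min ε δ), t ∈ Set.Ioo (t₀ - ε) (t₀ + ε) :=
    fun t ht => ⟨by linarith [ht.1], by linarith [ht.2]⟩
  have hd := fun t ht => hr1.2 t (hsub t ht)
  set d : ℝ → TotalSpace F V := fun t => Θ (t, t₁, ⟨γ t₁, r • v⟩)
  have hd1 : d t₁ = ⟨γ t₁, r • v⟩ := hr1.1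
  have hcomb : ∀ r' : ℝ, (⟨(d t₁).proj, r' • (d t₁).snd⟩ : TotalSpace F V) =
      ⟨γ t₁, r' • r • v⟩ := fun r' => by rw [hd1]
  have hbase : Set.EqOn (fun t => (⟨(d t).proj, (0 : ℝ) • (d t).snd⟩ : TotalSpace F V))
      (fun t => ⟨γ t, 0⟩) (Set.Ioo (t₀ - min ε δ) (t₀ + min ε δ)) :=
    hlaw.eqOn isOpen_Ioo isPreconnected_Ioo ht₁ (fun t ht => (hd t ht).const_smul 0)
      (fun t _ => hzero t) ((hcomb 0).trans (by rw [zero_smul]))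
  refine ⟨fun t => ⟨(d t).proj, r⁻¹ • (d t).snd⟩, (hcomb _).trans ?_, fun t ht =>
    ⟨(hd t ht).const_smul r⁻¹, congrArg TotalSpace.proj (hbase ht)⟩⟩
  rw [smul_smul, inv_mul_cancel₀ hr0, one_smul]

theorem HasCovDerivAt.add {ς : Sec EM F V} {γ : ℝ → M} {t : ℝ} {v w : ∀ s, V (γ s)}
    {z z' : V (γ t)} (hv : A.HasCovDerivAt ς v t z) (hw : A.HasCovDerivAt ς w t z') :
    A.HasCovDerivAt ς (fun s => v s + w s) t (z + z') := fun τ => by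
  simp only [map_add, LinearMap.add_apply]
  exact ((hv τ).add (hw τ)).congr_deriv (by ring)

theorem metric_congr {x y : M} {v w : V x} {v' w' : V y}
    (hv : (⟨x, v⟩ : TotalSpace F V) = ⟨y, v'⟩) (hw : (⟨x, w⟩ : TotalSpace F V) = ⟨y, w'⟩) :
    A.metric x v w = A.metric y v' w' := by
  obtain rfl : x = y := congrArg TotalSpace.proj hv
  rw [TotalSpace.mk_injective _ hv, TotalSpace.mk_injective _ hw]

theorem mk_add_congr {x y : M} {v w : V x} {v' w' : V y}
    (hv : (⟨x, v⟩ : TotalSpace F V) = ⟨y, v'⟩) (hw : (⟨x, w⟩ : TotalSpace F V) = ⟨y, w'⟩) :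
    (⟨x, v + w⟩ : TotalSpace F V) = ⟨y, v' + w'⟩ := by
  obtain rfl : x = y := congrArg TotalSpace.proj hv
  rw [TotalSpace.mk_injective _ hv, TotalSpace.mk_injective _ hw]

variable {σ : ℝ → Sec EM F V} (hσ : A.SmoothSecFamily σ) (hc : A.IsCompleteSecFamily σ)

/-- The flow of the time-dependent section `σ` on the total space, from time `s` to time `t`. -/
def flow (t s : ℝ) (p : TotalSpace F V) : TotalSpace F V :=
  evolution (exists_transport hσ hc) t s p

/-- The flow of `a(σ t)` on the base, from time `s` to time `t`. -/
def baseFlow (t s : ℝ) (x : M) : M := (flow hσ hc t s ⟨x, 0⟩).proj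

theorem isTransportAt_flow (s : ℝ) (p : TotalSpace F V) (t : ℝ) :
    A.IsTransportAt σ (fun t => flow hσ hc t s p) t :=
  evolution_law _ s p t

theorem flow_self (s : ℝ) (p : TotalSpace F V) : flow hσ hc s s p = p := evolution_self _ s p

theorem flow_eq {c : ℝ → TotalSpace F V} (h : ∀ t, A.IsTransportAt σ c t) {s : ℝ}
    {p : TotalSpace F V} (hp : c s = p) (t : ℝ) : flow hσ hc t s p = c t := by
  have := t2Space_totalSpace A
  subst hp
  exact (isEvolutionLaw hσ).evolution_eq _ h t s

theorem flow_flow (t s r : ℝ) (p : TotalSpace F V) :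
    flow hσ hc t s (flow hσ hc s r p) = flow hσ hc t r p :=
  flow_eq hσ hc (isTransportAt_flow hσ hc r p) rfl t

theorem contMDiff_flow :
    ContMDiff (𝓘(ℝ, ℝ).prod (𝓘(ℝ, ℝ).prod (𝓘(ℝ, EM).prod 𝓘(ℝ, F)))) (𝓘(ℝ, EM).prod 𝓘(ℝ, F)) ∞
      (fun z : ℝ × ℝ × TotalSpace F V => flow hσ hc z.1 z.2.1 z.2.2) :=
  have := t2Space_totalSpace A
  (isEvolutionLaw hσ).contMDiff_evolution _

theorem proj_flow (t s : ℝ) (p : TotalSpace F V) :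
    (flow hσ hc t s p).proj = baseFlow hσ hc t s p.proj := by
  have h := flow_eq hσ hc (fun t => (isTransportAt_flow hσ hc s p t).const_smul 0)
    (s := s) (p := ⟨p.proj, 0⟩) (by
      simp only [zero_smul]
      exact congrArg (fun q : TotalSpace F V => (⟨q.proj, 0⟩ : TotalSpace F V))
        (flow_self hσ hc s p)) t
  exact (congrArg TotalSpace.proj h).symm

theorem baseFlow_self (s : ℝ) (x : M) : baseFlow hσ hc s s x = x := by
  simp [baseFlow, flow_self]

theorem baseFlow_baseFlow (t s r : ℝ) (x : M) :
    baseFlow hσ hc t s (baseFlow hσ hc s r x) = baseFlow hσ hc t r x := by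
  have := congrArg TotalSpace.proj (flow_flow hσ hc t s r ⟨x, 0⟩)
  rwa [proj_flow, proj_flow, proj_flow] at this

theorem hasAnchorVelocity_baseFlow (s : ℝ) (x : M) (t : ℝ) :
    A.HasAnchorVelocity (σ t) (fun t => baseFlow hσ hc t s x) t :=
  (isTransportAt_flow hσ hc s ⟨x, 0⟩ t).1

theorem contMDiff_baseFlow :
    ContMDiff (𝓘(ℝ, ℝ).prod (𝓘(ℝ, ℝ).prod 𝓘(ℝ, EM))) 𝓘(ℝ, EM) ∞
      (fun z : ℝ × ℝ × M => baseFlow hσ hc z.1 z.2.1 z.2.2) := by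
  have h0 : ContMDiff 𝓘(ℝ, EM) (𝓘(ℝ, EM).prod 𝓘(ℝ, F)) ∞
      (fun x => (⟨x, 0⟩ : TotalSpace F V)) := contMDiff_zeroSection ℝ V
  exact (contMDiff_proj V).comp ((contMDiff_flow hσ hc).comp (contMDiff_fst.prodMk
    ((contMDiff_fst.comp contMDiff_snd).prodMk (h0.comp (contMDiff_snd.comp contMDiff_snd)))))

theorem exists_fiberFlow (s : ℝ) (x : M) : ∃ T : ∀ t, V x →ₗ[ℝ] V (baseFlow hσ hc t s x),
    ∀ t v, flow hσ hc t s ⟨x, v⟩ = ⟨baseFlow hσ hc t s x, T t v⟩ := by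
  have hex : ∀ t (v : V x), ∃ w : V (baseFlow hσ hc t s x),
      flow hσ hc t s ⟨x, v⟩ = ⟨baseFlow hσ hc t s x, w⟩ := fun t v => by
    rw [← proj_flow hσ hc t s ⟨x, v⟩]
    exact ⟨_, rfl⟩
  choose T hT using hex
  have hTt : ∀ v t, A.IsTransportAt σ
      (fun t => (⟨baseFlow hσ hc t s x, T t v⟩ : TotalSpace F V)) t := fun v t => by
    simp only [← hT]
    exact isTransportAt_flow hσ hc s ⟨x, v⟩ t
  have hTs : ∀ v, (⟨baseFlow hσ hc s s x, T s v⟩ : TotalSpace F V) = ⟨x, v⟩ := fun v => by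
    rw [← hT, flow_self]
  have hinj : ∀ {y : M} {w w' : V y}, (⟨y, w⟩ : TotalSpace F V) = ⟨y, w'⟩ → w = w' := fun h =>
    TotalSpace.mk_injective _ h
  refine ⟨fun t => ⟨⟨T t, fun v w => ?_⟩, fun r v => ?_⟩, hT⟩
  · have h1 : ∀ t, A.IsTransportAt σ
        (fun t => (⟨baseFlow hσ hc t s x, T t v + T t w⟩ : TotalSpace F V)) t := fun t =>
      ⟨(hTt v t).1, by
        have := (hTt v t).2.add (hTt w t).2
        rwa [add_zero] at this⟩
    have h2 := flow_eq hσ hc h1 (mk_add_congr (hTs v) (hTs w)) t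
    rw [hT] at h2
    exact hinj h2
  · have h1 := fun t => (hTt v t).const_smul r
    have h3 : (⟨baseFlow hσ hc s s x, r • T s v⟩ : TotalSpace F V) = ⟨x, r • v⟩ :=
      congrArg (fun p : TotalSpace F V => (⟨p.proj, r • p.snd⟩ : TotalSpace F V)) (hTs v)
    have h2 := flow_eq hσ hc h1 h3 t
    rw [hT] at h2
    exact hinj h2

/-- The linear map of fibres given by the flow. -/
def fiberFlow (t s : ℝ) (x : M) : V x →ₗ[ℝ] V (baseFlow hσ hc t s x) :=
  (exists_fiberFlow hσ hc s x).choose t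

theorem flow_mk (t s : ℝ) (x : M) (v : V x) :
    flow hσ hc t s ⟨x, v⟩ = ⟨baseFlow hσ hc t s x, fiberFlow hσ hc t s x v⟩ :=
  (exists_fiberFlow hσ hc s x).choose_spec t v

theorem isTransportAt_fiberFlow (s : ℝ) (x : M) (v : V x) (t : ℝ) : A.IsTransportAt σ
    (fun t => (⟨baseFlow hσ hc t s x, fiberFlow hσ hc t s x v⟩ : TotalSpace F V)) t := by
  simp only [← flow_mk]
  exact isTransportAt_flow hσ hc s ⟨x, v⟩ t

theorem fiberFlow_self (s : ℝ) (x : M) (v : V x) :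
    (⟨baseFlow hσ hc s s x, fiberFlow hσ hc s s x v⟩ : TotalSpace F V) = ⟨x, v⟩ := by
  rw [← flow_mk, flow_self]

/-- The metric is constant along pairs of transport curves. -/
theorem metric_fiberFlow (t s : ℝ) (x : M) (v w : V x) :
    A.metric (baseFlow hσ hc t s x) (fiberFlow hσ hc t s x v) (fiberFlow hσ hc t s x w) =
      A.metric x v w := by
  have hd : ∀ t, HasDerivAt (fun t => A.metric (baseFlow hσ hc t s x)
      (fiberFlow hσ hc t s x v) (fiberFlow hσ hc t s x w)) 0 t := fun t => by
    have hv := isTransportAt_fiberFlow hσ hc s x v t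
    have hw := isTransportAt_fiberFlow hσ hc s x w t
    simpa using hv.2.hasDerivAt_metric hv.1 hw.2
  rw [is_const_of_deriv_eq_zero (fun t => (hd t).differentiableAt) (fun t => (hd t).deriv) t s]
  exact metric_congr (fiberFlow_self hσ hc s x v) (fiberFlow_self hσ hc s x w)

theorem fiberFlow_bijective (t s : ℝ) (x : M) : Function.Bijective (fiberFlow hσ hc t s x) := by
  constructor
  · refine fun v w h => TotalSpace.mk_injective (F := F) x ?_
    have h1 : flow hσ hc t s ⟨x, v⟩ = flow hσ hc t s ⟨x, w⟩ := by rw [flow_mk, flow_mk, h]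
    rw [← flow_self hσ hc s ⟨x, v⟩, ← flow_self hσ hc s ⟨x, w⟩, ← flow_flow hσ hc s t s, h1,
      flow_flow]
  · intro w
    have h1 : (flow hσ hc s t ⟨baseFlow hσ hc t s x, w⟩).proj = x := by
      rw [proj_flow, baseFlow_baseFlow, baseFlow_self]
    have h2 : ∀ p : TotalSpace F V, p.proj = x → ∃ v : V x, p = ⟨x, v⟩ := by
      rintro ⟨y, v⟩ rfl
      exact ⟨v, rfl⟩
    obtain ⟨v, hv⟩ := h2 _ h1
    refine ⟨v, TotalSpace.mk_injective (F := F) _ ?_⟩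
    rw [← flow_mk, ← hv, flow_flow, flow_self]

/-- The diffeomorphism of the base given by the flow. -/
def baseDiffeo (t s : ℝ) : Diffeomorph 𝓘(ℝ, EM) 𝓘(ℝ, EM) M M ∞ where
  toFun := baseFlow hσ hc t s
  invFun := baseFlow hσ hc s t
  left_inv x := by rw [baseFlow_baseFlow, baseFlow_self]
  right_inv x := by rw [baseFlow_baseFlow, baseFlow_self]
  contMDiff_toFun := (contMDiff_baseFlow hσ hc).comp
    (contMDiff_const.prodMk (contMDiff_const.prodMk contMDiff_id))
  contMDiff_invFun := (contMDiff_baseFlow hσ hc).comp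
    (contMDiff_const.prodMk (contMDiff_const.prodMk contMDiff_id))

end CourantAlgebroid

end Flow

/-! ### The flow preserves the Courant structure -/

section FlowAutomorphism

variable {EM : Type*} [NormedAddCommGroup EM] [NormedSpace ℝ EM] [FiniteDimensional ℝ EM]
  {M : Type*} [TopologicalSpace M] [T2Space M] [ChartedSpace EM M] [IsManifold 𝓘(ℝ, EM) ∞ M]
  {F : Type*} [NormedAddCommGroup F] [NormedSpace ℝ F] [FiniteDimensional ℝ F]
  {V : M → Type*} [TopologicalSpace (TotalSpace F V)]
  [∀ x, AddCommGroup (V x)] [∀ x, Module ℝ (V x)] [∀ x, TopologicalSpace (V x)]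
  [FiberBundle F V] [VectorBundle ℝ F V] [ContMDiffVectorBundle ∞ F V 𝓘(ℝ, EM)]
  {A : CourantAlgebroid EM F V}

namespace CourantAlgebroid

/-- A smooth family of linear functionals applied to a smooth family of sections. -/
theorem SmoothSecFamily.contMDiff_apply {u : ℝ → Sec EM F V} (hu : A.SmoothSecFamily u)
    {B : ∀ p : ℝ × M, V p.2 →ₗ[ℝ] ℝ}
    (hB : ∀ τ : Sec EM F V, ContMDiff (𝓘(ℝ, ℝ).prod 𝓘(ℝ, EM)) 𝓘(ℝ, ℝ) ∞ (fun p => B p (τ p.2))) :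
    ContMDiff (𝓘(ℝ, ℝ).prod 𝓘(ℝ, EM)) 𝓘(ℝ, ℝ) ∞ (fun p => B p (u p.1 p.2)) := by
  intro p
  obtain ⟨e, he⟩ := exists_frame EM F (V := V) p.2
  have hp : ContMDiffAt (𝓘(ℝ, ℝ).prod 𝓘(ℝ, EM)) 𝓘(ℝ, EM) ∞ (fun q : ℝ × M => q.2) p :=
    contMDiffAt_snd
  have hinv := contMDiffAt_matrix_inv (J := 𝓘(ℝ, ℝ).prod 𝓘(ℝ, EM)) (n := ∞) (p := p)
    (G := fun q : ℝ × M => A.gram q.2 (fun i => e i q.2))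
    (fun i j => ((A.metric_smooth (e i) (e j)) _).comp p hp)
    (A.gram_det_ne_zero he.self_of_nhds.1 he.self_of_nhds.2)
  have h : ContMDiffAt (𝓘(ℝ, ℝ).prod 𝓘(ℝ, EM)) 𝓘(ℝ, ℝ) ∞ (fun q : ℝ × M =>
      ∑ i, (∑ j, (A.gram q.2 (fun i => e i q.2))⁻¹ i j * A.metric q.2 (u q.1 q.2) (e j q.2)) *
        B q (e i q.2)) p :=
    ContMDiffAt.sum fun i _ => (ContMDiffAt.sum fun j _ => (hinv i j).mul (hu (e j) p)).mul
      (hB (e i) p)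
  refine h.congr_of_eventuallyEq ?_
  filter_upwards [hp.continuousAt.eventually he] with q hq
  conv_lhs => rw [A.eq_sum_gram_inv hq.1 hq.2 (u q.1 q.2)]
  simp [map_sum]

/-- The bracket of two smooth families of sections is a smooth family. -/
theorem SmoothSecFamily.bracket_family {u w : ℝ → Sec EM F V} (hu : A.SmoothSecFamily u)
    (hw : A.SmoothSecFamily w) : A.SmoothSecFamily (fun t => A.bracket (u t) (w t)) := fun τ => by
  simp only [metric_bracket_right]
  refine ContMDiff.sub ?_ ?_
  · exact hu.contMDiff_apply (B := fun p => covector EM (fun y => A.metric y (w p.1 y) (τ y)) p.2 ∘ₗ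
      A.anchor p.2) fun ρ => contMDiff_dirDeriv_family (hw τ) (A.anchorField ρ)
  · refine hw.contMDiff_apply (B := fun p => (A.metric p.2).flip (A.bracket (u p.1) τ p.2))
      fun ρ => (hu.bracket τ ρ).congr fun p => A.metric_symm p.2 _ _

/-- The family `u` of sections has the pointwise derivative `u'` at time `t`; tested on pairings. -/
def HasSecDerivAt (A : CourantAlgebroid EM F V) (u : ℝ → Sec EM F V) (u' : Sec EM F V)
    (t : ℝ) : Prop :=
  ∀ (x : M) (v : V x), HasDerivAt (fun s => A.metric x (u s x) v) (A.metric x (u' x) v) t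

/-- The product rule for the evaluation of a family of functionals on a family of sections. -/
theorem HasSecDerivAt.hasDerivAt_apply {u : ℝ → Sec EM F V} {u' : Sec EM F V} {t : ℝ}
    (hu : A.HasSecDerivAt u u' t) {x : M} {B : ℝ → V x →ₗ[ℝ] ℝ} {B' : V x →ₗ[ℝ] ℝ}
    (hB : ∀ v, HasDerivAt (fun s => B s v) (B' v) t) :
    HasDerivAt (fun s => B s (u s x)) (B' (u t x) + B t (u' x)) t := by
  have : FiniteDimensional ℝ (V x) := VectorBundle.finiteDimensional ℝ F V x
  have hl : ∀ l : V x →ₗ[ℝ] ℝ, HasDerivAt (fun s => l (u s x)) (l (u' x)) t := fun l => by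
    have h := hu x (((A.metric x).toDual (A.metric_nondegenerate x)).symm l)
    have h2 : ∀ v, A.metric x v (((A.metric x).toDual (A.metric_nondegenerate x)).symm l) = l v :=
      fun v => by
        rw [A.metric_symm]
        exact LinearMap.BilinForm.apply_toDual_symm_apply (hB := A.metric_nondegenerate x) l v
    simpa only [h2] using h
  set b := Module.finBasis ℝ (V x)
  have h1 : ∀ (l : V x →ₗ[ℝ] ℝ) (v : V x), l v = ∑ i, b.coord i v * l (b i) := fun l v => by
    conv_lhs => rw [← b.sum_repr v, map_sum]
    simp only [map_smul, smul_eq_mul]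
    rfl
  rw [h1 B', h1 (B t) (u' x), ← Finset.sum_add_distrib]
  exact (HasDerivAt.fun_sum fun i _ => (((hl (b.coord i)).mul (hB (b i)))).congr_deriv
    (add_comm _ _)).congr_of_eventuallyEq (.of_forall fun s => h1 (B s) (u s x))

theorem hasDerivAt_dirDeriv_of_hasDerivAt {f : ℝ × M → ℝ} {f' : M → ℝ} {t : ℝ}
    (hf : ContMDiff (𝓘(ℝ, ℝ).prod 𝓘(ℝ, EM)) 𝓘(ℝ, ℝ) ∞ f)
    (hf' : ∀ y, HasDerivAt (fun s => f (s, y)) (f' y) t) (x : M) (v : TangentSpace 𝓘(ℝ, EM) x) :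
    HasDerivAt (fun s => dirDeriv EM (fun y => f (s, y)) x v) (dirDeriv EM f' x v) t := by
  have h := hasDerivAt_dirDeriv_family hf t x v
  rwa [funext fun y => (hf' y).deriv] at h

theorem HasSecDerivAt.bracket_const {u : ℝ → Sec EM F V} {u' : Sec EM F V} {t : ℝ}
    (hus : A.SmoothSecFamily u) (hu : A.HasSecDerivAt u u' t) (τ : Sec EM F V) :
    A.HasSecDerivAt (fun s => A.bracket (u s) τ) (A.bracket u' τ) t := fun x v => by
  obtain ⟨ρ, rfl⟩ := exists_sec_apply (EM := EM) (F := F) x v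
  simp only [metric_bracket_left]
  exact ((hasDerivAt_dirDeriv_of_hasDerivAt (hus τ) (fun y => hu y (τ y)) x _).sub
    (hasDerivAt_dirDeriv_of_hasDerivAt (hus ρ) (fun y => hu y (ρ y)) x _)).add (hu x _)

/-- The Leibniz rule for the time derivative of the bracket of two families. -/
theorem HasSecDerivAt.bracket {u w : ℝ → Sec EM F V} {u' w' : Sec EM F V} {t : ℝ}
    (hus : A.SmoothSecFamily u) (hu : A.HasSecDerivAt u u' t)
    (hws : A.SmoothSecFamily w) (hw : A.HasSecDerivAt w w' t) :
    A.HasSecDerivAt (fun s => A.bracket (u s) (w s)) (A.bracket u' (w t) + A.bracket (u t) w') t :=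
  fun x v => by
  obtain ⟨τ, rfl⟩ := exists_sec_apply (EM := EM) (F := F) x v
  have h1 := hu.hasDerivAt_apply (x := x)
    (B := fun s => covector EM (fun y => A.metric y (w s y) (τ y)) x ∘ₗ A.anchor x)
    (B' := covector EM (fun y => A.metric y (w' y) (τ y)) x ∘ₗ A.anchor x) fun v =>
      hasDerivAt_dirDeriv_of_hasDerivAt (hws τ) (fun y => hw y (τ y)) x _
  have h2 := hw.hasDerivAt_apply (x := x)
    (B := fun s => A.metric x (A.bracket (u s) τ x)) (B' := A.metric x (A.bracket u' τ x))
    fun v => hu.bracket_const hus τ x v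
  have h3 := h1.sub h2
  refine (h3.congr_of_eventuallyEq (.of_forall fun s => ?_)).congr_deriv ?_
  · refine (A.metric_bracket_right (u s) (w s) τ x).trans ?_
    rw [A.metric_symm x (w s x)]
    rfl
  · have e1 := A.metric_bracket_right u' (w t) τ x
    have e2 := A.metric_bracket_right (u t) w' τ x
    rw [A.metric_symm x (w t x)] at e1
    rw [A.metric_symm x (w' x)] at e2
    rw [ContMDiffSection.coe_add, Pi.add_apply, map_add, LinearMap.add_apply, e1, e2]
    change dirDeriv EM (fun y => A.metric y (w' y) (τ y)) x (A.anchor x (u t x)) +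
      dirDeriv EM (fun y => A.metric y (w t y) (τ y)) x (A.anchor x (u' x)) - _ = _
    ring

/-- The smooth family `u` of sections solves the equation `∂ u / ∂ t = - ⟦σ t, u⟧`. -/
def IsInvariantFamily (A : CourantAlgebroid EM F V) (σ u : ℝ → Sec EM F V) : Prop :=
  A.SmoothSecFamily u ∧ ∀ t, A.HasSecDerivAt u (-A.bracket (σ t) (u t)) t

/-- By the Jacobi identity, the bracket of invariant families is invariant. -/
theorem IsInvariantFamily.bracket {σ u w : ℝ → Sec EM F V} (hu : A.IsInvariantFamily σ u)
    (hw : A.IsInvariantFamily σ w) : A.IsInvariantFamily σ (fun t => A.bracket (u t) (w t)) := by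
  refine ⟨hu.1.bracket_family hw.1, fun t => ?_⟩
  have h := (hu.2 t).bracket hu.1 hw.1 (hw.2 t)
  rw [A.jacobi]
  convert h using 1
  rw [map_neg, map_neg, LinearMap.neg_apply, neg_add]

/-- The covariant derivative of a family of sections along an integral curve. -/
theorem HasSecDerivAt.hasCovDerivAt {ς : Sec EM F V} {u : ℝ → Sec EM F V} {u' : Sec EM F V}
    {γ : ℝ → M} {t : ℝ} (hus : A.SmoothSecFamily u) (hu : A.HasSecDerivAt u u' t)
    (hγ : A.HasAnchorVelocity ς γ t) :
    A.HasCovDerivAt ς (fun s => u s (γ s)) t ((u' + A.bracket ς (u t)) (γ t)) := fun τ => by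
  refine (hasDerivAt_comp_graph (hus τ) hγ).congr_deriv ?_
  have h := (hu (γ t) (τ (γ t))).deriv
  simp only at h ⊢
  rw [h, A.anchor_metric, ContMDiffSection.coe_add, Pi.add_apply, map_add, LinearMap.add_apply,
    add_assoc]

/-- Invariant families are parallel along the integral curves. -/
theorem IsInvariantFamily.isTransportAt {σ u : ℝ → Sec EM F V} (hu : A.IsInvariantFamily σ u)
    {γ : ℝ → M} {t : ℝ} (hγ : A.HasAnchorVelocity (σ t) γ t) :
    A.IsTransportAt σ (fun s => (⟨γ s, u s (γ s)⟩ : TotalSpace F V)) t := by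
  have h := (hu.2 t).hasCovDerivAt hu.1 hγ
  rw [neg_add_cancel] at h
  exact ⟨hγ, h⟩

variable {σ : ℝ → Sec EM F V} (hσ : A.SmoothSecFamily σ) (hc : A.IsCompleteSecFamily σ)

theorem exists_eq_mk_of_proj_eq {p : TotalSpace F V} {x : M} (h : p.proj = x) :
    ∃ v : V x, p = ⟨x, v⟩ := by
  subst h
  exact ⟨p.snd, rfl⟩

/-- The push-forward of a section by the flow is an invariant smooth family of sections. -/
theorem exists_pushforward (u : Sec EM F V) (s : ℝ) : ∃ w : ℝ → Sec EM F V,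
    A.IsInvariantFamily σ w ∧ ∀ t x, w t (baseFlow hσ hc t s x) = fiberFlow hσ hc t s x (u x) := by
  have hp : ∀ t y, ∃ v : V y,
      flow hσ hc t s ⟨baseFlow hσ hc s t y, u (baseFlow hσ hc s t y)⟩ = ⟨y, v⟩ := fun t y =>
    exists_eq_mk_of_proj_eq (by rw [proj_flow, baseFlow_baseFlow, baseFlow_self])
  choose w hw using hp
  have hsm : ∀ τ : Sec EM F V, ContMDiff (𝓘(ℝ, ℝ).prod 𝓘(ℝ, EM)) 𝓘(ℝ, ℝ) ∞
      (fun p : ℝ × M => A.metric p.2 (w p.1 p.2) (τ p.2)) := fun τ => by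
    have hb : ContMDiff (𝓘(ℝ, ℝ).prod 𝓘(ℝ, EM)) 𝓘(ℝ, EM) ∞
        (fun p : ℝ × M => baseFlow hσ hc s p.1 p.2) := (contMDiff_baseFlow hσ hc).comp
      (contMDiff_const.prodMk (contMDiff_fst.prodMk contMDiff_snd))
    have hu : ContMDiff 𝓘(ℝ, EM) (𝓘(ℝ, EM).prod 𝓘(ℝ, F)) ∞
      (fun x => (⟨x, u x⟩ : TotalSpace F V)) := u.contMDiff_toFun
    have hfl := (A.contMDiff_metric_total τ).comp ((contMDiff_flow hσ hc).comp
      (contMDiff_fst.prodMk (contMDiff_const (c := s) |>.prodMk (hu.comp hb))))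
    refine hfl.congr fun p => ?_
    change _ = A.metric (flow hσ hc p.1 s _).proj (flow hσ hc p.1 s _).snd _
    exact (congrArg (fun q : TotalSpace F V => A.metric q.proj q.snd (τ q.proj)) (hw p.1 p.2)).symm
  set W : ℝ → Sec EM F V := fun t => A.secOfMetric (w t) fun τ => contMDiff_of_family (hsm τ) t
  have hW : ∀ t x, W t (baseFlow hσ hc t s x) = fiberFlow hσ hc t s x (u x) := fun t x => by
    refine TotalSpace.mk_injective (F := F) _ ?_
    have h := hw t (baseFlow hσ hc t s x)
    rw [baseFlow_baseFlow, baseFlow_self, flow_mk] at h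
    exact h.symm
  refine ⟨W, ⟨hsm, fun t x v => ?_⟩, hW⟩
  obtain ⟨τ, rfl⟩ := exists_sec_apply (EM := EM) (F := F) x v
  obtain ⟨y, rfl⟩ : ∃ y, x = baseFlow hσ hc t s y :=
    ⟨baseFlow hσ hc s t x, by rw [baseFlow_baseFlow, baseFlow_self]⟩
  have h1 := (isTransportAt_fiberFlow hσ hc s y (u y) t).hasDerivAt τ
  simp only [← hW] at h1
  have h2 := hasDerivAt_comp_graph (hsm τ) (hasAnchorVelocity_baseFlow hσ hc s y t)
  have h3 := h1.unique h2
  have h4 := A.anchor_metric (σ t) (W t) τ (baseFlow hσ hc t s y)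
  have h5 := (hasDerivAt_family (hsm τ) (t, baseFlow hσ hc t s y)).differentiableAt.hasDerivAt
  refine h5.congr_deriv ?_
  simp only [ContMDiffSection.coe_neg, Pi.neg_apply, map_neg, LinearMap.neg_apply]
  simp only [W, secOfMetric_apply] at h3 h4 ⊢
  linarith

theorem bracket_fiberFlow (t s : ℝ) {u w u' w' : Sec EM F V}
    (hu : ∀ x, u' (baseFlow hσ hc t s x) = fiberFlow hσ hc t s x (u x))
    (hw : ∀ x, w' (baseFlow hσ hc t s x) = fiberFlow hσ hc t s x (w x)) (x : M) :
    A.bracket u' w' (baseFlow hσ hc t s x) = fiberFlow hσ hc t s x (A.bracket u w x) := by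
  have hext : ∀ (r : ℝ) {a b : Sec EM F V},
      (∀ x, a (baseFlow hσ hc r s x) = b (baseFlow hσ hc r s x)) → a = b := fun r a b h => by
    ext y
    have := h (baseFlow hσ hc s r y)
    rwa [baseFlow_baseFlow, baseFlow_self] at this
  have key : ∀ (u u' : Sec EM F V),
      (∀ x, u' (baseFlow hσ hc t s x) = fiberFlow hσ hc t s x (u x)) →
      ∃ U : ℝ → Sec EM F V, A.IsInvariantFamily σ U ∧ U s = u ∧ U t = u' := fun u u' h => by
    obtain ⟨U, hU, hUp⟩ := exists_pushforward hσ hc u s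
    refine ⟨U, hU, ?_, hext t fun x => (hUp t x).trans (h x).symm⟩
    ext x
    refine TotalSpace.mk_injective (F := F) _ ?_
    rw [← fiberFlow_self hσ hc s x (u x), ← hUp s x, baseFlow_self]
  obtain ⟨U, hU, rfl, rfl⟩ := key u u' hu
  obtain ⟨W, hW, rfl, rfl⟩ := key w w' hw
  have h := (hU.bracket hW)
  have h1 := flow_eq hσ hc (fun r => h.isTransportAt (hasAnchorVelocity_baseFlow hσ hc s x r))
    (s := s) (p := ⟨x, A.bracket (U s) (W s) x⟩) (by rw [baseFlow_self]) t
  rw [flow_mk] at h1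
  exact (TotalSpace.mk_injective (F := F) _ h1).symm

theorem dirDeriv_comp {Φ : M → M} {h : M → ℝ} {x : M}
    (hh : MDifferentiableAt 𝓘(ℝ, EM) 𝓘(ℝ, ℝ) h (Φ x))
    (hΦ : MDifferentiableAt 𝓘(ℝ, EM) 𝓘(ℝ, EM) Φ x) (v : TangentSpace 𝓘(ℝ, EM) x) :
    dirDeriv EM (fun y => h (Φ y)) x v =
      dirDeriv EM h (Φ x) (mfderiv 𝓘(ℝ, EM) 𝓘(ℝ, EM) Φ x v) := by
  have h1 := mfderiv_comp x hh hΦ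
  unfold dirDeriv
  exact congrArg (fun L : EM →L[ℝ] ℝ => L v) h1

/-- A fibrewise isometry that preserves brackets preserves the anchor: the anchor is determined by
the first axiom. -/
theorem anchor_fiberFlow (t s : ℝ) (x : M) (v : V x) :
    A.anchor (baseFlow hσ hc t s x) (fiberFlow hσ hc t s x v) =
      mfderiv 𝓘(ℝ, EM) 𝓘(ℝ, EM) (baseDiffeo hσ hc t s) x (A.anchor x v) := by
  by_cases hv : v = 0
  · subst hv
    simp only [map_zero]
    rfl
  set Φ := baseDiffeo hσ hc t s
  have hpb : ∀ τ' : Sec EM F V, ∃ τ : Sec EM F V,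
      ∀ x, τ' (baseFlow hσ hc t s x) = fiberFlow hσ hc t s x (τ x) := fun τ' => by
    obtain ⟨U, -, hUp⟩ := exists_pushforward hσ hc τ' t
    refine ⟨U s, fun x => TotalSpace.mk_injective (F := F) _ ?_⟩
    have h := hUp s (baseFlow hσ hc t s x)
    rw [← flow_mk]
    have h2 : (⟨x, U s x⟩ : TotalSpace F V) =
        flow hσ hc s t ⟨baseFlow hσ hc t s x, τ' (baseFlow hσ hc t s x)⟩ := by
      rw [flow_mk, ← h, baseFlow_baseFlow, baseFlow_self]
    rw [h2, flow_flow, flow_self]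
  have hpf : ∀ τ : Sec EM F V, ∃ τ' : Sec EM F V,
      ∀ x, τ' (baseFlow hσ hc t s x) = fiberFlow hσ hc t s x (τ x) := fun τ => by
    obtain ⟨U, -, hUp⟩ := exists_pushforward hσ hc τ s
    exact ⟨U t, hUp t⟩
  obtain ⟨ς, rfl⟩ := exists_sec_apply (EM := EM) (F := F) x v
  obtain ⟨ς', hς⟩ := hpf ς
  -- both vectors have the same effect on the pairings of sections
  have key : ∀ τ₁ τ₂ : Sec EM F V,
      dirDeriv EM (fun y => A.metric y (τ₁ y) (τ₂ y)) (baseFlow hσ hc t s x)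
        (A.anchor (baseFlow hσ hc t s x) (fiberFlow hσ hc t s x (ς x))) =
      dirDeriv EM (fun y => A.metric y (τ₁ y) (τ₂ y)) (Φ x)
        (mfderiv 𝓘(ℝ, EM) 𝓘(ℝ, EM) Φ x (A.anchor x (ς x))) := fun τ₁' τ₂' => by
    obtain ⟨τ₁, h₁⟩ := hpb τ₁'
    obtain ⟨τ₂, h₂⟩ := hpb τ₂'
    rw [← hς, A.anchor_metric, bracket_fiberFlow hσ hc t s hς h₁, bracket_fiberFlow hσ hc t s hς h₂,
      h₁, h₂, metric_fiberFlow, metric_fiberFlow, ← A.anchor_metric, ← dirDeriv_comp]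
    · refine dirDeriv_congr (.of_forall fun y => ?_) _
      change _ = A.metric (baseFlow hσ hc t s y) (τ₁' (baseFlow hσ hc t s y))
        (τ₂' (baseFlow hσ hc t s y))
      rw [h₁, h₂, metric_fiberFlow]
    · exact (A.metric_smooth τ₁' τ₂').mdiffAt _
    · exact Φ.contMDiff.mdifferentiableAt (by simp)
  refine dirDeriv_ext fun f hf => ?_
  have hne : fiberFlow hσ hc t s x (ς x) ≠ 0 := fun h =>
    hv ((fiberFlow_bijective hσ hc t s x).1 (h.trans (map_zero _).symm))
  obtain ⟨w, hw⟩ : ∃ w, A.metric _ (fiberFlow hσ hc t s x (ς x)) w ≠ 0 := by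
    by_contra! h
    exact hne ((A.metric_nondegenerate _).1 _ h)
  obtain ⟨τ, rfl⟩ := exists_sec_apply (EM := EM) (F := F) _ w
  rw [← hς] at hw
  have h1 := key (fsmul f hf ς') τ
  have h2 := key ς' τ
  simp only [fsmul_apply, map_smul, LinearMap.smul_apply, smul_eq_mul] at h1
  rw [dirDeriv_mul (hf.mdiffAt _) ((A.metric_smooth ς' τ).mdiffAt _),
    dirDeriv_mul (hf.mdiffAt _) ((A.metric_smooth ς' τ).mdiffAt _), ← h2] at h1
  exact mul_left_cancel₀ hw (add_left_cancel h1)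

/-- The Courant automorphism given by the flow of a time-dependent section. -/
def flowAutomorphism (t s : ℝ) : A.Automorphism where
  base := baseDiffeo hσ hc t s
  fiber x := LinearEquiv.ofBijective (fiberFlow hσ hc t s x) (fiberFlow_bijective hσ hc t s x)
  smooth := by
    refine ((contMDiff_flow hσ hc).comp (contMDiff_const (c := t) |>.prodMk
      (contMDiff_const (c := s) |>.prodMk contMDiff_id))).congr fun p => ?_
    exact (flow_mk hσ hc t s p.proj p.snd).symm
  map_anchor := anchor_fiberFlow hσ hc t s
  map_metric := metric_fiberFlow hσ hc t s
  map_bracket _ _ _ _ := bracket_fiberFlow hσ hc t s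

theorem flowAutomorphism_toMap (t s : ℝ) (p : TotalSpace F V) :
    (flowAutomorphism hσ hc t s).toMap p = flow hσ hc t s p :=
  (flow_mk hσ hc t s p.proj p.snd).symm

end CourantAlgebroid

end FlowAutomorphism

/-! ### Linear differential equations -/

section LinearODE

/-- A solution of a homogeneous linear ODE with continuous coefficients that vanishes at one time
vanishes near this time. -/
theorem eventually_eq_zero_of_linear {ι : Type*} [Fintype ι] {y : ℝ → ι → ℝ}
    {β : ℝ → ι → ι → ℝ} {t₀ : ℝ} (hβ : ∀ i j, ContinuousAt (fun t => β t i j) t₀)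
    (hy : ∀ᶠ t in 𝓝 t₀, ∀ i, HasDerivAt (fun t => y t i) (∑ j, β t i j * y t j) t)
    (h₀ : y t₀ = 0) : ∀ᶠ t in 𝓝 t₀, y t = 0 := by
  obtain ⟨C, hC⟩ : ∃ C : ℝ, ∀ᶠ t in 𝓝 t₀, ∀ i j, |β t i j| ≤ C := by
    refine ⟨∑ i, ∑ j, (|β t₀ i j| + 1), ?_⟩
    refine eventually_all.2 fun i => eventually_all.2 fun j => ?_
    have h1 : ∀ᶠ t in 𝓝 t₀, |β t i j| < |β t₀ i j| + 1 :=
      (hβ i j).abs.eventually (gt_mem_nhds (lt_add_one _))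
    filter_upwards [h1] with t ht
    refine ht.le.trans ?_
    refine (Finset.single_le_sum (f := fun j => |β t₀ i j| + 1) (fun j _ => by positivity)
      (Finset.mem_univ j)).trans ?_
    exact Finset.single_le_sum (f := fun i => ∑ j, (|β t₀ i j| + 1)) (fun j _ => by positivity)
      (Finset.mem_univ i)
  have hC0 : 0 ≤ max C 0 := le_max_right _ _
  have hl : ∀ᶠ t in 𝓝 t₀, LipschitzOnWith (Real.toNNReal (Fintype.card ι * max C 0))
      (fun (z : ι → ℝ) i => ∑ j, β t i j * z j) Set.univ := by
    filter_upwards [hC] with t ht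
    refine LipschitzOnWith.of_dist_le_mul fun z _ z' _ => ?_
    rw [Real.coe_toNNReal _ (by positivity)]
    refine (dist_pi_le_iff (by positivity)).2 fun i => ?_
    rw [Real.dist_eq, ← Finset.sum_sub_distrib]
    refine (Finset.abs_sum_le_sum_abs _ _).trans ?_
    refine (Finset.sum_le_card_nsmul _ _ (max C 0 * dist z z') fun j _ => ?_).trans ?_
    · rw [← mul_sub, abs_mul]
      refine mul_le_mul ((ht i j).trans (le_max_left _ _)) ?_ (abs_nonneg _) hC0
      rw [← Real.dist_eq]
      exact dist_le_pi_dist z z' j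
    · rw [Finset.card_univ, nsmul_eq_mul, mul_assoc]
  exact ODE_solution_unique_of_eventually (s := fun _ => Set.univ) hl
    (hy.mono fun t ht => ⟨hasDerivAt_pi.2 ht, trivial⟩)
    (.of_forall fun t => ⟨(hasDerivAt_const t (0 : ι → ℝ)).congr_deriv (by ext; simp), trivial⟩)
    h₀

end LinearODE

/-! ### Invariant Lagrangian subbundles -/

section InvariantSubbundles

variable {EM : Type*} [NormedAddCommGroup EM] [NormedSpace ℝ EM] [FiniteDimensional ℝ EM]
  {M : Type*} [TopologicalSpace M] [T2Space M] [ChartedSpace EM M] [IsManifold 𝓘(ℝ, EM) ∞ M]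
  {F : Type*} [NormedAddCommGroup F] [NormedSpace ℝ F] [FiniteDimensional ℝ F]
  {V : M → Type*} [TopologicalSpace (TotalSpace F V)]
  [∀ x, AddCommGroup (V x)] [∀ x, Module ℝ (V x)] [∀ x, TopologicalSpace (V x)]
  [FiberBundle F V] [VectorBundle ℝ F V] [ContMDiffVectorBundle ∞ F V 𝓘(ℝ, EM)]
  {A : CourantAlgebroid EM F V}

namespace CourantAlgebroid

theorem SmoothSecFamily.contMDiff_metric {u w : ℝ → Sec EM F V} (hu : A.SmoothSecFamily u)
    (hw : A.SmoothSecFamily w) : ContMDiff (𝓘(ℝ, ℝ).prod 𝓘(ℝ, EM)) 𝓘(ℝ, ℝ) ∞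
      (fun p : ℝ × M => A.metric p.2 (u p.1 p.2) (w p.1 p.2)) :=
  hw.contMDiff_apply (B := fun p => A.metric p.2 (u p.1 p.2)) hu

theorem SmoothSecFamily.deriv {u u' : ℝ → Sec EM F V} (hu : A.SmoothSecFamily u)
    (h : ∀ t, A.HasSecDerivAt u (u' t) t) : A.SmoothSecFamily u' := fun τ =>
  (contMDiff_deriv_family (hu τ)).congr fun p => ((h p.1 p.2 (τ p.2)).deriv).symm

theorem SmoothSecFamily.add {u w : ℝ → Sec EM F V} (hu : A.SmoothSecFamily u)
    (hw : A.SmoothSecFamily w) : A.SmoothSecFamily (fun t => u t + w t) := fun τ =>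
  ((hu τ).add (hw τ)).congr fun p => by simp [ContMDiffSection.coe_add]

/-- Near `(t₀, x₀)`, the family `Q` of subbundles has a smooth frame, contained in a frame of the
whole bundle, whose derivatives `∂_t l + ⟦σ t, l⟧` remain in `Q`. -/
def HasInvariantFrameAt (A : CourantAlgebroid EM F V) (σ : ℝ → Sec EM F V)
    (Q : ℝ → ∀ x, Submodule ℝ (V x)) (t₀ : ℝ) (x₀ : M) : Prop :=
  ∃ (k k' : ℕ) (b : Fin k ⊕ Fin k' → ℝ → Sec EM F V) (b' : Fin k → ℝ → Sec EM F V),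
    (∀ i, A.SmoothSecFamily (b i)) ∧ (∀ i t, A.HasSecDerivAt (b (Sum.inl i)) (b' i t) t) ∧
    (∀ i t x, (b' i t + A.bracket (σ t) (b (Sum.inl i) t)) x ∈ Q t x) ∧
    ∀ᶠ q in 𝓝 (t₀, x₀), LinearIndependent ℝ (fun i => b i q.1 q.2) ∧
      Submodule.span ℝ (Set.range fun i => b i q.1 q.2) = ⊤ ∧
      Submodule.span ℝ (Set.range fun i => b (Sum.inl i) q.1 q.2) = Q q.1 q.2

theorem coeff_inr_eq_zero {E ι ι' : Type*} [AddCommGroup E] [Module ℝ E] [Fintype ι] [Fintype ι']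
    {b : ι ⊕ ι' → E} (hb : LinearIndependent ℝ b) {c : ι ⊕ ι' → ℝ}
    (hc : ∑ i, c i • b i ∈ Submodule.span ℝ (Set.range fun i => b (Sum.inl i))) (j : ι') :
    c (Sum.inr j) = 0 := by
  obtain ⟨d, hd⟩ := (Submodule.mem_span_range_iff_exists_fun ℝ).1 hc
  have h := Fintype.linearIndependent_iff.1 hb (fun i => c i - Sum.elim d 0 i) (by
    simp only [sub_smul, Finset.sum_sub_distrib, Fintype.sum_sum_type, Sum.elim_inl, Sum.elim_inr,
      Pi.zero_apply, zero_smul, Finset.sum_const_zero, add_zero] at hd ⊢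
    rw [hd, sub_self]) (Sum.inr j)
  simpa using h

variable {σ : ℝ → Sec EM F V} (hσ : A.SmoothSecFamily σ) (hc : A.IsCompleteSecFamily σ)

/-- The flow preserves a family of Lagrangian subbundles with invariant frames: the pairings of a
transported vector with the frame satisfy a homogeneous linear ODE. -/
theorem fiberFlow_mem {Q : ℝ → ∀ x, Submodule ℝ (V x)}
    (hQ : ∀ t x (v : V x), v ∈ Q t x ↔ ∀ w ∈ Q t x, A.metric x v w = 0)
    (hfr : ∀ t x, A.HasInvariantFrameAt σ Q t x) (t s : ℝ) (x : M) {v : V x} (hv : v ∈ Q s x) :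
    fiberFlow hσ hc t s x v ∈ Q t (baseFlow hσ hc t s x) := by
  set γ : ℝ → M := fun t => baseFlow hσ hc t s x
  set T : ∀ t, V (γ t) := fun t => fiberFlow hσ hc t s x v
  set S : Set ℝ := {t | T t ∈ Q t (γ t)} with hS
  suffices hSu : S = Set.univ by
    have : t ∈ S := hSu ▸ Set.mem_univ t
    exact this
  have hγ := hasAnchorVelocity_baseFlow hσ hc s x
  have hT := fun t => (isTransportAt_fiberFlow hσ hc s x v t).2
  -- the local description of membership by the vanishing of pairings
  have key : ∀ t₀, ∃ (k : ℕ) (y : ℝ → Fin k → ℝ), ContinuousAt y t₀ ∧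
      (∀ᶠ t in 𝓝 t₀, (t ∈ S ↔ y t = 0)) ∧ (y t₀ = 0 → ∀ᶠ t in 𝓝 t₀, y t = 0) := fun t₀ => by
    obtain ⟨k, k', b, b', hb, hb', hz, hfr⟩ := hfr t₀ (γ t₀)
    set z : Fin k → ℝ → Sec EM F V := fun i t => b' i t + A.bracket (σ t) (b (Sum.inl i) t)
    have hzs : ∀ i, A.SmoothSecFamily (z i) := fun i =>
      ((hb _).deriv (hb' i)).add (hσ.bracket_family (hb _))
    set y : ℝ → Fin k → ℝ := fun t i => A.metric (γ t) (T t) (b (Sum.inl i) t (γ t))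
    have hyd : ∀ t i, HasDerivAt (fun t => y t i) (A.metric (γ t) (T t) (z i t (γ t))) t :=
      fun t i => by
        have h := (hT t).hasDerivAt_metric (hγ t) ((hb' i t).hasCovDerivAt (hb _) (hγ t))
        refine h.congr_deriv ?_
        rw [map_zero, LinearMap.zero_apply, zero_add]
    have hgr : ContinuousAt (fun t => (t, γ t)) t₀ := continuousAt_id.prodMk (hγ t₀).continuousAt
    have hfrt := hgr.eventually hfr
    refine ⟨k, y, continuousAt_pi.2 fun i => (hyd t₀ i).continuousAt, ?_, fun h0 => ?_⟩
    · filter_upwards [hfrt] with t ht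
      refine (hQ t (γ t) (T t)).trans ⟨fun h => ?_, fun h w hw => ?_⟩
      · ext i
        refine h _ ?_
        rw [← ht.2.2]
        exact Submodule.subset_span ⟨i, rfl⟩
      · rw [← ht.2.2] at hw
        induction hw using Submodule.span_induction with
        | zero => simp
        | add u w _ _ hu hw => rw [map_add, hu, hw, add_zero]
        | smul c u _ hu => rw [map_smul, hu, smul_zero]
        | mem u hu =>
          obtain ⟨i, rfl⟩ := hu
          exact congrFun h i
    · have hinv := contMDiffAt_matrix_inv (J := 𝓘(ℝ, ℝ).prod 𝓘(ℝ, EM)) (n := ∞) (p := (t₀, γ t₀))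
        (G := fun q : ℝ × M => A.gram q.2 (fun i => b i q.1 q.2))
        (fun i j => (hb i).contMDiff_metric (hb j) _)
        (A.gram_det_ne_zero hfr.self_of_nhds.1 hfr.self_of_nhds.2.1)
      set coef : ℝ → Fin k → Fin k ⊕ Fin k' → ℝ := fun t i j =>
        ∑ l, (A.gram (γ t) (fun i => b i t (γ t)))⁻¹ j l *
          A.metric (γ t) (z i t (γ t)) (b l t (γ t))
      have hcoef : ∀ i j, ContinuousAt (fun t => coef t i j) t₀ := fun i j => by
        have h1 : ContMDiffAt (𝓘(ℝ, ℝ).prod 𝓘(ℝ, EM)) 𝓘(ℝ, ℝ) ∞ (fun q : ℝ × M =>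
            ∑ l, (A.gram q.2 (fun i => b i q.1 q.2))⁻¹ j l *
              A.metric q.2 (z i q.1 q.2) (b l q.1 q.2)) (t₀, γ t₀) :=
          ContMDiffAt.sum fun l _ => (hinv j l).mul ((hzs i).contMDiff_metric (hb l) _)
        exact h1.continuousAt.comp (f := fun t => (t, γ t)) hgr
      refine eventually_eq_zero_of_linear (β := fun t i j => coef t i (Sum.inl j))
        (fun i j => hcoef i (Sum.inl j)) ?_ h0
      filter_upwards [hfrt] with t ht i
      refine (hyd t i).congr_deriv ?_
      have h1 := A.eq_sum_gram_inv ht.1 ht.2.1 (z i t (γ t))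
      have h2 : ∀ j, coef t i (Sum.inr j) = 0 := coeff_inr_eq_zero ht.1 (by
        rw [ht.2.2]
        exact h1 ▸ hz i t (γ t))
      rw [h1, map_sum, Fintype.sum_sum_type]
      simp only [map_smul, smul_eq_mul]
      have h3 : ∑ j, coef t i (Sum.inr j) * A.metric (γ t) (T t) (b (Sum.inr j) t (γ t)) = 0 :=
        Finset.sum_eq_zero fun j _ => by rw [h2 j, zero_mul]
      exact (congrArg _ h3).trans (add_zero _)
  refine IsClopen.eq_univ ⟨isClosed_of_closure_subset fun t₀ ht₀ => ?_,
    isOpen_iff_mem_nhds.2 fun t₀ ht₀ => ?_⟩ ⟨s, ?_⟩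
  · obtain ⟨k, y, hyc, hyS, -⟩ := key t₀
    refine hyS.self_of_nhds.2 ?_
    have hne : (𝓝[S] t₀).NeBot := mem_closure_iff_nhdsWithin_neBot.1 ht₀
    refine tendsto_nhds_unique_of_eventuallyEq (l := 𝓝[S] t₀)
      (hyc.tendsto.mono_left nhdsWithin_le_nhds) tendsto_const_nhds ?_
    filter_upwards [hyS.filter_mono nhdsWithin_le_nhds, self_mem_nhdsWithin] with t h1 h2
    exact h1.1 h2
  · obtain ⟨k, y, -, hyS, hy0⟩ := key t₀
    filter_upwards [hyS, hy0 (hyS.self_of_nhds.1 ht₀)] with t h1 h2 using h1.2 h2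
  · have h : ∀ p : TotalSpace F V, p = ⟨x, v⟩ → p.snd ∈ Q s p.proj := by
      rintro p rfl
      exact hv
    exact h _ (fiberFlow_self hσ hc s x v)

theorem flowAutomorphism_mapsSubbundle {Q : ℝ → ∀ x, Submodule ℝ (V x)}
    (hQ : ∀ t x (v : V x), v ∈ Q t x ↔ ∀ w ∈ Q t x, A.metric x v w = 0)
    (hfr : ∀ t x, A.HasInvariantFrameAt σ Q t x) (t s : ℝ) :
    (flowAutomorphism hσ hc t s).MapsSubbundle (Q s) (Q t) := by
  intro x
  refine le_antisymm ?_ fun w hw => ?_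
  · rintro _ ⟨v, hv, rfl⟩
    exact fiberFlow_mem hσ hc hQ hfr t s x hv
  · obtain ⟨v, rfl⟩ := (fiberFlow_bijective hσ hc t s x).2 w
    refine ⟨v, ?_, rfl⟩
    have h1 : fiberFlow hσ hc s t (baseFlow hσ hc t s x) (fiberFlow hσ hc t s x v) ∈
      Q s (baseFlow hσ hc s t (baseFlow hσ hc t s x)) := fiberFlow_mem hσ hc hQ hfr s t _ hw
    have h2 : ∀ p q : TotalSpace F V, p = q → p.snd ∈ Q s p.proj → q.snd ∈ Q s q.proj := by
      rintro p q rfl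
      exact id
    refine h2 ⟨baseFlow hσ hc s t (baseFlow hσ hc t s x),
      fiberFlow hσ hc s t (baseFlow hσ hc t s x) (fiberFlow hσ hc t s x v)⟩ ⟨x, v⟩ ?_ h1
    rw [← flow_mk, ← flow_mk, flow_flow, flow_self]

end CourantAlgebroid

end InvariantSubbundles

/-! ### Gauge transformations and projections -/

section Moser

variable {EM : Type*} [NormedAddCommGroup EM] [NormedSpace ℝ EM] [FiniteDimensional ℝ EM]
  {M : Type*} [TopologicalSpace M] [T2Space M] [ChartedSpace EM M] [IsManifold 𝓘(ℝ, EM) ∞ M]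
  {F : Type*} [NormedAddCommGroup F] [NormedSpace ℝ F] [FiniteDimensional ℝ F]
  {V : M → Type*} [TopologicalSpace (TotalSpace F V)]
  [∀ x, AddCommGroup (V x)] [∀ x, Module ℝ (V x)] [∀ x, TopologicalSpace (V x)]
  [FiberBundle F V] [VectorBundle ℝ F V] [ContMDiffVectorBundle ∞ F V 𝓘(ℝ, EM)]
  {A : CourantAlgebroid EM F V}

/-- A smooth subbundle has local frames by global sections of the subbundle. -/
theorem IsSmoothSubbundle.exists_frame {E : ∀ x : M, Submodule ℝ (V x)}
    (hE : IsSmoothSubbundle EM F E) (x₀ : M) : ∃ (k : ℕ) (e : Fin k → Sec EM F V),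
      (∀ i x, e i x ∈ E x) ∧ ∀ᶠ x in 𝓝 x₀, LinearIndependent ℝ (fun i => e i x) ∧
        Submodule.span ℝ (Set.range fun i => e i x) = E x := by
  obtain ⟨k, e, he⟩ := hE x₀
  obtain ⟨u, hu, huo, hxu⟩ := eventually_nhds_iff.1 he
  obtain ⟨ρ, -, hρ⟩ := (SmoothBumpFunction.nhds_basis_tsupport (I := 𝓘(ℝ, EM)) x₀).mem_iff.1
    (huo.mem_nhds hxu)
  refine ⟨k, fun i => fsmul ρ ρ.contMDiff (e i), fun i x => ?_, ?_⟩
  · by_cases hx : x ∈ u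
    · rw [← (hu x hx).2]
      exact Submodule.smul_mem _ _ (Submodule.subset_span ⟨i, rfl⟩)
    · have : ρ x = 0 := image_eq_zero_of_notMem_tsupport fun h => hx (hρ h)
      rw [fsmul_apply, this, zero_smul]
      exact zero_mem _
  · filter_upwards [he, ρ.eventuallyEq_one] with x hx h1
    simpa [h1] using hx

theorem frame_of_isCompl {E ι ι' : Type*} [AddCommGroup E] [Module ℝ E] {P Q : Submodule ℝ E}
    (h : IsCompl P Q) {b : ι ⊕ ι' → E}
    (hu : LinearIndependent ℝ (fun i => b (Sum.inl i)) ∧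
      Submodule.span ℝ (Set.range fun i => b (Sum.inl i)) = P)
    (hw : LinearIndependent ℝ (fun i => b (Sum.inr i)) ∧
      Submodule.span ℝ (Set.range fun i => b (Sum.inr i)) = Q) :
    LinearIndependent ℝ b ∧ Submodule.span ℝ (Set.range b) = ⊤ := by
  have hb : b = Sum.elim (fun i => b (Sum.inl i)) (fun i => b (Sum.inr i)) := by
    ext i; cases i <;> rfl
  rw [hb]
  refine ⟨hu.1.sum_type hw.1 ?_, ?_⟩
  · rw [hu.2, hw.2]
    exact h.disjoint
  · rw [Set.Sum.elim_range, Submodule.span_union, hu.2, hw.2]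
    exact h.sup_eq_top

namespace CourantAlgebroid

theorem metric_gauge (η : TwoForm EM M) (x : M) (v w : V x) :
    A.metric x (A.gauge η x v) w =
      A.metric x v w + η.toFun x (A.anchor x v) (A.anchor x w) := by
  simp [gauge, metric_coanchor]

theorem anchor_gauge (η : TwoForm EM M) (x : M) (v : V x) :
    A.anchor x (A.gauge η x v) = A.anchor x v := by
  simp [gauge, anchor_coanchor]

theorem gauge_injective (η : TwoForm EM M) (x : M) : Function.Injective (A.gauge η x) := by
  refine (injective_iff_map_eq_zero _).2 fun v hv => ?_
  have h1 : A.anchor x v = 0 := by rw [← anchor_gauge η, hv, map_zero]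
  simpa [gauge, h1] using hv

/-- The gauge transform of a section. -/
def gaugeSec (A : CourantAlgebroid EM F V) (η : TwoForm EM M) (l : Sec EM F V) : Sec EM F V :=
  A.secOfMetric (fun x => A.gauge η x (l x)) fun τ => by
    simp only [metric_gauge]
    exact (A.metric_smooth l τ).add (η.smooth (A.anchorField l) (A.anchorField τ))

theorem gaugeSec_apply (η : TwoForm EM M) (l : Sec EM F V) (x : M) :
    A.gaugeSec η l x = A.gauge η x (l x) := rfl

theorem smoothSecFamily_const (l : Sec EM F V) : A.SmoothSecFamily (fun _ => l) := fun τ =>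
  (A.metric_smooth l τ).comp contMDiff_snd

theorem smoothSecFamily_gaugeSec {ν : ℝ → TwoForm EM M} (hν : SmoothTwoFormFamily ν)
    (l : Sec EM F V) : A.SmoothSecFamily (fun s => A.gaugeSec (ν s) l) := fun τ => by
  simp only [gaugeSec_apply, metric_gauge]
  exact (smoothSecFamily_const l τ).add (hν (A.anchorField l) (A.anchorField τ))

theorem smoothSecFamily_coanchorSec {α : ℝ → OneForm EM M} (hα : SmoothOneFormFamily α) :
    A.SmoothSecFamily (fun s => A.coanchorSec (α s)) := fun τ => by
  simp only [coanchorSec_apply, metric_coanchor]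
  exact hα (A.anchorField τ)

/-- If `∂ν/∂s = -dα`, the derivative of a gauge transformed section is its bracket with `a^*α`. -/
theorem hasSecDerivAt_gaugeSec {ν : ℝ → TwoForm EM M} {α : ℝ → OneForm EM M}
    (hνα : ∀ (s : ℝ) (X Y : VField EM M) (x : M),
      HasDerivAt (fun t => (ν t).toFun x (X x) (Y x)) (-((α s).extDeriv X Y x)) s)
    (l : Sec EM F V) (s : ℝ) : A.HasSecDerivAt (fun s => A.gaugeSec (ν s) l)
      (A.bracket (A.coanchorSec (α s)) (A.gaugeSec (ν s) l)) s := fun x v => by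
  obtain ⟨τ, rfl⟩ := exists_sec_apply (EM := EM) (F := F) x v
  have hfield : A.anchorField (A.gaugeSec (ν s) l) = A.anchorField l := by
    ext y
    exact anchor_gauge (ν s) y (l y)
  rw [metric_bracket_coanchorSec, hfield]
  simp only [gaugeSec_apply, metric_gauge]
  exact (hνα s (A.anchorField l) (A.anchorField τ) x).const_add _

/-- The projection of a smooth family of sections along complementary families of subbundles with
smooth frames is smooth. -/
theorem SmoothSecFamily.contMDiff_projection {P Q : ℝ → ∀ x, Submodule ℝ (V x)}
    (h : ∀ t x, IsCompl (P t x) (Q t x))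
    (hfr : ∀ t₀ x₀, ∃ (k k' : ℕ) (b : Fin k ⊕ Fin k' → ℝ → Sec EM F V),
      (∀ i, A.SmoothSecFamily (b i)) ∧ ∀ᶠ q in 𝓝 (t₀, x₀),
        (LinearIndependent ℝ (fun i => b i q.1 q.2) ∧
          Submodule.span ℝ (Set.range fun i => b i q.1 q.2) = ⊤) ∧
        (∀ i, b (Sum.inl i) q.1 q.2 ∈ P q.1 q.2) ∧ ∀ i, b (Sum.inr i) q.1 q.2 ∈ Q q.1 q.2)
    {u : ℝ → Sec EM F V} (hu : A.SmoothSecFamily u) (τ : Sec EM F V) :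
    ContMDiff (𝓘(ℝ, ℝ).prod 𝓘(ℝ, EM)) 𝓘(ℝ, ℝ) ∞ (fun p : ℝ × M =>
      A.metric p.2 ((P p.1 p.2).projection (Q p.1 p.2) (h p.1 p.2) (u p.1 p.2)) (τ p.2)) := by
  intro p
  obtain ⟨k, k', b, hb, hbp⟩ := hfr p.1 p.2
  have hinv := contMDiffAt_matrix_inv (J := 𝓘(ℝ, ℝ).prod 𝓘(ℝ, EM)) (n := ∞) (p := p)
    (G := fun q : ℝ × M => A.gram q.2 (fun i => b i q.1 q.2))
    (fun i j => (hb i).contMDiff_metric (hb j) _)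
    (A.gram_det_ne_zero hbp.self_of_nhds.1.1 hbp.self_of_nhds.1.2)
  have hs : ContMDiffAt (𝓘(ℝ, ℝ).prod 𝓘(ℝ, EM)) 𝓘(ℝ, ℝ) ∞ (fun q : ℝ × M => ∑ i : Fin k,
      (∑ j, (A.gram q.2 (fun i => b i q.1 q.2))⁻¹ (Sum.inl i) j *
        A.metric q.2 (u q.1 q.2) (b j q.1 q.2)) *
      A.metric q.2 (b (Sum.inl i) q.1 q.2) (τ q.2)) p :=
    ContMDiffAt.sum fun i _ => (ContMDiffAt.sum fun j _ => (hinv _ j).mul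
      (hu.contMDiff_metric (hb j) p)).mul (hb _ τ p)
  refine hs.congr_of_eventuallyEq ?_
  filter_upwards [hbp] with q hq
  conv_lhs => rw [A.eq_sum_gram_inv hq.1.1 hq.1.2 (u q.1 q.2)]
  rw [Fintype.sum_sum_type, map_add, map_sum, map_sum]
  simp only [map_smul, Submodule.projection_apply_of_mem_left _ (hq.2.1 _),
    (Submodule.projection_apply_eq_zero_iff _).2 (hq.2.2 _), smul_zero, Finset.sum_const_zero,
    add_zero, map_sum, LinearMap.sum_apply, LinearMap.smul_apply, smul_eq_mul]

end CourantAlgebroid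

end Moser

end MoserManin

end


open MoserManin CourantAlgebroid in
theorem theoremB
    {EM : Type*} [NormedAddCommGroup EM] [NormedSpace ℝ EM] [FiniteDimensional ℝ EM]
    {M : Type*} [TopologicalSpace M] [T2Space M] [SecondCountableTopology M]
    [ChartedSpace EM M] [IsManifold 𝓘(ℝ, EM) ∞ M]
    {F : Type*} [NormedAddCommGroup F] [NormedSpace ℝ F] [FiniteDimensional ℝ F]
    {V : M → Type*} [TopologicalSpace (TotalSpace F V)]
    [∀ x, AddCommGroup (V x)] [∀ x, Module ℝ (V x)] [∀ x, TopologicalSpace (V x)]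
    [FiberBundle F V] [VectorBundle ℝ F V] [ContMDiffVectorBundle ∞ F V 𝓘(ℝ, EM)]
    (A : MoserManin.CourantAlgebroid EM F V)
    (E : ∀ x : M, Submodule ℝ (V x)) (hE : A.IsDirac E)
    (L : ℝ → ∀ x : M, Submodule ℝ (V x)) (hL : ∀ s, A.IsDirac (L s))
    (hEL : ∀ s x, IsCompl (E x) (L s x))
    (ν : ℝ → MoserManin.TwoForm EM M) (hν : MoserManin.SmoothTwoFormFamily ν)
    (hν_closed : ∀ s, (ν s).IsClosed)
    (hν_zero : ∀ x, (ν 0).toFun x = 0)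
    (hgauge : ∀ s x, L s x = (L 0 x).map (A.gauge (ν s) x))
    (α : ℝ → MoserManin.OneForm EM M) (hα : MoserManin.SmoothOneFormFamily α)
    (hνα : ∀ (s : ℝ) (X Y : MoserManin.VField EM M) (x : M),
      HasDerivAt (fun t => (ν t).toFun x (X x) (Y x)) (-((α s).extDeriv X Y x)) s)
    (hcomplete : MoserManin.IsCompleteTimeDependent
      (fun s x => A.poissonSharp (hEL s) x ((α s).toFun x))) :
    ∃ φ : ℝ → A.Automorphism, MoserManin.CourantAlgebroid.SmoothAutomorphismFamily φ ∧
      ∀ s, (φ s).MapsSubbundle E E ∧ (φ s).MapsSubbundle (L s) (L 0) := by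
  -- adapted frames, by sections of `E` and by gauge transforms of sections of `L 0`
  have hframes : ∀ x₀, ∃ (k k' : ℕ) (e : Fin k → Sec EM F V) (l : Fin k' → Sec EM F V),
      (∀ i x, e i x ∈ E x) ∧ (∀ j s x, A.gaugeSec (ν s) (l j) x ∈ L s x) ∧
      ∀ s₀ : ℝ, ∀ᶠ q in 𝓝 (s₀, x₀), (LinearIndependent ℝ (fun i => e i q.2) ∧
        Submodule.span ℝ (Set.range fun i => e i q.2) = E q.2) ∧
        (LinearIndependent ℝ (fun j => A.gaugeSec (ν q.1) (l j) q.2) ∧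
        Submodule.span ℝ (Set.range fun j => A.gaugeSec (ν q.1) (l j) q.2) = L q.1 q.2) :=
    fun x₀ => by
    obtain ⟨k, e, heE, he⟩ := hE.subbundle.exists_frame x₀
    obtain ⟨k', l, hlL, hl⟩ := (hL 0).subbundle.exists_frame x₀
    refine ⟨k, k', e, l, heE, fun j s x => ?_, fun s₀ => ?_⟩
    · rw [hgauge]
      exact Submodule.mem_map_of_mem (hlL j x)
    · filter_upwards [continuous_snd.continuousAt.eventually (he.and hl)] with q hq
      refine ⟨hq.1, hq.2.1.map' _ (LinearMap.ker_eq_bot.2 (gauge_injective (ν q.1) q.2)), ?_⟩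
      rw [hgauge, ← hq.2.2, Submodule.map_span, ← Set.range_comp]
      rfl
  have hcomb : ∀ s₀ x₀, ∃ (k k' : ℕ) (b : Fin k ⊕ Fin k' → ℝ → Sec EM F V),
      (∀ i, A.SmoothSecFamily (b i)) ∧ ∀ᶠ q in 𝓝 (s₀, x₀),
        (LinearIndependent ℝ (fun i => b i q.1 q.2) ∧
          Submodule.span ℝ (Set.range fun i => b i q.1 q.2) = ⊤) ∧
        (∀ i, b (Sum.inl i) q.1 q.2 ∈ L q.1 q.2) ∧ ∀ i, b (Sum.inr i) q.1 q.2 ∈ E q.2 :=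
    fun s₀ x₀ => by
    obtain ⟨k, k', e, l, heE, hlL, h⟩ := hframes x₀
    refine ⟨k', k, Sum.elim (fun j s => A.gaugeSec (ν s) (l j)) (fun i _ => e i), ?_, ?_⟩
    · rintro (j | i)
      · exact smoothSecFamily_gaugeSec hν (l j)
      · exact smoothSecFamily_const (e i)
    · filter_upwards [h s₀] with q hq
      exact ⟨frame_of_isCompl (hEL q.1 q.2).symm hq.2 hq.1, fun j => hlL j q.1 q.2,
        fun i => heE i q.2⟩
  have hα' := smoothSecFamily_coanchorSec (A := A) hα
  -- the components of `a^* α` in `L` and, up to the sign, in `E`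
  have hlam := hα'.contMDiff_projection (P := L) (Q := fun _ => E) (fun s x => (hEL s x).symm) hcomb
  set lam : ℝ → Sec EM F V := fun s => A.secOfMetric _
    fun τ => contMDiff_of_family (hlam τ) s with hlamdef
  have hlamL : ∀ s x, lam s x ∈ L s x := fun s x => Submodule.projection_apply_mem _ _
  set σ : ℝ → Sec EM F V := fun s => lam s - A.coanchorSec (α s) with hσdef
  have hσ : A.SmoothSecFamily σ := fun τ =>
    ((hlam τ).sub (hα' τ)).congr fun p => by
      simp [hσdef, hlamdef, ContMDiffSection.coe_sub]
  have hσE : ∀ s x, σ s x ∈ E x := fun s x => by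
    have h := neg_mem (Submodule.sub_projection_mem (hEL s x).symm (A.coanchor x ((α s).toFun x)))
    rw [neg_sub] at h
    exact h
  have hanchor : ∀ s x, A.anchor x (σ s x) = A.poissonSharp (hEL s) x ((α s).toFun x) :=
    fun s x => by
    change A.anchor x (lam s x - A.coanchor x ((α s).toFun x)) = _
    rw [map_sub, anchor_coanchor, sub_zero]
    rfl
  have hc : A.IsCompleteSecFamily σ := fun s x => by
    obtain ⟨γ, hγ, h⟩ := hcomplete s x
    refine ⟨γ, hγ, fun t => ?_⟩
    unfold HasAnchorVelocity
    rw [hanchor]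
    exact h t
  have hframeE : ∀ t x, A.HasInvariantFrameAt σ (fun _ => E) t x := fun t x => by
    obtain ⟨k, k', e, l, heE, hlL, h⟩ := hframes x
    refine ⟨k, k', Sum.elim (fun i _ => e i) (fun j s => A.gaugeSec (ν s) (l j)), fun _ _ => 0,
      ?_, fun i t x v => ?_, fun i t x => ?_, ?_⟩
    · rintro (i | j)
      · exact smoothSecFamily_const (e i)
      · exact smoothSecFamily_gaugeSec hν (l j)
    · simpa using hasDerivAt_const t (A.metric x (e i x) v)
    · rw [zero_add]
      exact hE.involutive _ _ (hσE t) (heE i) x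
    · filter_upwards [h t] with q hq
      have := frame_of_isCompl (b := fun i => (Sum.elim (fun i _ => e i)
        (fun j s => A.gaugeSec (ν s) (l j)) : Fin k ⊕ Fin k' → ℝ → Sec EM F V) i q.1 q.2)
        (hEL q.1 q.2) hq.1 hq.2
      exact ⟨this.1, this.2, hq.1.2⟩
  have hframeL : ∀ t x, A.HasInvariantFrameAt σ L t x := fun t x => by
    obtain ⟨k, k', e, l, heE, hlL, h⟩ := hframes x
    refine ⟨k', k, Sum.elim (fun j s => A.gaugeSec (ν s) (l j)) (fun i _ => e i),
      fun j s => A.bracket (A.coanchorSec (α s)) (A.gaugeSec (ν s) (l j)),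
      ?_, fun j t => hasSecDerivAt_gaugeSec hνα (l j) t, fun j t x => ?_, ?_⟩
    · rintro (j | i)
      · exact smoothSecFamily_gaugeSec hν (l j)
      · exact smoothSecFamily_const (e i)
    · -- the terms with `a^* α` cancel
      simp only [hσdef, Sum.elim_inl, map_sub, LinearMap.sub_apply, add_sub_cancel]
      exact (hL t).involutive _ _ (hlamL t) (hlL j t) x
    · filter_upwards [h t] with q hq
      have := frame_of_isCompl (b := fun i => (Sum.elim (fun j s => A.gaugeSec (ν s) (l j))
        (fun i _ => e i) : Fin k' ⊕ Fin k → ℝ → Sec EM F V) i q.1 q.2)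
        (hEL q.1 q.2).symm hq.2 hq.1
      exact ⟨this.1, this.2, hq.2.2⟩
  refine ⟨fun s => flowAutomorphism hσ hc 0 s, ?_, fun s => ⟨?_, ?_⟩⟩
  · refine ((contMDiff_flow hσ hc).comp (contMDiff_const (c := (0 : ℝ)).prodMk
      (contMDiff_fst.prodMk contMDiff_snd))).congr fun p => ?_
    exact flowAutomorphism_toMap hσ hc 0 p.1 p.2
  · exact flowAutomorphism_mapsSubbundle hσ hc (fun _ => hE.lagrangian) hframeE 0 s
  · exact flowAutomorphism_mapsSubbundle hσ hc (fun t => (hL t).lagrangian) hframeL 0 s
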